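/- \textbf{Setting.} Let $G$ be a finite set of register values with initial value $g_{init}$, $\Sigma_C=\{\bar r(g),\bar w(g): g\in G\}$, $\Sigma_D=\{r(g),w(g): g\in G\}$, $\Sigma_\nu=\{\nu(g): g\in G\}$, $\Sigma_{D,\nu}=\Sigma_D\cup\Sigma_\nu$, and fix a leader action $\top\in\Sigma_D$. Let $\mathcal A_C$ (contributor) and $\mathcal A_D$ (leader) be pushdown systems over $\Sigma_C$ and $\Sigma_D$, with finite sets of control states $Q_C,Q_D$ and of stack symbols $\Gamma_C,\Gamma_D$; silent ($\varepsilon$-labelled) transitions are allowed. A transition $(q,A)\xrightarrow{a}(q',\beta)$ induces the steps $qA\alpha\xrightarrow{a}q'\beta\alpha$ of the associated transition system ($\mathcal C$, resp. $\mathcal D$), which starts with only the initial symbol on the stack. The transitions of $\mathcal A_C$ are push and pop operations: each replaces the top stack symbol by a word of length at most $2$. \textbf{$(\mathcal C,\mathcal D)$-systems.} A configuration is a triple $(M,t,g)$: a finite multiset $M$ of states of $\mathcal C$, a state $t$ of $\mathcal D$, a value $g\in G$. A step lets the leader, or one of the contributors counted by $M$, make a transition; reads $r(h),\bar r(h)$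 require $h=g$, writes $w(h),\bar w(h)$ change the register value to $h$, and silent transitions leave it unchanged. Runs are initial if they start in $(n[s_{init}],t_{init},g_{init})$ for some $n\in\mathbb N$; a configuration is reachable if a finite initial run ends in it. A Büchi run is an infinite initial run with infinitely many occurrences of $\top$. \textbf{$\mathcal C_N$.} Let $N=2|Q_C|^2|\Gamma_C|+2$. The finite-state system $\mathcal C_N$ has as states the $p\alpha\in Q_C\Gamma_C^*$ with $|\alpha|\le N$, the same initial state as $\mathcal C$, and transitions $p\alpha\xrightarrow{a}q\alpha'$ whenever $p\alpha\xrightarrow{a}q\alpha'\alpha''$ in $\mathcal C$ for some $\alpha''$. \textbf{Capacity systems.} The capacity leader $\mathcal D^\kappa$ has configurations $(K,t,g)$ with $K\subseteq G$, $t$ a state of $\mathcal D$, $g\in G$, and transitions $(K,t,g)\xrightarrow{w(h)}(K,t',h)$ if $t\xrightarrow{w(h)}t'$; $(K,t,g)\xrightarrow{r(h)}(K,t',h)$ if $t\xrightarrow{r(h)}t'$ and $h\in K\cup\{g\}$; $(K,t,g)\xrightarrow{\nu(h)}(K\cup\{h\},t,h)$ if $h\notin K$. The capacity contributor $\mathcal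 C_N^\kappa$ has states $(K,p,g)$ with $p$ a state of $\mathcal C_N$, and transitions $(K,p,g)\xrightarrow{w(h)}(K,p,h)$; $(K,p,g)\xrightarrow{r(h)}(K,p,h)$ if $h\in K\cup\{g\}$; $(K,p,g)\xrightarrow{\nu(h)}(K\cup\{h\},p,h)$; $(K,p,g)\xrightarrow{\bar w(h)}(K,p',h)$ if $p\xrightarrow{\bar w(h)}p'$ in $\mathcal C_N$ and $h\in K$; $(K,p,g)\xrightarrow{\bar r(h)}(K,p',h)$ if $p\xrightarrow{\bar r(h)}p'$ in $\mathcal C_N$ and $h\in K\cup\{g\}$. Silent transitions of $\mathcal D$, resp. $\mathcal C_N$, are inherited and change neither $K$ nor $g$. \textbf{$\omega$-support.} Let $v=v_1\nu(h_1)\cdots v_m\nu(h_m)v_{m+1}$ be non-empty with $v_j\in\Sigma_D^*$ and $h_1,\dots,h_m$ pairwise different, and let $g$ be the register value of the last letter of $v$. The word $v$ is $\omega$-supported from states $p_1,\dots,p_m$ of $\mathcal C_N$ if for every $1\le i\le m$ there is a word $u^i\in(\Sigma_C\cup\Sigma_{D,\nu})^*$ of the form $$u^i=u^i_1\nu(h_1)\cdots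 u^i_i\,\nu(h_i)\,\bar w(h_i)\,u^i_{i+1}\nu(h_{i+1})\cdots u^i_m\nu(h_m)u^i_{m+1}$$ whose projection to $\Sigma_{D,\nu}$ is $v$ and which labels a run $(\emptyset,p_i,g)\to(K,p_i,g)$ of $\mathcal C_N^\kappa$ for some $K$. \textbf{Lemma.} The $(\mathcal C,\mathcal D)$-system has a Büchi run if and only if there are a configuration $(M,qA\alpha,g)$ reachable in the $(\mathcal C_N,\mathcal D)$-system, with $q\in Q_D$, $A\in\Gamma_D$, $\alpha\in\Gamma_D^*$, $g\in G$, and a word $v\in\Sigma_{D,\nu}^*$ such that (1) $\mathcal D^\kappa$ has a run $(\emptyset,qA,g)\xrightarrow{v}(K,qA\alpha',g)$ for some $K\subseteq G$ and $\alpha'\in\Gamma_D^*$, and $\top$ appears in $v$; and (2) $v$ is $\omega$-supported from some states $p_1,\dots,p_m$ of $\mathcal C_N$ with $[p_1,\dots,p_m]\le M$. -/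

import Mathlib

/-- Register actions of the leader: `r(g)` and `w(g)`. -/
inductive LeaderAct (G : Type*) where
  | r (g : G)
  | w (g : G)

/-- Register actions of a contributor: `r̄(g)` and `w̄(g)`. -/
inductive ContribAct (G : Type*) where
  | r (g : G)
  | w (g : G)

/-- The letters of `Σ_{C,D,ν}`: actions of the leader, actions of the contributors, and the
first contributor writes `ν(g)`. -/
inductive Letter (G : Type*) where
  | leader (a : LeaderAct G)
  | contrib (a : ContribAct G)
  | nu (g : G)

namespace Letter

/-- The register value that a letter mentions. -/
def value {G : Type*} : Letter G → G
  | leader (.r g) => g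
  | leader (.w g) => g
  | contrib (.r g) => g
  | contrib (.w g) => g
  | nu g => g

/-- Membership in the sub-alphabet `Σ_{D,ν}`. -/
def inDNu {G : Type*} : Letter G → Bool
  | leader _ => true
  | contrib _ => false
  | nu _ => true

end Letter

/-- `last(v)`: the register value of the last letter of `v` (`none` for the empty word). -/
def lastValue {G : Type*} (v : List (Letter G)) : Option G :=
  v.getLast?.map Letter.value

/-- A transition system with states `S` and alphabet `A`; the label `none` is a silent step
(an `ε`-transition). -/
structure TransSys (A S : Type*) where
  tr : S → Option A → S → Prop
  init : S

/-- `T.Path s u s'`: there is a finite path from `s` to `s'` labelled by the word `u`. -/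
inductive TransSys.Path {A S : Type*} (T : TransSys A S) : S → List A → S → Prop
  | nil (s : S) : TransSys.Path T s [] s
  | silent {s t s' : S} {u : List A} :
      T.tr s none t → TransSys.Path T t u s' → TransSys.Path T s u s'
  | cons {s t s' : S} {a : A} {u : List A} :
      T.tr s (some a) t → TransSys.Path T t u s' → TransSys.Path T s (a :: u) s'

/-- A pushdown system with input alphabet `A`, control states `Q` and stack alphabet `Γ`.
A transition `((q, X), a, (q', β))` reads `a` (or nothing, if `a = none`), goes from `q` to `q'`
and replaces the topmost stack symbol `X` by the word `β`. -/
structure Pushdown (A Q Γ : Type*) where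
  trans : Set ((Q × Γ) × Option A × (Q × List Γ))
  init : Q
  initSym : Γ

namespace Pushdown

variable {A Q Γ : Type*}

/-- `qXα →a q'βα` for every transition `((q, X), a, (q', β))`; stacks are written top first. -/
def Step (P : Pushdown A Q Γ) (s : Q × List Γ) (a : Option A) (s' : Q × List Γ) : Prop :=
  ∃ q X α q' β, s = (q, X :: α) ∧ s' = (q', β ++ α) ∧ ((q, X), a, (q', β)) ∈ P.trans

/-- The transition system associated with a pushdown system. -/
def toTransSys (P : Pushdown A Q Γ) : TransSys A (Q × List Γ) where
  tr := P.Step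
  init := (P.init, [P.initSym])

/-- The system `P_N`: its states are the configurations with at most `N` stack symbols, and
`pα →a qα'` when `pα →a qα'α''` in `P` for some `α''`. -/
def truncated (P : Pushdown A Q Γ) (N : ℕ) (hN : 0 < N) :
    TransSys A {s : Q × List Γ // s.2.length ≤ N} where
  tr s a s' := ∃ α'' : List Γ, P.Step s.1 a (s'.1.1, s'.1.2 ++ α'')
  init := ⟨(P.init, [P.initSym]), hN⟩

/-- Every transition is a pop, a rewriting of the topmost symbol, or the push of one symbol:
the topmost symbol is replaced by a word of length at most two. -/
def PushPop (P : Pushdown A Q Γ) : Prop :=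
  ∀ τ ∈ P.trans, τ.2.2.2.length ≤ 2

end Pushdown

/-- The bound `2|Q|²|Γ| + 2`. -/
def stackBound (Q Γ : Type*) [Fintype Q] [Fintype Γ] : ℕ :=
  2 * Fintype.card Q ^ 2 * Fintype.card Γ + 2

theorem stackBound_pos (Q Γ : Type*) [Fintype Q] [Fintype Γ] : 0 < stackBound Q Γ :=
  Nat.succ_pos _

/-- The finite-state contributor system `C_N` with `N = 2|Q|²|Γ| + 2`. -/
def Pushdown.finiteContrib {A Q Γ : Type*} [Fintype Q] [Fintype Γ] (P : Pushdown A Q Γ) :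
    TransSys A {s : Q × List Γ // s.2.length ≤ stackBound Q Γ} :=
  P.truncated (stackBound Q Γ) (stackBound_pos Q Γ)

section CDSystems

variable {G S T : Type*}

/-- The step `M →a M'` that one contributor of the multiset `M` performs. -/
def MultiStep (C : TransSys (ContribAct G) S)
    (M : Multiset S) (a : Option (ContribAct G)) (M' : Multiset S) : Prop :=
  ∃ s s' R, C.tr s a s' ∧ M = s ::ₘ R ∧ M' = s' ::ₘ R

/-- The transitions of the `(C,D)`-system on configurations `(M, t, g)`. Silent steps of a
process leave the register unchanged. -/
inductive CDStep (C : TransSys (ContribAct G) S) (D : TransSys (LeaderAct G) T) :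
    Multiset S × T × G → Option (Letter G) → Multiset S × T × G → Prop
  | leaderWrite {M t t' g h} :
      D.tr t (some (.w h)) t' → CDStep C D (M, t, g) (some (.leader (.w h))) (M, t', h)
  | leaderRead {M t t' h} :
      D.tr t (some (.r h)) t' → CDStep C D (M, t, h) (some (.leader (.r h))) (M, t', h)
  | leaderSilent {M t t' g} :
      D.tr t none t' → CDStep C D (M, t, g) none (M, t', g)
  | contribWrite {M M' t g h} :
      MultiStep C M (some (.w h)) M' →
      CDStep C D (M, t, g) (some (.contrib (.w h))) (M', t, h)
  | contribRead {M M' t h} :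
      MultiStep C M (some (.r h)) M' →
      CDStep C D (M, t, h) (some (.contrib (.r h))) (M', t, h)
  | contribSilent {M M' t g} :
      MultiStep C M none M' → CDStep C D (M, t, g) none (M', t, g)

/-- The initial configuration `(n[s_init], t_init, g_init)` with `n` contributors. -/
def initConfig (C : TransSys (ContribAct G) S) (D : TransSys (LeaderAct G) T) (ginit : G)
    (n : ℕ) : Multiset S × T × G :=
  (Multiset.replicate n C.init, D.init, ginit)

/-- Reachability of a configuration of the `(C,D)`-system by a finite initial run, for some
number of contributors. -/
def CDReachable (C : TransSys (ContribAct G) S) (D : TransSys (LeaderAct G) T) (ginit : G)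
    (c : Multiset S × T × G) : Prop :=
  ∃ n : ℕ, Relation.ReflTransGen (fun c₁ c₂ => ∃ a, CDStep C D c₁ a c₂)
    (initConfig C D ginit n) c

/-- The `(C,D)`-system has a Büchi run: an infinite initial run, for some number of
contributors, with infinitely many occurrences of the leader action `top`. -/
def HasBuchiRun (C : TransSys (ContribAct G) S) (D : TransSys (LeaderAct G) T) (ginit : G)
    (top : LeaderAct G) : Prop :=
  ∃ (n : ℕ) (c : ℕ → Multiset S × T × G) (a : ℕ → Option (Letter G)),
    c 0 = initConfig C D ginit n ∧
    (∀ k, CDStep C D (c k) (a k) (c (k + 1))) ∧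
    {k | a k = some (.leader top)}.Infinite

/-- The transitions of the capacity leader `D^κ` on configurations `(K, t, g)`. -/
inductive CapLeaderStep (D : TransSys (LeaderAct G) T) :
    Set G × T × G → Option (Letter G) → Set G × T × G → Prop
  | write {K t t' g h} :
      D.tr t (some (.w h)) t' → CapLeaderStep D (K, t, g) (some (.leader (.w h))) (K, t', h)
  | read {K t t' g h} :
      D.tr t (some (.r h)) t' → h ∈ K ∪ {g} →
      CapLeaderStep D (K, t, g) (some (.leader (.r h))) (K, t', h)
  | silent {K t t' g} :
      D.tr t none t' → CapLeaderStep D (K, t, g) none (K, t', g)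
  | nu {K t g h} :
      h ∉ K → CapLeaderStep D (K, t, g) (some (.nu h)) (K ∪ {h}, t, h)

/-- The capacity leader `D^κ`. -/
def capLeader (D : TransSys (LeaderAct G) T) (ginit : G) :
    TransSys (Letter G) (Set G × T × G) where
  tr := CapLeaderStep D
  init := (∅, D.init, ginit)

/-- The transitions of the capacity contributor `C^κ` on states `(K, p, g)`. It follows the
actions of `D^κ`, so a leader read of `h` is possible when `h ∈ K ∪ {g}`. -/
inductive CapContribStep (C : TransSys (ContribAct G) S) :
    Set G × S × G → Option (Letter G) → Set G × S × G → Prop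
  | leaderWrite {K p g h} :
      CapContribStep C (K, p, g) (some (.leader (.w h))) (K, p, h)
  | leaderRead {K p g h} :
      h ∈ K ∪ {g} → CapContribStep C (K, p, g) (some (.leader (.r h))) (K, p, h)
  | nu {K p g h} :
      CapContribStep C (K, p, g) (some (.nu h)) (K ∪ {h}, p, h)
  | contribWrite {K p p' g h} :
      C.tr p (some (.w h)) p' → h ∈ K →
      CapContribStep C (K, p, g) (some (.contrib (.w h))) (K, p', h)
  | contribRead {K p p' g h} :
      C.tr p (some (.r h)) p' → h ∈ K ∪ {g} →
      CapContribStep C (K, p, g) (some (.contrib (.r h))) (K, p', h)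
  | contribSilent {K p p' g} :
      C.tr p none p' → CapContribStep C (K, p, g) none (K, p', g)

/-- The capacity contributor `C^κ`. -/
def capContrib (C : TransSys (ContribAct G) S) (ginit : G) :
    TransSys (Letter G) (Set G × S × G) where
  tr := CapContribStep C
  init := (∅, C.init, ginit)

/-- The word `v` is `ω`-supported from the states `p 0, …, p (m-1)` of `C`:

* `v = v₀ ν(h₀) v₁ ν(h₁) ⋯ ν(h_{m-1}) v_m` with every `v_j` a word of leader actions and the
  `h_j` pairwise different, and, with `g = last(v)`,
* for every `i` there is a word
  `u = u₀ ν(h₀) ⋯ u_i ν(h_i) w̄(h_i) u_{i+1} ν(h_{i+1}) ⋯ ν(h_{m-1}) u_m` whose projection to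
  `Σ_{D,ν}` is `v` and that labels a run `(∅, p i, g) → (K, p i, g)` of `C^κ`. -/
def OmegaSupported (C : TransSys (ContribAct G) S) (ginit : G) (v : List (Letter G))
    {m : ℕ} (p : Fin m → S) : Prop :=
  ∃ (h : Fin m → G) (w : Fin (m + 1) → List (LeaderAct G)) (g : G),
    Function.Injective h ∧
    v = (List.ofFn fun j : Fin m =>
          (w j.castSucc).map Letter.leader ++ [Letter.nu (h j)]).flatten
        ++ (w (Fin.last m)).map Letter.leader ∧
    lastValue v = some g ∧
    ∀ i : Fin m, ∃ (u : List (Letter G)) (x : Fin (m + 1) → List (Letter G)) (K : Set G),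
      u = (List.ofFn fun j : Fin m =>
            x j.castSucc ++ [Letter.nu (h j)]
              ++ (if j = i then [Letter.contrib (.w (h i))] else [])).flatten
          ++ x (Fin.last m) ∧
      u.filter Letter.inDNu = v ∧
      (capContrib C ginit).Path (∅, p i, g) u (K, p i, g)

end CDSystems

/-!
The criterion trades the unbounded parts of a Büchi run for a cycle that can be checked locally: the
leader reads values as if every value of the capacity, once written, stayed available, and for each
of these values one contributor is followed.

*From a cycle to a Büchi run* (`hasBuchiRun_of_supported_cycle`). Contributors can be copied: copies
repeat what the original does, immediately after it, and reading or writing twice is harmless. While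
the capacity cycle `v` is imitated, a read of a value of the capacity is preceded by a real write of
one of the copies that were left waiting in front of their write. The number of these writes is
bounded by the length of the imitation, not by the number of copies (`Replay`), so that enough copies
can be provided beforehand. The copies that have made their write do so at a point in the middle of
the cycle, and have missed the rest of it; so there are two crowds for each value. While the first
follows `v` up to `ν(h)` and is then spent on writes, the second, which waits after its write of the
previous repetition, takes over and follows the remainder of `v`. After one repetition the crowds
have changed places, and the leader's stack has the same topmost symbol. The truncated contributors
obtained in this way are imitated by the pushdown contributors with more symbols at the bottom of
their stacks (`HasBuchiRun.of_truncated`).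

*From a Büchi run to a cycle* (`exists_supported_cycle`). Give the contributors of the run names. A
part of the run of a pushdown contributor that never goes below its initial stack height can be
shortened to a run of the truncated system, in such a way that one chosen step is kept
(`lazyRun_of_performs`): symbols that are never popped need not be stored, and a symbol that is
popped is handled by a derivation tree in which no type, consisting of two control states and a
symbol, is repeated on a branch. The branch to the chosen step and the trees beside it need at most
`|Q|²|Γ|` symbols each, whence the bound `2|Q|²|Γ| + 2`. The shortened run skips actions, but keeps
those it performs at their times; skipping is harmless as long as each write is still performed by
somebody, and another copy can be provided for each write.

Since the shortened runs begin and end at times after which the stack is never lower, a cycle is cut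
out between two `Checkpoint`s that agree in the register, in the topmost part of the leader's
configuration at such a time, and in the truncated states of the contributors that are the next to
write the recurrent values. There are finitely many types of checkpoints, so that two checkpoints of
the same type exist (`exists_recurrent_checkpoint`). Between them, the leader traverses a cycle of
the capacity leader (`Checkpoint.exists_leader_cycle`), and the contributor in charge of `h`, with
its first write of `h` retained, traverses a cycle of the capacity contributor
(`Checkpoint.exists_contrib_cycle`). A checkpoint is placed just after a leader action, because only
leader actions and first writes determine the register of the capacity systems.
-/

open Relation

/-! ### Paths -/

namespace TransSys

variable {A S : Type*} {T : TransSys A S}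

theorem Path.append {s t s' : S} {u v : List A} (h : T.Path s u t) (h' : T.Path t v s') :
    T.Path s (u ++ v) s' := by
  induction h with
  | nil => exact h'
  | silent hs _ ih => exact .silent hs (ih h')
  | cons hs _ ih => exact .cons hs (ih h')

theorem Path.of_tr {s s' : S} {a : Option A} (h : T.tr s a s') : T.Path s a.toList s' := by
  cases a with
  | none => exact .silent h (.nil _)
  | some a => exact .cons h (.nil _)

theorem Path.reflTransGen {s s' : S} {u : List A} (h : T.Path s u s') :
    ReflTransGen (fun x y => ∃ a, T.tr x a y) s s' := by
  induction h with
  | nil => exact .refl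
  | silent hs _ ih => exact .head ⟨_, hs⟩ ih
  | cons hs _ ih => exact .head ⟨_, hs⟩ ih

theorem exists_path_of_reflTransGen {s s' : S}
    (h : ReflTransGen (fun x y => ∃ a, T.tr x a y) s s') : ∃ u, T.Path s u s' := by
  induction h with
  | refl => exact ⟨_, .nil _⟩
  | tail _ hs ih =>
    obtain ⟨u, hu⟩ := ih
    obtain ⟨a, ha⟩ := hs
    exact ⟨_, hu.append (.of_tr ha)⟩

theorem Path.split {s s' : S} {u v : List A} (h : T.Path s (u ++ v) s') :
    ∃ t, T.Path s u t ∧ T.Path t v s' := by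
  generalize hw : u ++ v = w at h
  induction h generalizing u with
  | nil s =>
    obtain ⟨rfl, rfl⟩ := List.append_eq_nil_iff.1 hw
    exact ⟨_, .nil _, .nil _⟩
  | silent hs _ ih =>
    obtain ⟨t, h1, h2⟩ := ih hw
    exact ⟨t, .silent hs h1, h2⟩
  | cons hs hp ih =>
    cases u with
    | nil => exact ⟨_, .nil _, by subst hw; exact .cons hs hp⟩
    | cons b u =>
      obtain ⟨rfl, hw'⟩ := List.cons_eq_cons.1 hw
      obtain ⟨t, h1, h2⟩ := ih hw'
      exact ⟨t, .cons hs h1, h2⟩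

/-- A step with letter `a` inside a path, isolated from the silent steps before it. -/
theorem Path.split_cons {s s' : S} {a : A} {v : List A} (h : T.Path s (a :: v) s') :
    ∃ t t', T.Path s [] t ∧ T.tr t (some a) t' ∧ T.Path t' v s' := by
  generalize hw : a :: v = w at h
  induction h with
  | nil s => cases hw
  | silent hs _ ih =>
    obtain ⟨t, t', h1, h2, h3⟩ := ih hw
    exact ⟨t, t', .silent hs h1, h2, h3⟩
  | cons hs hp ih =>
    obtain ⟨rfl, rfl⟩ := List.cons_eq_cons.1 hw
    exact ⟨_, _, .nil _, hs, hp⟩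

end TransSys

/-! ### Copying contributors -/

namespace Pushdown

variable {A Q Γ : Type*}

theorem Step.lift {P : Pushdown A Q Γ} {s s' : Q × List Γ} {a : Option A} (h : P.Step s a s')
    (γ : List Γ) : P.Step (s.1, s.2 ++ γ) a (s'.1, s'.2 ++ γ) := by
  obtain ⟨q, X, α, q', β, rfl, rfl, ht⟩ := h
  exact ⟨q, X, α ++ γ, q', β, by simp, by simp, ht⟩

end Pushdown

section Systems

variable {G S T : Type*}

/-- The effect of a contributor action on the register: `ContribReg l g g'` says that `l` can be
performed when the register holds `g`, and that the register then holds `g'`. -/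
inductive ContribReg : Option (ContribAct G) → G → G → Prop
  | silent (g : G) : ContribReg none g g
  | read (h : G) : ContribReg (some (.r h)) h h
  | write (g h : G) : ContribReg (some (.w h)) g h

/-- The effect of a leader action on the register. -/
inductive LeaderReg : Option (LeaderAct G) → G → G → Prop
  | silent (g : G) : LeaderReg none g g
  | read (h : G) : LeaderReg (some (.r h)) h h
  | write (g h : G) : LeaderReg (some (.w h)) g h

variable {C : TransSys (ContribAct G) S} {D : TransSys (LeaderAct G) T}

theorem CDStep.of_contrib {M M' : Multiset S} {t : T} {l : Option (ContribAct G)} {g g' : G}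
    (hM : MultiStep C M l M') (hg : ContribReg l g g') :
    CDStep C D (M, t, g) (l.map Letter.contrib) (M', t, g') := by
  cases hg with
  | silent => exact .contribSilent hM
  | read => exact .contribRead hM
  | write => exact .contribWrite hM

theorem CDStep.of_leader {M : Multiset S} {t t' : T} {l : Option (LeaderAct G)} {g g' : G}
    (ht : D.tr t l t') (hg : LeaderReg l g g') :
    CDStep C D (M, t, g) (l.map Letter.leader) (M, t', g') := by
  cases hg with
  | silent => exact .leaderSilent ht
  | read => exact .leaderRead ht
  | write => exact .leaderWrite ht

/-- The `(C,D)`-system as a transition system. Only its paths are of interest; the initial state,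
without contributors, plays no role. -/
def cdSys (C : TransSys (ContribAct G) S) (D : TransSys (LeaderAct G) T) (ginit : G) :
    TransSys (Letter G) (Multiset S × T × G) where
  tr := CDStep C D
  init := initConfig C D ginit 0

/-- Copies of one contributor can repeat, one after the other, an action that leaves the
register as it is. -/
theorem exists_path_copies {ginit g : G} {s s' : S} {l : Option (ContribAct G)}
    (hs : C.tr s l s') (hg : ContribReg l g g) (t : T) (n : ℕ) (R : Multiset S) :
    ∃ u, (cdSys C D ginit).Path (n • {s} + R, t, g) u (n • {s'} + R, t, g) := by
  induction n generalizing R with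
  | zero => exact ⟨[], by simpa using TransSys.Path.nil _⟩
  | succ n ih =>
    obtain ⟨u, hu⟩ := ih ({s} + R)
    have hstep : (cdSys C D ginit).tr (n • {s'} + ({s} + R), t, g) (l.map Letter.contrib)
        (n • {s'} + ({s'} + R), t, g) :=
      CDStep.of_contrib ⟨s, s', n • {s'} + R, hs, by
        rw [← Multiset.singleton_add]; abel, by rw [← Multiset.singleton_add]; abel⟩ hg
    refine ⟨u ++ (l.map Letter.contrib).toList, ?_⟩
    rw [show (n + 1) • ({s} : Multiset S) + R = n • {s} + ({s} + R) by rw [succ_nsmul]; abel,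
      show (n + 1) • ({s'} : Multiset S) + R = n • {s'} + ({s'} + R) by rw [succ_nsmul]; abel]
    exact hu.append (.of_tr hstep)

/-- `n`-fold copies of all contributors can follow a path, each of the copies
repeating what the original does. -/
theorem exists_path_nsmul {ginit : G} {n : ℕ} {c c' : Multiset S × T × G} (hn : n ≠ 0)
    (h : ReflTransGen (fun c₁ c₂ => ∃ a, CDStep C D c₁ a c₂) c c') :
    ∃ u, (cdSys C D ginit).Path (n • c.1, c.2) u (n • c'.1, c'.2) := by
  induction h with
  | refl => exact ⟨[], .nil _⟩
  | tail _ hs ih =>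
    obtain ⟨u, hu⟩ := ih
    suffices H : ∀ c₁ a c₂, CDStep C D c₁ a c₂ →
        ∃ w, (cdSys C D ginit).Path (n • c₁.1, c₁.2) w (n • c₂.1, c₂.2) by
      obtain ⟨a, ha⟩ := hs
      obtain ⟨w, hw⟩ := H _ _ _ ha
      exact ⟨_, hu.append hw⟩
    intro c₁ a c₂ hc
    have key : ∀ {M M' : Multiset S} {l : Option (ContribAct G)} {t : T} {g g' : G},
        MultiStep C M l M' → ContribReg l g g' →
        ∃ w, (cdSys C D ginit).Path (n • M, t, g) w (n • M', t, g') := by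
      intro M M' l t g g' hM hg
      obtain ⟨s, s', R, ht, rfl, rfl⟩ := hM
      obtain ⟨k, rfl⟩ := Nat.exists_eq_succ_of_ne_zero hn
      -- after the first copy the action leaves the register as it is
      have hg' : ContribReg l g' g' := by cases hg <;> constructor
      have h1 : (cdSys C D ginit).tr ((k + 1) • (s ::ₘ R), t, g) (l.map Letter.contrib)
          (k • {s} + ({s'} + (k + 1) • R), t, g') :=
        CDStep.of_contrib ⟨s, s', k • {s} + (k + 1) • R, ht, by
          simp only [← Multiset.singleton_add, nsmul_add, add_nsmul, one_nsmul]
          abel, by rw [← Multiset.singleton_add]; abel⟩ hg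
      obtain ⟨w, hw⟩ := exists_path_copies (D := D) (ginit := ginit) ht hg' t k
        ({s'} + (k + 1) • R)
      refine ⟨_, (TransSys.Path.of_tr h1).append (v := w) ?_⟩
      convert hw using 2
      simp only [← Multiset.singleton_add, nsmul_add, Nat.succ_eq_add_one, add_nsmul, one_nsmul]
      abel
    cases hc with
    | leaderWrite h => exact ⟨_, .of_tr (T := cdSys C D ginit) (.leaderWrite h)⟩
    | leaderRead h => exact ⟨_, .of_tr (T := cdSys C D ginit) (.leaderRead h)⟩
    | leaderSilent h => exact ⟨_, .of_tr (T := cdSys C D ginit) (.leaderSilent h)⟩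
    | contribWrite h => exact key h (.write _ _)
    | contribRead h => exact key h (.read _)
    | contribSilent h => exact key h (.silent _)

theorem CDReachable.nsmul {ginit : G} {n : ℕ} {c : Multiset S × T × G} (hn : n ≠ 0)
    (h : CDReachable C D ginit c) : CDReachable C D ginit (n • c.1, c.2) := by
  obtain ⟨k, hk⟩ := h
  obtain ⟨u, hu⟩ := exists_path_nsmul (ginit := ginit) hn hk
  refine ⟨n * k, ?_⟩
  have := hu.reflTransGen
  simpa [initConfig, cdSys, Multiset.nsmul_replicate] using this

end Systems

/-! ### Following a word of the capacity leader -/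

section Follows

variable {G S T : Type*}

/-- A contributor step that is possible when the register holds `g` and leaves it at `g`. -/
def QuietStep (C : TransSys (ContribAct G) S) (g : G) (s s' : S) : Prop :=
  ∃ l, C.tr s l s' ∧ ContribReg l g g

/-- A contributor step that is silent or reads or writes a value of `K`. -/
def ActiveStep (C : TransSys (ContribAct G) S) (K : Set G) (s s' : S) : Prop :=
  ∃ l, C.tr s l s' ∧ (l = none ∨ ∃ h ∈ K, ContribReg l h h)

theorem QuietStep.active {C : TransSys (ContribAct G) S} {g : G} {K : Set G} {s s' : S}
    (h : QuietStep C g s s') (hg : g ∈ K) : ActiveStep C K s s' := by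
  obtain ⟨l, hl, hr⟩ := h
  exact ⟨l, hl, .inr ⟨g, hg, hr⟩⟩

/-- `Follows C h₀ a z K g s v s' g'`: a contributor in state `s` can accompany the word `v`, which
is read with capacity `K` and register `g`, and arrives in `s'` with register `g'`. Between two
letters it first makes steps that do not disturb the register and then steps on values of `K`; the
second kind is excluded before a letter that depends on the value in the register. At `ν(h₀)` it
has to be in state `a`, and is replaced there by a contributor in state `z`. -/
inductive Follows (C : TransSys (ContribAct G) S) (h₀ : G) (a z : S) :
    Set G → G → S → List (Letter G) → S → G → Prop
  | quiet {K g s s'} :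
      ReflTransGen (QuietStep C g) s s' → Follows C h₀ a z K g s [] s' g
  | active {K g s s₁ s' g'} :
      ReflTransGen (QuietStep C g) s s₁ → ReflTransGen (ActiveStep C K) s₁ s' → g' ∈ K →
      Follows C h₀ a z K g s [] s' g'
  | write {K g s s₁ s₂ h v s' g'} :
      ReflTransGen (QuietStep C g) s s₁ → ReflTransGen (ActiveStep C K) s₁ s₂ →
      Follows C h₀ a z K h s₂ v s' g' →
      Follows C h₀ a z K g s (.leader (.w h) :: v) s' g'
  | readQuiet {K h s s₁ v s' g'} :
      ReflTransGen (QuietStep C h) s s₁ → Follows C h₀ a z K h s₁ v s' g' →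
      Follows C h₀ a z K h s (.leader (.r h) :: v) s' g'
  | readActive {K g s s₁ s₂ h v s' g'} :
      ReflTransGen (QuietStep C g) s s₁ → ReflTransGen (ActiveStep C K) s₁ s₂ → h ∈ K →
      Follows C h₀ a z K h s₂ v s' g' →
      Follows C h₀ a z K g s (.leader (.r h) :: v) s' g'
  | nu {K g s s₁ s₂ h v s' g'} :
      ReflTransGen (QuietStep C g) s s₁ → ReflTransGen (ActiveStep C K) s₁ s₂ → h ≠ h₀ →
      Follows C h₀ a z (K ∪ {h}) h s₂ v s' g' →
      Follows C h₀ a z K g s (.nu h :: v) s' g'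
  | swap {K g s s₁ v s' g'} :
      ReflTransGen (QuietStep C g) s s₁ → ReflTransGen (ActiveStep C K) s₁ a →
      Follows C h₀ a z (K ∪ {h₀}) h₀ z v s' g' →
      Follows C h₀ a z K g s (.nu h₀ :: v) s' g'

variable {C : TransSys (ContribAct G) S} {h₀ : G} {a z : S}

theorem Follows.head_quiet {K : Set G} {g g' : G} {s s₁ s' : S} {v : List (Letter G)}
    (hs : QuietStep C g s s₁) (h : Follows C h₀ a z K g s₁ v s' g') :
    Follows C h₀ a z K g s v s' g' := by
  cases h with
  | quiet h1 => exact .quiet (.head hs h1)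
  | active h1 h2 h3 => exact .active (.head hs h1) h2 h3
  | write h1 h2 h3 => exact .write (.head hs h1) h2 h3
  | readQuiet h1 h2 => exact .readQuiet (.head hs h1) h2
  | readActive h1 h2 h3 h4 => exact .readActive (.head hs h1) h2 h3 h4
  | nu h1 h2 h3 h4 => exact .nu (.head hs h1) h2 h3 h4
  | swap h1 h2 h3 => exact .swap (.head hs h1) h2 h3

theorem Follows.head_active {K : Set G} {g g' h : G} {s s₁ s' : S} {v : List (Letter G)}
    (hs : ActiveStep C K s s₁) (hK : h ∈ K) (hf : Follows C h₀ a z K h s₁ v s' g') :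
    Follows C h₀ a z K g s v s' g' := by
  have key : ∀ {x}, ReflTransGen (QuietStep C h) s₁ x → ReflTransGen (ActiveStep C K) s x :=
    fun hx => .head hs (ReflTransGen.mono (fun _ _ hq => QuietStep.active hq hK) _ _ hx)
  cases hf with
  | quiet h1 => exact .active .refl (key h1) hK
  | active h1 h2 h3 => exact .active .refl ((key h1).trans h2) h3
  | write h1 h2 h3 => exact .write .refl ((key h1).trans h2) h3
  | readQuiet h1 h2 => exact .readActive .refl (key h1) hK h2
  | readActive h1 h2 h3 h4 => exact .readActive .refl ((key h1).trans h2) h3 h4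
  | nu h1 h2 h3 h4 => exact .nu .refl ((key h1).trans h2) h3 h4
  | swap h1 h2 h3 => exact .swap .refl ((key h1).trans h2) h3

/-- A run of the capacity contributor that does not see `ν(h₀)` can be put in front. -/
theorem Follows.of_path {ginit : G} {c c' : Set G × S × G} {u v : List (Letter G)} {s' : S}
    {g' : G} (hp : (capContrib C ginit).Path c u c') (hu : Letter.nu h₀ ∉ u)
    (hf : Follows C h₀ a z c'.1 c'.2.2 c'.2.1 v s' g') :
    Follows C h₀ a z c.1 c.2.2 c.2.1 (u.filter Letter.inDNu ++ v) s' g' := by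
  induction hp with
  | nil => exact hf
  | silent hs _ ih =>
    have ih := ih hu hf
    cases hs with
    | contribSilent h => exact ih.head_quiet ⟨_, h, .silent _⟩
  | cons hs _ ih =>
    simp only [List.mem_cons, not_or] at hu
    have ih := ih hu.2 hf
    cases hs with
    | leaderWrite => exact .write .refl .refl ih
    | leaderRead h =>
      rcases h with h | rfl
      · exact .readActive .refl .refl h ih
      · exact .readQuiet .refl ih
    | nu => exact .nu .refl .refl (fun h => hu.1 (by rw [h])) ih
    | contribWrite h hK => exact ih.head_active ⟨_, h, .inr ⟨_, hK, .write _ _⟩⟩ hK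
    | contribRead h hK =>
      rcases hK with hK | rfl
      · exact ih.head_active ⟨_, h, .inr ⟨_, hK, .read _⟩⟩ hK
      · exact ih.head_quiet ⟨_, h, .read _⟩

/-- A contributor can follow the capacity leader without moving. -/
theorem Follows.of_capLeader {D : TransSys (LeaderAct G) T} {ginit : G} {c c' : Set G × T × G}
    {v : List (Letter G)} (hp : (capLeader D ginit).Path c v c') (hv : Letter.nu h₀ ∉ v) (s : S) :
    Follows C h₀ a z c.1 c.2.2 s v s c'.2.2 := by
  induction hp with
  | nil => exact .quiet .refl
  | silent hs _ ih =>
    have ih := ih hv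
    cases hs with
    | silent h => exact ih
  | cons hs _ ih =>
    simp only [List.mem_cons, not_or] at hv
    have ih := ih hv.2
    cases hs with
    | write => exact .write .refl .refl ih
    | read _ h =>
      rcases h with h | rfl
      · exact .readActive .refl .refl h ih
      · exact .readQuiet .refl ih
    | nu => exact .nu .refl .refl (fun h => hv.1 (by rw [h])) ih

end Follows

/-! ### Imitation of a capacity run by the real system -/

section Replay

variable {G S Q Γ ι : Type*} [Fintype ι]

/-- If a property can be pulled back along a step of one component, it can be pulled back along
finitely many steps of each component. -/
theorem pull_back_components [DecidableEq ι] {r : S → S → Prop} {Φ : (ι → S) → Prop}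
    (hΦ : ∀ s i x, r (s i) x → Φ (Function.update s i x) → Φ s) {s s₁ : ι → S}
    (hs : ∀ i, ReflTransGen r (s i) (s₁ i)) (h : Φ s₁) : Φ s := by
  have single : ∀ i x y, ReflTransGen r x y → ∀ s : ι → S, s i = x →
      Φ (Function.update s i y) → Φ s := by
    intro i x y hxy
    induction hxy using ReflTransGen.head_induction_on with
    | refl => intro s hs h; subst hs; simpa using h
    | head h1 _ ih =>
      intro s hs h
      subst hs
      exact hΦ s i _ h1 (ih _ (by simp) (by simpa using h))
  have main : ∀ I : Finset ι, Φ (I.piecewise s₁ s) → Φ s := by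
    intro I
    induction I using Finset.induction_on with
    | empty => simp
    | insert i I hi ih =>
      intro h
      rw [Finset.piecewise_insert] at h
      exact ih (single i _ _ (by rw [Finset.piecewise_eq_of_notMem _ _ _ hi]; exact hs i) _ rfl h)
  exact main Finset.univ (by simpa using h)

/-- For each `i`, the data of the contributors in charge of the value `val i`: such a contributor
waits in `pre i`, and goes to `post i` by writing `val i`; `spare i` is the state in which the
contributors of the reserve are before the first write of `val i`. -/
structure Writers (ι G S : Type*) where
  val : ι → G
  pre : ι → S
  post : ι → S
  spare : ι → S

/-- The multiset with `κ i` contributors in state `s i`, for every `i`. -/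
def crowd (κ : ι → ℕ) (s : ι → S) : Multiset S := ∑ i, κ i • {s i}

open Classical in
/-- The contributors in reserve when the capacity is `K`: if `val i` is in `K`, then `F i` of those
in charge of it can still write, and `c i` have done so. -/
noncomputable def reserve (W : Writers ι G S) (K : Set G) (F c κ : ι → ℕ) : Multiset S :=
  ∑ i, if W.val i ∈ K then F i • {W.pre i} + c i • {W.post i} else κ i • {W.spare i}

/-- Starting with capacity `K`, contributors `s`, leader `t` and register `g`, the real system can
imitate the word `v` and arrive at contributors `s'`, leader `t'`, register `g'`, if there are
enough contributors in reserve. The numbers `F i` count the writes of `val i` that are needed;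
they do not depend on the number `κ i` of copies of `s i`, on the rest of the leader's stack, or on
the other contributors. In the end the contributors in reserve have all made their write. -/
def Replay (C : TransSys (ContribAct G) S) (P : Pushdown (LeaderAct G) Q Γ) (ginit : G)
    (W : Writers ι G S) (s' : ι → S) (t' : Q × List Γ) (g' : G)
    (v : List (Letter G)) (K : Set G) (s : ι → S) (t : Q × List Γ) (g : G) : Prop :=
  ∃ F : ι → ℕ, ∀ κ c : ι → ℕ, (∀ i, W.val i ∈ K → κ i = F i + c i) →
    (∀ i, W.val i ∉ K → F i ≤ κ i) → ∀ (R : Multiset S) (α : List Γ),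
    ∃ u, (cdSys C P.toTransSys ginit).Path
        (crowd κ s + reserve W K F c κ + R, (t.1, t.2 ++ α), g) u
        (crowd κ s' + crowd κ W.post + R, (t'.1, t'.2 ++ α), g') ∧
      ∀ x, Letter.leader x ∈ v → Letter.leader x ∈ u

variable {C : TransSys (ContribAct G) S} {P : Pushdown (LeaderAct G) Q Γ} {ginit : G}
  {W : Writers ι G S} {s' : ι → S} {t' : Q × List Γ} {g' : G} {v : List (Letter G)} {K : Set G}
  {s : ι → S} {t : Q × List Γ} {g : G}

theorem Replay.head_leader {t₁ : Q × List Γ} {g₁ : G} {l : Option (LeaderAct G)}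
    (ht : P.Step t l t₁) (hr : LeaderReg l g g₁)
    (h : Replay C P ginit W s' t' g' v K s t₁ g₁) :
    Replay C P ginit W s' t' g' ((l.map Letter.leader).toList ++ v) K s t g := by
  obtain ⟨F, hF⟩ := h
  refine ⟨F, fun κ c h1 h2 R α => ?_⟩
  obtain ⟨u, hu, hv⟩ := hF κ c h1 h2 R α
  refine ⟨_, TransSys.Path.append (.of_tr (T := cdSys C P.toTransSys ginit)
    (CDStep.of_leader (ht.lift α) hr)) hu, fun x hx => ?_⟩
  rcases List.mem_append.1 hx with hx | hx
  · exact List.mem_append_left _ hx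
  · exact List.mem_append_right _ (hv x hx)

variable [DecidableEq ι]

theorem crowd_split (κ : ι → ℕ) (s : ι → S) (i : ι) : ∃ N, ∀ x,
    crowd κ (Function.update s i x) = κ i • {x} + N := by
  refine ⟨∑ j ∈ Finset.univ.erase i, κ j • {s j}, fun x => ?_⟩
  rw [crowd, ← Finset.add_sum_erase _ _ (Finset.mem_univ i)]
  congr 1
  · simp
  · refine Finset.sum_congr rfl fun j hj => ?_
    rw [Function.update_of_ne (Finset.ne_of_mem_erase hj)]

theorem Replay.head_quiet {i : ι} {x : S} (hs : QuietStep C g (s i) x)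
    (h : Replay C P ginit W s' t' g' v K (Function.update s i x) t g) :
    Replay C P ginit W s' t' g' v K s t g := by
  obtain ⟨F, hF⟩ := h
  refine ⟨F, fun κ c h1 h2 R α => ?_⟩
  obtain ⟨u, hu, hv⟩ := hF κ c h1 h2 R α
  obtain ⟨l, hl, hr⟩ := hs
  obtain ⟨N, hN⟩ := crowd_split κ s i
  obtain ⟨w, hw⟩ := exists_path_copies (D := P.toTransSys) (ginit := ginit) hl hr
    (t.1, t.2 ++ α) (κ i) (N + reserve W K F c κ + R)
  refine ⟨w ++ u, ?_, fun x hx => by simp [hv x hx]⟩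
  rw [hN x] at hu
  have hs0 := hN (s i)
  rw [Function.update_eq_self] at hs0
  rw [hs0]
  refine TransSys.Path.append ?_ hu
  convert hw using 2 <;> abel

theorem reserve_split (W : Writers ι G S) (K : Set G) (κ : ι → ℕ) {i : ι} (hi : W.val i ∈ K) :
    ∀ F c, ∃ N, ∀ m n, reserve W K (Function.update F i m) (Function.update c i n) κ =
      m • {W.pre i} + n • {W.post i} + N := by
  classical
  intro F c
  refine ⟨∑ j ∈ Finset.univ.erase i,
    if W.val j ∈ K then F j • {W.pre j} + c j • {W.post j} else κ j • {W.spare j}, fun m n => ?_⟩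
  rw [reserve, ← Finset.add_sum_erase _ _ (Finset.mem_univ i)]
  congr 1
  · simp [hi]
  · refine Finset.sum_congr rfl fun j hj => ?_
    rw [Function.update_of_ne (Finset.ne_of_mem_erase hj),
      Function.update_of_ne (Finset.ne_of_mem_erase hj)]

/-- A contributor in reserve can set the register to a value of the capacity. -/
theorem Replay.of_val {i : ι} (hi : W.val i ∈ K)
    (hW : C.tr (W.pre i) (some (.w (W.val i))) (W.post i))
    (h : Replay C P ginit W s' t' g' v K s t (W.val i)) (g : G) :
    Replay C P ginit W s' t' g' v K s t g := by
  obtain ⟨F, hF⟩ := h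
  refine ⟨Function.update F i (F i + 1), fun κ c h1 h2 R α => ?_⟩
  obtain ⟨u, hu, hv⟩ := hF κ (Function.update c i (c i + 1)) (fun j hj => by
      rcases eq_or_ne j i with rfl | hji
      · have := h1 j hj
        simp only [Function.update_self] at this ⊢
        omega
      · simpa [hji] using h1 j hj) (fun j hj => by
      have hji : j ≠ i := by rintro rfl; exact hj hi
      simpa [hji] using h2 j hj) R α
  obtain ⟨N, hN⟩ := reserve_split W K κ hi F c
  have e1 := hN (F i + 1) (c i)
  have e2 := hN (F i) (c i + 1)
  rw [Function.update_eq_self] at e1 e2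
  rw [e2] at hu
  rw [e1]
  refine ⟨_, TransSys.Path.cons (a := .contrib (.w (W.val i))) (CDStep.contribWrite
    ⟨_, _, crowd κ s + (F i • {W.pre i} + c i • {W.post i} + N) + R, hW, ?_, rfl⟩)
    (u := u) ?_, fun x hx => by simp [hv x hx]⟩
  · simp only [← Multiset.singleton_add, add_nsmul, one_nsmul]
    abel
  · convert hu using 2
    simp only [← Multiset.singleton_add, add_nsmul, one_nsmul]
    abel

/-- At the first write of `val i`, the copies of `s i` become the writers of the reserve, and the
former reserve takes their place. All copies that will not be needed write at once. -/
theorem Replay.head_nu {i : ι} {s₁ : ι → S} (hinj : Function.Injective W.val)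
    (hi : W.val i ∉ K) (hW : C.tr (W.pre i) (some (.w (W.val i))) (W.post i))
    (hpre : s i = W.pre i) (hspare : s₁ i = W.spare i) (hne : ∀ j, j ≠ i → s₁ j = s j)
    (h : Replay C P ginit W s' t' g' v (K ∪ {W.val i}) s₁ t (W.val i)) (g : G) :
    Replay C P ginit W s' t' g' (.nu (W.val i) :: v) K s t g := by
  classical
  obtain ⟨F, hF⟩ := h
  refine ⟨Function.update F i (F i + 1), fun κ c h1 h2 R α => ?_⟩
  have hFi : F i + 1 ≤ κ i := by simpa using h2 i hi
  obtain ⟨u, hu, hv⟩ := hF κ (Function.update c i (κ i - F i)) (fun j hj => by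
      rcases eq_or_ne j i with rfl | hji
      · simp only [Function.update_self]
        omega
      · have : W.val j ∈ K := by
          rcases hj with hj | hj
          · exact hj
          · exact absurd (hinj hj) hji
        simpa [hji] using h1 j this) (fun j hj => by
      have hji : j ≠ i := by rintro rfl; exact hj (.inr rfl)
      simpa [hji] using h2 j (fun h => hj (.inl h))) R α
  obtain ⟨N, hN⟩ := reserve_split W (K ∪ {W.val i}) κ (.inr rfl : W.val i ∈ K ∪ {W.val i}) F c
  have e2 := hN (F i) (κ i - F i)
  rw [Function.update_eq_self] at e2
  have e3 : crowd κ s + reserve W K (Function.update F i (F i + 1)) c κ =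
      crowd κ s₁ + (κ i • {W.pre i} + N) := by
    have e4 := hN (κ i) 0
    rw [zero_nsmul, add_zero] at e4
    rw [← e4, crowd, crowd, reserve, reserve, ← Finset.sum_add_distrib, ← Finset.sum_add_distrib]
    refine Finset.sum_congr rfl fun j _ => ?_
    rcases eq_or_ne j i with rfl | hji
    · simp [hi, hpre, hspare, add_comm]
    · have : W.val j ≠ W.val i := fun h => hji (hinj h)
      simp [hji, hne j hji, this]
  rw [e3]
  rw [e2] at hu
  obtain ⟨k, hk⟩ : ∃ k, κ i = F i + (k + 1) := ⟨κ i - F i - 1, by omega⟩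
  rw [hk]
  rw [show κ i - F i = k + 1 by omega] at hu
  obtain ⟨w, hw⟩ := exists_path_copies (D := P.toTransSys) (ginit := ginit) hW
    (.write (W.val i) _) (t.1, t.2 ++ α) k (crowd κ s₁ + (F i • {W.pre i} + {W.post i} + N) + R)
  refine ⟨.contrib (.w (W.val i)) :: (w ++ u), TransSys.Path.cons (CDStep.contribWrite
    ⟨_, _, crowd κ s₁ + (F i • {W.pre i} + k • {W.pre i} + N) + R, hW, ?_, rfl⟩)
    (TransSys.Path.append ?_ hu), fun x hx => ?_⟩
  · simp only [← Multiset.singleton_add, add_nsmul, one_nsmul]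
    abel
  · convert hw using 2 <;> simp only [← Multiset.singleton_add, add_nsmul, one_nsmul] <;> abel
  · have : Letter.leader x ∈ v := by simpa using hx
    simp [hv x this]

theorem Replay.head_quiets {s₁ : ι → S} (hs : ∀ i, ReflTransGen (QuietStep C g) (s i) (s₁ i))
    (h : Replay C P ginit W s' t' g' v K s₁ t g) : Replay C P ginit W s' t' g' v K s t g :=
  pull_back_components (Φ := fun s => Replay C P ginit W s' t' g' v K s t g)
    (fun _ _ _ hx h => h.head_quiet hx) hs h

theorem Replay.head_actives {s₁ : ι → S}
    (hW : ∀ i, C.tr (W.pre i) (some (.w (W.val i))) (W.post i)) (hK : K ⊆ Set.range W.val)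
    (hs : ∀ i, ReflTransGen (ActiveStep C K) (s i) (s₁ i))
    (h : ∀ g, Replay C P ginit W s' t' g' v K s₁ t g) (g : G) :
    Replay C P ginit W s' t' g' v K s t g := by
  refine pull_back_components (Φ := fun s => ∀ g, Replay C P ginit W s' t' g' v K s t g)
    (fun s i x hx h g => ?_) hs h g
  obtain ⟨l, hl, rfl | ⟨h', hh', hr⟩⟩ := hx
  · exact (h g).head_quiet ⟨_, hl, .silent _⟩
  · obtain ⟨j, rfl⟩ := hK hh'
    exact Replay.of_val hh' (hW j) ((h _).head_quiet ⟨_, hl, hr⟩) g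

/-- A word that the capacity leader can read and that the contributors in charge can follow is
imitated by the real system. -/
theorem Replay.of_follows (hinj : Function.Injective W.val)
    (hW : ∀ i, C.tr (W.pre i) (some (.w (W.val i))) (W.post i))
    {c c' : Set G × (Q × List Γ) × G} (hp : (capLeader P.toTransSys ginit).Path c v c')
    (hc : c.1 ⊆ Set.range W.val) (hc' : Set.range W.val ⊆ c'.1)
    (hv : ∀ h, Letter.nu h ∈ v → h ∈ Set.range W.val)
    (hf : ∀ i, Follows C (W.val i) (W.pre i) (W.spare i) c.1 c.2.2 (s i) v (s' i) c'.2.2) :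
    Replay C P ginit W s' c'.2.1 c'.2.2 v c.1 s c.2.1 c.2.2 := by
  induction hp generalizing s with
  | nil c =>
    obtain ⟨K, t, g⟩ := c
    dsimp only at *
    have base : Replay C P ginit W s' t g [] K s' t g := by
      refine ⟨0, fun κ c h1 _ R α => ⟨[], ?_, by simp⟩⟩
      have : reserve W K 0 c κ = crowd κ W.post := by
        refine Finset.sum_congr rfl fun i _ => ?_
        have hi : W.val i ∈ K := hc' ⟨i, rfl⟩
        have := h1 i hi
        simp only [Pi.zero_apply, zero_add] at this
        simp [hi, this]
      rw [this]
      exact .nil _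
    -- the value `g` at the end is written afresh if active steps have overwritten it
    by_cases hg : g ∈ K
    · have : ∀ i, ∃ s₁, ReflTransGen (QuietStep C g) (s i) s₁ ∧
          ReflTransGen (ActiveStep C K) s₁ (s' i) := by
        intro i
        cases hf i with
        | quiet h1 => exact ⟨_, h1, .refl⟩
        | active h1 h2 _ => exact ⟨_, h1, h2⟩
      choose s₁ h1 h2 using this
      obtain ⟨j, rfl⟩ := hc hg
      exact .head_quiets h1 (.head_actives hW hc h2 (Replay.of_val hg (hW j) base) _)
    · refine .head_quiets (fun i => ?_) base
      cases hf i with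
      | quiet h1 => exact h1
      | active _ _ h => exact absurd h hg
  | silent hs _ ih =>
    cases hs with
    | silent h => exact (ih hc hc' hv hf).head_leader (l := none) h (.silent _)
  | @cons _ _ e _ w hs _ ih =>
    cases hs with
    | @write K t t₁ g h ht =>
      have : ∀ i, ∃ s₁ s₂, ReflTransGen (QuietStep C g) (s i) s₁ ∧
          ReflTransGen (ActiveStep C K) s₁ s₂ ∧
          Follows C (W.val i) (W.pre i) (W.spare i) K h s₂ w (s' i) e.2.2 := by
        intro i
        cases hf i with
        | write h1 h2 h3 => exact ⟨_, _, h1, h2, h3⟩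
      choose s₁ s₂ h1 h2 h3 using this
      have ih := ih hc hc' (fun x hx => hv x (List.mem_cons_of_mem _ hx)) h3
      exact .head_quiets h1 (.head_actives hW hc h2
        (fun g => ih.head_leader (l := some (.w h)) ht (.write _ _)) _)
    | @read K t t₁ g h ht hK =>
      by_cases hh : h ∈ K
      · have : ∀ i, ∃ s₁ s₂, ReflTransGen (QuietStep C g) (s i) s₁ ∧
            ReflTransGen (ActiveStep C K) s₁ s₂ ∧
            Follows C (W.val i) (W.pre i) (W.spare i) K h s₂ w (s' i) e.2.2 := by
          intro i
          cases hf i with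
          | readQuiet h1 h2 => exact ⟨_, _, h1, .refl, h2⟩
          | readActive h1 h2 _ h3 => exact ⟨_, _, h1, h2, h3⟩
        choose s₁ s₂ h1 h2 h3 using this
        have ih := ih hc hc' (fun x hx => hv x (List.mem_cons_of_mem _ hx)) h3
        obtain ⟨j, rfl⟩ := hc hh
        exact .head_quiets h1 (.head_actives hW hc h2 (Replay.of_val hh (hW j)
          (ih.head_leader (l := some (.r _)) ht (.read _))) _)
      · obtain rfl : h = g := by
          rcases hK with hK | hK
          · exact absurd hK hh
          · exact hK
        have : ∀ i, ∃ s₁, ReflTransGen (QuietStep C h) (s i) s₁ ∧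
            Follows C (W.val i) (W.pre i) (W.spare i) K h s₁ w (s' i) e.2.2 := by
          intro i
          cases hf i with
          | readQuiet h1 h2 => exact ⟨_, h1, h2⟩
          | readActive _ _ h _ => exact absurd h hh
        choose s₁ h1 h3 using this
        have ih := ih hc hc' (fun x hx => hv x (List.mem_cons_of_mem _ hx)) h3
        exact .head_quiets h1 (ih.head_leader (l := some (.r _)) ht (.read _))
    | @nu K t g h hK =>
      obtain ⟨j, rfl⟩ := hv h (List.mem_cons_self ..)
      have : ∀ i, ∃ s₁ s₂ s₃, ReflTransGen (QuietStep C g) (s i) s₁ ∧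
          ReflTransGen (ActiveStep C K) s₁ s₂ ∧ (i = j → s₂ = W.pre i ∧ s₃ = W.spare i) ∧
          (i ≠ j → s₃ = s₂) ∧
          Follows C (W.val i) (W.pre i) (W.spare i) (K ∪ {W.val j}) (W.val j) s₃ w (s' i)
            e.2.2 := by
        intro i
        rcases eq_or_ne i j with rfl | hij
        · cases hf i with
          | nu _ _ h3 _ => exact absurd rfl h3
          | swap h1 h2 h3 =>
            exact ⟨_, _, _, h1, h2, fun _ => ⟨rfl, rfl⟩, fun h => absurd rfl h, h3⟩
        · have hne : W.val j ≠ W.val i := fun h => hij (hinj h).symm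
          have := hf i
          generalize W.val j = x at *
          cases this with
          | nu h1 h2 _ h4 => exact ⟨_, _, _, h1, h2, fun h => absurd h hij, fun _ => rfl, h4⟩
          | swap _ _ _ => exact absurd rfl hne
      choose s₁ s₂ s₃ h1 h2 h3 h4 h5 using this
      have ih := ih (s := s₃) (Set.union_subset hc (by simp)) hc'
        (fun x hx => hv x (List.mem_cons_of_mem _ hx)) h5
      exact .head_quiets h1 (.head_actives hW hc h2 (Replay.head_nu hinj hK (hW j)
        (h3 j rfl).1 (h3 j rfl).2 h4 ih) _)

end Replay

/-! ### Repeating a piece of a run forever -/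

section Recurrence

variable {G S T : Type*} {C : TransSys (ContribAct G) S} {D : TransSys (LeaderAct G) T}
  {ginit : G} {top : LeaderAct G}

/-- A run that can always be continued by a finite piece with an occurrence of `top` can be
continued to a Büchi run. -/
theorem hasBuchiRun_of_recurrent (Win : Multiset S × T × G → Prop)
    (h₀ : ∃ c, CDReachable C D ginit c ∧ Win c)
    (hWin : ∀ c, Win c → ∃ u c', (cdSys C D ginit).Path c u c' ∧ Letter.leader top ∈ u ∧ Win c') :
    HasBuchiRun C D ginit top := by
  let X : Multiset S × T × G → Prop := fun c =>
    ∃ u c', (cdSys C D ginit).Path c u c' ∧ Letter.leader top ∈ u ∧ Win c'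
  have hX : ∀ {c u c'}, (cdSys C D ginit).Path c u c' → Win c' → X c := by
    intro c u c' hp hc'
    obtain ⟨w, e, hw, ht, he⟩ := hWin c' hc'
    exact ⟨_, e, hp.append hw, List.mem_append_right _ ht, he⟩
  -- `dist n c`: after `n` steps from `c`, a step labelled `top` leads back to `X`
  let dist : ℕ → Multiset S × T × G → Prop := fun n => Nat.rec
    (fun c => ∃ c₁, CDStep C D c (some (.leader top)) c₁ ∧ X c₁)
    (fun _ d c => ∃ a c₁, CDStep C D c a c₁ ∧ d c₁) n
  have hdist : ∀ {c u c'}, (cdSys C D ginit).Path c u c' → Letter.leader top ∈ u → Win c' →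
      ∃ n, dist n c := by
    intro c u c' hp
    induction hp with
    | nil => simp
    | silent hs _ ih =>
      intro ht hw
      obtain ⟨n, hn⟩ := ih ht hw
      exact ⟨n + 1, _, _, hs, hn⟩
    | @cons _ _ _ a _ hs hp ih =>
      intro ht hw
      by_cases ha : a = Letter.leader top
      · subst ha
        exact ⟨0, _, hs, hX hp hw⟩
      · obtain ⟨n, hn⟩ := ih ((List.mem_cons.1 ht).resolve_left (Ne.symm ha)) hw
        exact ⟨n + 1, _, _, hs, hn⟩
  have next : ∀ x : {x : (Multiset S × T × G) × ℕ // dist x.2 x.1},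
      ∃ (a : Option (Letter G)) (y : {x : (Multiset S × T × G) × ℕ // dist x.2 x.1}),
        CDStep C D x.1.1 a y.1.1 ∧
          ((x.1.2 = 0 ∧ a = some (.leader top)) ∨ x.1.2 = y.1.2 + 1) := by
    rintro ⟨⟨c, n⟩, hx⟩
    cases n with
    | zero =>
      obtain ⟨c₁, h1, u, c', h2, h3, h4⟩ := hx
      obtain ⟨n, hn⟩ := hdist h2 h3 h4
      exact ⟨_, ⟨(c₁, n), hn⟩, h1, .inl ⟨rfl, rfl⟩⟩
    | succ n =>
      obtain ⟨a, c₁, h1, h2⟩ := hx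
      exact ⟨a, ⟨(c₁, n), h2⟩, h1, .inr rfl⟩
  choose lab nxt hnext using next
  obtain ⟨c, ⟨n, hn⟩, hc⟩ := h₀
  obtain ⟨u, hu⟩ := TransSys.exists_path_of_reflTransGen (T := cdSys C D ginit) hn
  obtain ⟨w, e, h1, h2, h3⟩ := hX hu hc
  obtain ⟨d, hd⟩ := hdist h1 h2 h3
  let x : ℕ → {x : (Multiset S × T × G) × ℕ // dist x.2 x.1} := fun k => nxt^[k] ⟨(_, d), hd⟩
  have hx : ∀ k, x (k + 1) = nxt (x k) := fun k => Function.iterate_succ_apply' _ _ _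
  refine ⟨n, fun k => (x k).1.1, fun k => lab (x k), rfl, fun k => ?_, ?_⟩
  · have := (hnext (x k)).1
    rwa [← hx] at this
  · refine Set.infinite_of_forall_exists_gt fun k => ?_
    suffices H : ∀ m j, (x j).1.2 = m → ∃ b, j ≤ b ∧ lab (x b) = some (.leader top) by
      obtain ⟨b, hb, hl⟩ := H _ (k + 1) rfl
      exact ⟨b, hl, hb⟩
    intro m
    induction m with
    | zero =>
      intro j hj
      rcases (hnext (x j)).2 with h | h
      · exact ⟨j, le_rfl, h.2⟩
      · omega
    | succ m ih =>
      intro j hj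
      rcases (hnext (x j)).2 with h | h
      · omega
      · obtain ⟨b, hb, hl⟩ := ih (j + 1) (by rw [hx]; omega)
        exact ⟨b, by omega, hl⟩

end Recurrence

/-! ### From truncated to pushdown contributors -/

section Truncation

variable {G Q Γ T : Type*}

/-- A run of the truncated system is imitated by the pushdown system, whose stacks extend those of
the truncated system at the bottom. -/
theorem HasBuchiRun.of_truncated {P : Pushdown (ContribAct G) Q Γ} {N : ℕ} {hN : 0 < N}
    {D : TransSys (LeaderAct G) T} {ginit : G} {top : LeaderAct G}
    (h : HasBuchiRun (P.truncated N hN) D ginit top) : HasBuchiRun P.toTransSys D ginit top := by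
  obtain ⟨n, c, a, h0, hs, ht⟩ := h
  let ext : {s : Q × List Γ // s.2.length ≤ N} → Q × List Γ → Prop :=
    fun s x => ∃ β, x = (s.1.1, s.1.2 ++ β)
  let R : Multiset {s : Q × List Γ // s.2.length ≤ N} × T × G →
      Multiset (Q × List Γ) × T × G → Prop :=
    fun c x => Multiset.Rel ext c.1 x.1 ∧ c.2 = x.2
  have multi : ∀ {M M' l X}, MultiStep (P.truncated N hN) M l M' → Multiset.Rel ext M X →
      ∃ X', MultiStep P.toTransSys X l X' ∧ Multiset.Rel ext M' X' := by
    rintro M M' l X ⟨s, s', N, ⟨α, hst⟩, rfl, rfl⟩ hX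
    obtain ⟨x, Y, ⟨β, rfl⟩, hY, rfl⟩ := Multiset.rel_cons_left.1 hX
    refine ⟨_, ⟨_, (s'.1.1, s'.1.2 ++ α ++ β), Y, hst.lift β, rfl, rfl⟩, ?_⟩
    exact Multiset.rel_cons_left.2 ⟨_, _, ⟨α ++ β, by simp⟩, hY, rfl⟩
  have sim : ∀ {c₁ a c₂ x}, CDStep (P.truncated N hN) D c₁ a c₂ → R c₁ x →
      ∃ y, CDStep P.toTransSys D x a y ∧ R c₂ y := by
    rintro c₁ a c₂ ⟨X, t, g⟩ h ⟨hX, hx⟩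
    cases h with
    | leaderWrite h => cases hx; exact ⟨_, .leaderWrite h, hX, rfl⟩
    | leaderRead h => cases hx; exact ⟨_, .leaderRead h, hX, rfl⟩
    | leaderSilent h => cases hx; exact ⟨_, .leaderSilent h, hX, rfl⟩
    | contribWrite h =>
      cases hx
      obtain ⟨X', h1, h2⟩ := multi h hX
      exact ⟨_, .contribWrite h1, h2, rfl⟩
    | contribRead h =>
      cases hx
      obtain ⟨X', h1, h2⟩ := multi h hX
      exact ⟨_, .contribRead h1, h2, rfl⟩
    | contribSilent h =>
      cases hx
      obtain ⟨X', h1, h2⟩ := multi h hX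
      exact ⟨_, .contribSilent h1, h2, rfl⟩
  have next : ∀ k (x : {x // R (c k) x}), ∃ y : {y // R (c (k + 1)) y},
      CDStep P.toTransSys D x.1 (a k) y.1 := by
    intro k x
    obtain ⟨y, h1, h2⟩ := sim (hs k) x.2
    exact ⟨⟨y, h2⟩, h1⟩
  choose nxt hnxt using next
  have hinit : R (c 0) (initConfig P.toTransSys D ginit n) := by
    rw [h0]
    refine ⟨?_, rfl⟩
    simp only [initConfig]
    induction n with
    | zero => simp
    | succ n ih =>
      simp only [Multiset.replicate_succ]
      refine .cons ⟨[], by simp [Pushdown.truncated, Pushdown.toTransSys]⟩ ?_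
      clear ih h0
      induction n with
      | zero => simp
      | succ n ih =>
        simp only [Multiset.replicate_succ]
        exact .cons ⟨[], by simp [Pushdown.truncated, Pushdown.toTransSys]⟩ ih
  let x : ∀ k, {x // R (c k) x} := fun k => Nat.rec ⟨_, hinit⟩ nxt k
  exact ⟨n, fun k => (x k).1, a, rfl, fun k => hnxt k (x k), ht⟩

end Truncation

/-! ### Supported cycles yield Büchi runs -/

section Cycle

variable {G S Q Γ T : Type*}

theorem capLeader_nu_notMem {D : TransSys (LeaderAct G) T} {ginit : G} {c c' : Set G × T × G}
    {v : List (Letter G)} (hp : (capLeader D ginit).Path c v c') {h : G} (hh : h ∈ c.1) :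
    Letter.nu h ∉ v := by
  induction hp with
  | nil => simp
  | silent hs _ ih =>
    cases hs with
    | silent => exact ih hh
  | cons hs _ ih =>
    cases hs with
    | write => simpa using ih hh
    | read => simpa using ih hh
    | nu hn =>
      rw [List.mem_cons, not_or]
      exact ⟨by rintro ⟨⟩; exact hn hh, ih (.inl hh)⟩

theorem capLeader_capacity {D : TransSys (LeaderAct G) T} {ginit : G} {c c' : Set G × T × G}
    {v : List (Letter G)} (hp : (capLeader D ginit).Path c v c') :
    c'.1 = c.1 ∪ {h | Letter.nu h ∈ v} := by
  induction hp with
  | nil => simp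
  | silent hs _ ih =>
    cases hs with
    | silent => exact ih
  | cons hs _ ih =>
    cases hs with
    | write => simpa using ih
    | read => simpa using ih
    | nu hn => ext x; simp [ih, or_left_comm, or_assoc]

theorem capContrib_capacity {C : TransSys (ContribAct G) S} {ginit : G} {c c' : Set G × S × G}
    {u : List (Letter G)} (hp : (capContrib C ginit).Path c u c') :
    c'.1 = c.1 ∪ {h | Letter.nu h ∈ u} := by
  induction hp with
  | nil => simp
  | silent hs _ ih =>
    cases hs with
    | contribSilent => exact ih
  | cons hs _ ih =>
    cases hs with
    | nu => ext x; simp [ih, or_left_comm, or_assoc]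
    | _ => simpa using ih

theorem capContrib_path_nil {C : TransSys (ContribAct G) S} {ginit : G} {c c' : Set G × S × G}
    {u : List (Letter G)} (K : Set G) (hp : (capContrib C ginit).Path c u c') (hu : u = []) :
    ∃ a, ReflTransGen (ActiveStep C K) c.2.1 a ∧ c' = (c.1, a, c.2.2) := by
  induction hp with
  | nil => exact ⟨_, .refl, rfl⟩
  | silent hs _ ih =>
    cases hs with
    | contribSilent hs =>
      obtain ⟨a, h1, h2⟩ := ih hu
      exact ⟨a, .head ⟨none, hs, .inl rfl⟩ h1, h2⟩
  | cons => cases hu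

theorem capLeader_mem_capacity {D : TransSys (LeaderAct G) T} {ginit : G} {c c' : Set G × T × G}
    {v : List (Letter G)} (hp : (capLeader D ginit).Path c v c') {h : G}
    (hh : Letter.nu h ∈ v) : h ∈ c'.1 := by
  rw [capLeader_capacity hp]
  exact .inr hh

theorem capLeader_nu_unique {D : TransSys (LeaderAct G) T} {ginit : G} {c c' : Set G × T × G}
    {v₁ v₂ : List (Letter G)} {h : G}
    (hp : (capLeader D ginit).Path c (v₁ ++ .nu h :: v₂) c') :
    Letter.nu h ∉ v₁ ∧ Letter.nu h ∉ v₂ := by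
  obtain ⟨d, h1, h2⟩ := hp.split
  constructor
  · intro hm
    exact capLeader_nu_notMem h2 (capLeader_mem_capacity h1 hm) (List.mem_cons_self ..)
  · obtain ⟨e, h3, h4⟩ := TransSys.Path.split (u := [Letter.nu h]) h2
    exact capLeader_nu_notMem h4 (capLeader_mem_capacity h3 (List.mem_cons_self ..))

theorem lastValue_cons (a : Letter G) (v : List (Letter G)) :
    lastValue (a :: v) = some ((lastValue v).getD a.value) := by
  simp only [lastValue, List.getLast?_cons]
  cases v.getLast? <;> rfl

theorem capLeader_register {D : TransSys (LeaderAct G) T} {ginit : G} {c c' : Set G × T × G}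
    {v : List (Letter G)} (hp : (capLeader D ginit).Path c v c') :
    c'.2.2 = (lastValue v).getD c.2.2 := by
  induction hp with
  | nil => rfl
  | silent hs _ ih =>
    cases hs with
    | silent => exact ih
  | cons hs _ ih => cases hs <;> simp [lastValue_cons, ih, Letter.value]

theorem List.exists_flatten_ofFn_eq {A : Type*} {m : ℕ} (f : Fin m → List A) (i : Fin m) :
    ∃ l₁ l₂, (List.ofFn f).flatten = l₁ ++ f i ++ l₂ := by
  obtain ⟨s, t, h⟩ := List.append_of_mem (List.mem_ofFn.2 ⟨i, rfl⟩ : f i ∈ List.ofFn f)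
  exact ⟨s.flatten, t.flatten, by simp [h]⟩

theorem Multiset.coe_ofFn_eq_sum {A : Type*} {m : ℕ} (p : Fin m → A) :
    (List.ofFn p : Multiset A) = ∑ i, {p i} := by
  rw [← List.sum_ofFn, ← Multiset.sum_map_singleton (List.ofFn p : Multiset A)]
  simp [Function.comp_def]

/-- A supported cycle of the capacity leader can be repeated forever by the real system. Two
crowds take turns: while one follows the cycle until its writes are due, the other, which made its
writes during the previous repetition, waits and then follows the remainder of the cycle. -/
theorem hasBuchiRun_of_supported_cycle {C : TransSys (ContribAct G) S}
    {P : Pushdown (LeaderAct G) Q Γ} {ginit : G} {top : LeaderAct G} {M : Multiset S} {q : Q}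
    {A : Γ} {α α' : List Γ} {g : G} {v : List (Letter G)} {K : Set G}
    (hreach : CDReachable C P.toTransSys ginit (M, (q, A :: α), g))
    (hv : (capLeader P.toTransSys ginit).Path (∅, (q, [A]), g) v (K, (q, A :: α'), g))
    (htop : Letter.leader top ∈ v) {m : ℕ} {p : Fin m → S} (hp : OmegaSupported C ginit v p)
    (hM : (List.ofFn p : Multiset S) ≤ M) : HasBuchiRun C P.toTransSys ginit top := by
  obtain ⟨h, w, g', hinj, hvw, hlast, hu⟩ := hp
  obtain rfl : g = g' := by
    have := capLeader_register hv
    simpa [hlast] using this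
  have hrange : ∀ x, Letter.nu x ∈ v → x ∈ Set.range h := by
    intro x hx
    rw [hvw] at hx
    simp only [List.mem_append, List.mem_flatten, List.mem_ofFn, List.mem_map, reduceCtorEq,
      and_false, exists_false, or_false] at hx
    obtain ⟨_, ⟨i, rfl⟩, hx⟩ := hx
    simp only [List.mem_append, List.mem_map, reduceCtorEq, and_false, exists_false,
      List.mem_singleton, Letter.nu.injEq, false_or] at hx
    exact ⟨i, hx.symm⟩
  -- `a`, `b` are the states before and after the designated write; each contributor in `p i`
  -- follows `v` up to `ν(h i)` and is replaced there by one in state `b`, or by one that has not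
  -- yet moved
  have key : ∀ i, ∃ a b, C.tr a (some (.w (h i))) b ∧
      Follows C (h i) a b ∅ g (p i) v (p i) g ∧ Follows C (h i) a (p i) ∅ g (p i) v (p i) g ∧
      Letter.nu (h i) ∈ v := by
    intro i
    obtain ⟨u, x, L, hux, hfil, hpath⟩ := hu i
    obtain ⟨l₁, l₂, hl⟩ := List.exists_flatten_ofFn_eq (fun j : Fin m =>
            x j.castSucc ++ [Letter.nu (h j)]
              ++ (if j = i then [Letter.contrib (.w (h i))] else [])) i
    obtain ⟨u₁, u₂, rfl⟩ : ∃ u₁ u₂, u = u₁ ++ .nu (h i) :: .contrib (.w (h i)) :: u₂ :=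
      ⟨l₁ ++ x i.castSucc, l₂ ++ x (Fin.last m), by rw [hux, hl]; simp⟩
    clear hux hl
    have hv' : v = u₁.filter Letter.inDNu ++ .nu (h i) :: u₂.filter Letter.inDNu := by
      rw [← hfil, List.filter_append, List.filter_cons_of_pos rfl,
        List.filter_cons_of_neg Bool.false_ne_true]
    rw [hv'] at hv
    obtain ⟨hn1, hn2⟩ := capLeader_nu_unique hv
    have hn1' : Letter.nu (h i) ∉ u₁ := fun hm => hn1 (List.mem_filter.2 ⟨hm, rfl⟩)
    have hn2' : Letter.nu (h i) ∉ u₂ := fun hm => hn2 (List.mem_filter.2 ⟨hm, rfl⟩)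
    obtain ⟨c₁, hc1, hc2⟩ := hpath.split
    obtain ⟨c₂, c₃, hc3, hc4, hc5⟩ := hc2.split_cons
    have hc13 := hc1.append hc3
    rw [List.append_nil] at hc13
    cases hc4 with
    | @nu K₁ a g₁ =>
      obtain ⟨c₄, c₅, hc6, hc7, hc8⟩ := hc5.split_cons
      -- silent steps may separate `ν` and the write; they are taken before `ν`
      obtain ⟨a', ha', rfl⟩ := capContrib_path_nil K₁ hc6 rfl
      cases hc7 with
      | @contribWrite _ _ b _ _ htr _ =>
        refine ⟨a', b, htr, ?_, ?_, by rw [hv']; simp⟩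
        · rw [hv']
          refine Follows.of_path hc13 hn1' (.swap .refl ha' ?_)
          have := Follows.of_path hc8 hn2' (h₀ := h i) (a := a') (z := b) (v := [])
            (.quiet .refl)
          simpa using this
        · rw [hv']
          refine Follows.of_path hc13 hn1' (.swap .refl ha' ?_)
          obtain ⟨d₁, hd1, hd2⟩ := hv.split
          obtain ⟨d₂, d₃, hd3, hd4, hd5⟩ := hd2.split_cons
          have hd13 := hd1.append hd3
          rw [List.append_nil] at hd13
          have hcap1 := capContrib_capacity hc13
          have hcap2 := capLeader_capacity hd13
          cases hd4 with
          | @nu K₂ t g₂ hnK =>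
            obtain rfl : K₁ = K₂ := by
              dsimp only at hcap1 hcap2
              rw [hcap1, hcap2]
              ext x
              simp [List.mem_filter, Letter.inDNu]
            exact Follows.of_capLeader hd5 hn2 (p i)
  choose a b hab hf1 hf2 hnu using key
  have hK : Set.range h ⊆ K := by
    rintro _ ⟨i, rfl⟩
    exact capLeader_mem_capacity hv (hnu i)
  -- a first repetition, `hF₂`, leads from two crowds in `p` to one in `p` and one in `b`;
  -- all further repetitions, `hF₁`, lead from such crowds to such crowds
  obtain ⟨F₁, hF₁⟩ := Replay.of_follows (W := ⟨h, a, b, b⟩) hinj hab hv (Set.empty_subset _) hK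
    hrange hf1
  obtain ⟨F₂, hF₂⟩ := Replay.of_follows (W := ⟨h, a, b, p⟩) hinj hab hv (Set.empty_subset _) hK
    hrange hf2
  let κ : Fin m → ℕ := fun i => F₁ i + F₂ i
  replace hF₁ := hF₁ κ 0 (fun i hi => hi.elim) (fun i _ => Nat.le_add_right _ _)
  replace hF₂ := hF₂ κ 0 (fun i hi => hi.elim) (fun i _ => Nat.le_add_left _ _)
  have hres : ∀ z F, reserve ⟨h, a, b, z⟩ ∅ F 0 κ = crowd κ z := by
    intro z F
    simp [reserve, crowd]
  dsimp only at hF₁ hF₂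
  rw [hres] at hF₁ hF₂
  have hcrowd : crowd κ p ≤ (∑ i, κ i) • M := by
    calc crowd κ p ≤ ∑ i, (∑ j, κ j) • {p i} := Finset.sum_le_sum fun i _ =>
          nsmul_le_nsmul_left (Multiset.zero_le _) (Finset.single_le_sum (fun _ _ => Nat.zero_le _)
            (Finset.mem_univ i))
      _ = (∑ j, κ j) • (List.ofFn p : Multiset S) := by
          rw [← Finset.smul_sum, Multiset.coe_ofFn_eq_sum]
      _ ≤ _ := nsmul_le_nsmul_right hM _
  obtain ⟨R, hR⟩ : ∃ R, (2 * ∑ i, κ i + 1) • M = crowd κ p + crowd κ p + R := by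
    refine Multiset.le_iff_exists_add.1 ?_
    rw [add_nsmul, two_mul, add_nsmul]
    exact (add_le_add hcrowd hcrowd).trans (Multiset.le_add_right _ _)
  have hreach' := hreach.nsmul (n := 2 * ∑ i, κ i + 1) (by omega)
  dsimp only at hreach'
  rw [hR] at hreach'
  refine hasBuchiRun_of_recurrent
    (fun c => ∃ β, c = (crowd κ p + crowd κ b + R, (q, A :: β), g)) ?_ ?_
  · obtain ⟨u, hu, -⟩ := hF₂ R α
    obtain ⟨n, hn⟩ := hreach'
    exact ⟨_, ⟨n, hn.trans hu.reflTransGen⟩, _, rfl⟩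
  · rintro _ ⟨β, rfl⟩
    obtain ⟨u, hu, ht⟩ := hF₁ R β
    exact ⟨u, _, hu, ht _ htop, _, rfl⟩

end Cycle

/-! ### Runs that skip actions -/

section LazyRun

variable {A S : Type*}

/-- `LazyRun T ℓ D a s b s'`: between the times `a` and `b` the system `T` goes from `s` to `s'`,
where at each time `t` it performs the action `ℓ t` or stays where it is (it has to stay if
`ℓ t = none`). At times in `D` it does not skip an action. -/
inductive LazyRun (T : TransSys A S) (ℓ : ℕ → Option (Option A)) (D : Set ℕ) :
    ℕ → S → ℕ → S → Prop
  | refl (a : ℕ) (s : S) : LazyRun T ℓ D a s a s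
  | idle {a b s s'} : LazyRun T ℓ D a s b s' → (b ∈ D → ℓ b = none) → LazyRun T ℓ D a s (b + 1) s'
  | step {a b s s' l s''} : LazyRun T ℓ D a s b s' → ℓ b = some l → T.tr s' l s'' →
      LazyRun T ℓ D a s (b + 1) s''

variable {T : TransSys A S} {ℓ : ℕ → Option (Option A)} {D D' : Set ℕ} {a b c : ℕ} {s s' s'' : S}

theorem LazyRun.le (h : LazyRun T ℓ D a s b s') : a ≤ b := by
  induction h with
  | refl => exact le_rfl
  | idle _ _ ih => omega
  | step _ _ _ ih => omega

theorem LazyRun.trans (h : LazyRun T ℓ D a s b s') (h' : LazyRun T ℓ D b s' c s'') :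
    LazyRun T ℓ D a s c s'' := by
  induction h' with
  | refl => exact h
  | idle _ hd ih => exact .idle (ih h) hd
  | step _ hl ht ih => exact .step (ih h) hl ht

theorem LazyRun.mono (h : LazyRun T ℓ D a s b s')
    (hD : ∀ t, a ≤ t → t < b → t ∈ D' → t ∈ D ∨ ℓ t = none) : LazyRun T ℓ D' a s b s' := by
  induction h with
  | refl => exact .refl _ _
  | @idle b _ _ h hd ih =>
    refine .idle (ih fun t h1 h2 => hD t h1 (by omega)) fun hb => ?_
    rcases hD b h.le (by omega) hb with h | h
    · exact hd h
    · exact h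
  | step _ hl ht ih => exact .step (ih fun t h1 h2 => hD t h1 (by omega)) hl ht

theorem LazyRun.wait (s : S) (hab : a ≤ b) (hD : ∀ t, a ≤ t → t < b → t ∈ D → ℓ t = none) :
    LazyRun T ℓ D a s b s := by
  induction b, hab using Nat.le_induction with
  | base => exact .refl _ _
  | succ b hab ih => exact .idle (ih fun t h1 h2 => hD t h1 (by omega)) (hD b hab (by omega))

theorem LazyRun.exists_states (h : LazyRun T ℓ D a s b s') :
    ∃ f : ℕ → S, f a = s ∧ f b = s' ∧ ∀ t, a ≤ t → t < b →
      ((t ∈ D → ℓ t = none) ∧ f (t + 1) = f t) ∨ ∃ l, ℓ t = some l ∧ T.tr (f t) l (f (t + 1)) := by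
  induction h with
  | refl => exact ⟨fun _ => _, rfl, rfl, fun t h1 h2 => by omega⟩
  | @idle b s s' h hd ih =>
    obtain ⟨f, h1, h2, h3⟩ := ih
    have hle := h.le
    refine ⟨Function.update f (b + 1) s', ?_, by simp, fun t ht1 ht2 => ?_⟩
    · rw [Function.update_of_ne (by omega), h1]
    · rw [Function.update_of_ne (show t ≠ b + 1 by omega)]
      rcases eq_or_ne t b with rfl | hne
      · exact .inl ⟨hd, by simp [h2]⟩
      · rw [Function.update_of_ne (by omega)]
        exact h3 t ht1 (by omega)
  | @step b s s' l s'' h hl ht ih =>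
    obtain ⟨f, h1, h2, h3⟩ := ih
    have hle := h.le
    refine ⟨Function.update f (b + 1) s'', ?_, by simp, fun t ht1 ht2 => ?_⟩
    · rw [Function.update_of_ne (by omega), h1]
    · rw [Function.update_of_ne (show t ≠ b + 1 by omega)]
      rcases eq_or_ne t b with rfl | hne
      · exact .inr ⟨l, hl, by simpa [h2] using ht⟩
      · rw [Function.update_of_ne (by omega)]
        exact h3 t ht1 (by omega)

end LazyRun

/-! ### Derivation trees and their height -/

section Trees

variable {A Q Γ : Type*}

/-- The piece of a run of a pushdown system, between the times `start` and `finish`, that begins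
with a symbol on top of the stack and ends when this symbol has been popped: `type` consists of the
control state at the beginning, the symbol, and the control state at the end. -/
structure PopItem (Q Γ : Type*) where
  start : ℕ
  type : Q × Γ × Q
  finish : ℕ

/-- `PopRule P ℓ i t cs`: the piece `i` consists of a step at time `t` and of the pieces `cs`, one
for each symbol pushed. The system may be idle before, between and after them. -/
inductive PopRule (P : Pushdown A Q Γ) (ℓ : ℕ → Option (Option A)) :
    PopItem Q Γ → ℕ → List (PopItem Q Γ) → Prop
  | pop {a t b q X q' l} : ((q, X), l, (q', [])) ∈ P.trans → ℓ t = some l → a ≤ t → t < b →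
      PopRule P ℓ ⟨a, (q, X, q'), b⟩ t []
  | unary {a t a₁ b₁ b q X q₁ Y q' l} : ((q, X), l, (q₁, [Y])) ∈ P.trans → ℓ t = some l → a ≤ t →
      t < a₁ → a₁ ≤ b₁ → b₁ ≤ b → PopRule P ℓ ⟨a, (q, X, q'), b⟩ t [⟨a₁, (q₁, Y, q'), b₁⟩]
  | binary {a t a₁ b₁ a₂ b₂ b q X q₁ Y r Z q' l} : ((q, X), l, (q₁, [Y, Z])) ∈ P.trans →
      ℓ t = some l → a ≤ t → t < a₁ → a₁ ≤ b₁ → b₁ ≤ a₂ → a₂ ≤ b₂ → b₂ ≤ b →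
      PopRule P ℓ ⟨a, (q, X, q'), b⟩ t [⟨a₁, (q₁, Y, r), b₁⟩, ⟨a₂, (r, Z, q'), b₂⟩]

/-- The piece `i` has a derivation tree all of whose types are in `V`. -/
inductive PopTree (P : Pushdown A Q Γ) (ℓ : ℕ → Option (Option A)) (V : Set (Q × Γ × Q)) :
    PopItem Q Γ → Prop
  | mk {i t cs} : i.type ∈ V → PopRule P ℓ i t cs → (∀ c ∈ cs, PopTree P ℓ V c) → PopTree P ℓ V i

/-- The piece `i` has a derivation tree in which the step at time `d` occurs, and the types on the
branch that leads to this step are in `V`. -/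
inductive PopTreeAt (P : Pushdown A Q Γ) (ℓ : ℕ → Option (Option A)) (d : ℕ)
    (V : Set (Q × Γ × Q)) : PopItem Q Γ → Prop
  | here {i cs} : i.type ∈ V → PopRule P ℓ i d cs → (∀ c ∈ cs, PopTree P ℓ Set.univ c) →
      PopTreeAt P ℓ d V i
  | child {i t cs c₀} : i.type ∈ V → PopRule P ℓ i t cs → c₀ ∈ cs → PopTreeAt P ℓ d V c₀ →
      (∀ c ∈ cs, PopTree P ℓ Set.univ c) → PopTreeAt P ℓ d V i

variable {P : Pushdown A Q Γ} {ℓ : ℕ → Option (Option A)} {V : Set (Q × Γ × Q)}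
  {i : PopItem Q Γ} {t d : ℕ} {cs : List (PopItem Q Γ)}

theorem PopRule.widen (h : PopRule P ℓ i t cs) {a b : ℕ} (ha : a ≤ i.start) (hb : i.finish ≤ b) :
    PopRule P ℓ ⟨a, i.type, b⟩ t cs := by
  cases h with
  | pop h1 h2 h3 h4 => exact .pop h1 h2 (ha.trans h3) (h4.trans_le hb)
  | unary h1 h2 h3 h4 h5 h6 => exact .unary h1 h2 (ha.trans h3) h4 h5 (h6.trans hb)
  | binary h1 h2 h3 h4 h5 h6 h7 h8 =>
    exact .binary h1 h2 (ha.trans h3) h4 h5 h6 h7 (h8.trans hb)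

theorem PopRule.time_mem (h : PopRule P ℓ i t cs) : i.start ≤ t ∧ t < i.finish := by
  cases h <;> dsimp only <;> omega

theorem PopRule.child_subset (h : PopRule P ℓ i t cs) {c : PopItem Q Γ} (hc : c ∈ cs) :
    t < c.start ∧ c.finish ≤ i.finish := by
  cases h with
  | pop => cases hc
  | unary =>
    obtain rfl := List.mem_singleton.1 hc
    dsimp only; omega
  | binary =>
    rcases List.mem_pair.1 hc with rfl | rfl <;> dsimp only <;> omega

theorem PopRule.children_disjoint (h : PopRule P ℓ i t cs) {c c' : PopItem Q Γ} (hc : c ∈ cs)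
    (hc' : c' ∈ cs) (hne : c ≠ c') (hd : c.start ≤ d ∧ d < c.finish) :
    ¬ (c'.start ≤ d ∧ d < c'.finish) := by
  cases h with
  | pop => cases hc
  | unary =>
    obtain rfl := List.mem_singleton.1 hc
    exact absurd (List.mem_singleton.1 hc').symm hne
  | binary =>
    rcases List.mem_pair.1 hc with rfl | rfl <;> rcases List.mem_pair.1 hc' with rfl | rfl
    · exact absurd rfl hne
    · dsimp only at *; omega
    · dsimp only at *; omega
    · exact absurd rfl hne

theorem PopTree.widen (h : PopTree P ℓ V i) {a b : ℕ} (ha : a ≤ i.start) (hb : i.finish ≤ b) :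
    PopTree P ℓ V ⟨a, i.type, b⟩ := by
  cases h with
  | mk h1 h2 h3 => exact .mk h1 (h2.widen ha hb) h3

theorem PopTreeAt.widen (h : PopTreeAt P ℓ d V i) {a b : ℕ} (ha : a ≤ i.start)
    (hb : i.finish ≤ b) : PopTreeAt P ℓ d V ⟨a, i.type, b⟩ := by
  cases h with
  | here h1 h2 h3 => exact .here h1 (h2.widen ha hb) h3
  | child h1 h2 h3 h4 h5 => exact .child h1 (h2.widen ha hb) h3 h4 h5

theorem PopTreeAt.time_mem (h : PopTreeAt P ℓ d V i) : i.start ≤ d ∧ d < i.finish := by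
  induction h with
  | here _ h _ => exact h.time_mem
  | child _ h hc _ _ ih =>
    have := h.time_mem
    have := h.child_subset hc
    omega

/-- Either the type `n` can be avoided, or there is an innermost piece of type `n`. -/
theorem PopTree.avoid (h : PopTree P ℓ V i) (n : Q × Γ × Q) :
    PopTree P ℓ (V \ {n}) i ∨ ∃ j t cs, j.type = n ∧ i.start ≤ j.start ∧ j.finish ≤ i.finish ∧
      PopRule P ℓ j t cs ∧ ∀ c ∈ cs, PopTree P ℓ (V \ {n}) c := by
  induction h with
  | @mk i t cs hV hr _ ih =>
    by_cases hall : ∀ c ∈ cs, PopTree P ℓ (V \ {n}) c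
    · by_cases hn : i.type = n
      · exact .inr ⟨i, t, cs, hn, le_rfl, le_rfl, hr, hall⟩
      · exact .inl (.mk ⟨hV, hn⟩ hr hall)
    · push Not at hall
      obtain ⟨c, hc, hnc⟩ := hall
      obtain ⟨j, u, ds, h1, h2, h3, h4⟩ := (ih c hc).resolve_left hnc
      have := hr.time_mem
      have := hr.child_subset hc
      exact .inr ⟨j, u, ds, h1, by omega, by omega, h4⟩

/-- A piece of a run can be shortened such that its type does not occur again inside. -/
theorem PopTree.root (h : PopTree P ℓ V i) :
    ∃ t cs, PopRule P ℓ i t cs ∧ ∀ c ∈ cs, PopTree P ℓ (V \ {i.type}) c := by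
  rcases h.avoid i.type with h | ⟨j, t, cs, h1, h2, h3, h4, h5⟩
  · cases h with
    | mk h => exact absurd rfl h.2
  · refine ⟨t, cs, ?_, h5⟩
    have := h4.widen h2 h3
    rwa [h1] at this

/-- Either the type `n` can be avoided on the branch to the step at time `d`, or there is an
innermost piece of type `n` on this branch. -/
theorem PopTreeAt.avoid (h : PopTreeAt P ℓ d V i) (n : Q × Γ × Q) :
    PopTreeAt P ℓ d (V \ {n}) i ∨ ∃ j t cs, j.type = n ∧ i.start ≤ j.start ∧ j.finish ≤ i.finish ∧
      PopRule P ℓ j t cs ∧ (∀ c ∈ cs, PopTree P ℓ Set.univ c) ∧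
      (t = d ∨ ∃ c ∈ cs, PopTreeAt P ℓ d (V \ {n}) c) := by
  induction h with
  | @here i cs hV hr hcs =>
    by_cases hn : i.type = n
    · exact .inr ⟨i, _, cs, hn, le_rfl, le_rfl, hr, hcs, .inl rfl⟩
    · exact .inl (.here ⟨hV, hn⟩ hr hcs)
  | @child i t cs c₀ hV hr hc _ hcs ih =>
    rcases ih with ih | ⟨j, u, ds, h1, h2, h3, h4⟩
    · by_cases hn : i.type = n
      · exact .inr ⟨i, _, cs, hn, le_rfl, le_rfl, hr, hcs, .inr ⟨c₀, hc, ih⟩⟩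
      · exact .inl (.child ⟨hV, hn⟩ hr hc ih hcs)
    · have := hr.time_mem
      have := hr.child_subset hc
      exact .inr ⟨j, u, ds, h1, by omega, by omega, h4⟩

/-- A piece of a run can be shortened such that its type does not occur again inside on the branch
to the step at time `d`. -/
theorem PopTreeAt.root (h : PopTreeAt P ℓ d V i) :
    ∃ t cs, PopRule P ℓ i t cs ∧ (∀ c ∈ cs, PopTree P ℓ Set.univ c) ∧
      (t = d ∨ ∃ c ∈ cs, PopTreeAt P ℓ d (V \ {i.type}) c) := by
  rcases h.avoid i.type with h | ⟨j, t, cs, h1, h2, h3, h4, h5⟩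
  · cases h with
    | here h => exact absurd rfl h.2
    | child h => exact absurd rfl h.2
  · refine ⟨t, cs, ?_, h5⟩
    have := h4.widen h2 h3
    rwa [h1] at this

/-- The truncated system can perform the piece `i` on top of any stack, using at most `k` stack
symbols more than this stack has. -/
def BoundedPop (P : Pushdown A Q Γ) (ℓ : ℕ → Option (Option A)) (N : ℕ) (hN : 0 < N) (D : Set ℕ)
    (k : ℕ) (i : PopItem Q Γ) : Prop :=
  ∀ (γ : List Γ), γ.length + k ≤ N → ∀ h₁ h₂,
    LazyRun (P.truncated N hN) ℓ D i.start ⟨(i.type.1, i.type.2.1 :: γ), h₁⟩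
      i.finish ⟨(i.type.2.2, γ), h₂⟩

variable {N : ℕ} {hN : 0 < N} {D : Set ℕ} {k : ℕ}

/-- One more symbol than for the children is needed, since below the first child the second pushed
symbol is stored. -/
theorem BoundedPop.of_rule (hr : PopRule P ℓ i t cs) (hk : ∀ c ∈ cs, 0 < k)
    (hcs : ∀ c ∈ cs, BoundedPop P ℓ N hN D k c)
    (hD : ∀ d ∈ D, d = t ∨ ℓ d = none ∨ ∃ c ∈ cs, c.start ≤ d ∧ d < c.finish) :
    BoundedPop P ℓ N hN D (k + 1) i := by
  intro γ hγ h₁ h₂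
  cases hr with
  | @pop a t b q X q' l h1 h2 h3 h4 =>
    have hw : ∀ u ∈ D, u ≠ t → ℓ u = none := fun u hu hne => by simpa [hne] using hD u hu
    have r1 : LazyRun (P.truncated N hN) ℓ D a ⟨(q, X :: γ), h₁⟩ t ⟨(q, X :: γ), h₁⟩ :=
      .wait _ h3 fun u _ _ hu => hw u hu (by omega)
    have r2 : LazyRun (P.truncated N hN) ℓ D t ⟨(q, X :: γ), h₁⟩ (t + 1) ⟨(q', γ), h₂⟩ :=
      .step (.refl _ _) h2 ⟨[], q, X, γ, q', [], rfl, by simp, h1⟩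
    exact (r1.trans r2).trans (.wait _ h4 fun u _ _ hu => hw u hu (by omega))
  | @unary a t a₁ b₁ b q X q₁ Y q' l h1 h2 h3 h4 h5 h6 =>
    have hw : ∀ u ∈ D, u ≠ t → ¬ (a₁ ≤ u ∧ u < b₁) → ℓ u = none := fun u hu hne hn => by
      have := hD u hu
      simp only [hne, List.mem_singleton, exists_eq_left, hn, or_false, false_or] at this
      exact this
    have h₃ : (Y :: γ).length ≤ N := h₁
    have r1 : LazyRun (P.truncated N hN) ℓ D a ⟨(q, X :: γ), h₁⟩ t ⟨(q, X :: γ), h₁⟩ :=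
      .wait _ h3 fun u _ _ hu => hw u hu (by omega) (by omega)
    have r2 : LazyRun (P.truncated N hN) ℓ D t ⟨(q, X :: γ), h₁⟩ (t + 1) ⟨(q₁, Y :: γ), h₃⟩ :=
      .step (.refl _ _) h2 ⟨[], q, X, γ, q₁, [Y], rfl, by simp, h1⟩
    have r3 : LazyRun (P.truncated N hN) ℓ D (t + 1) ⟨(q₁, Y :: γ), h₃⟩ a₁ ⟨(q₁, Y :: γ), h₃⟩ :=
      .wait _ h4 fun u _ _ hu => hw u hu (by omega) (by omega)
    have r4 := hcs _ (List.mem_singleton.2 rfl) γ (by omega) h₃ h₂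
    have r5 : LazyRun (P.truncated N hN) ℓ D b₁ ⟨(q', γ), h₂⟩ b ⟨(q', γ), h₂⟩ :=
      .wait _ h6 fun u _ _ hu => hw u hu (by omega) (by omega)
    exact (((r1.trans r2).trans r3).trans r4).trans r5
  | @binary a t a₁ b₁ a₂ b₂ b q X q₁ Y r Z q' l h1 h2 h3 h4 h5 h6 h7 h8 =>
    have hw : ∀ u ∈ D, u ≠ t → ¬ (a₁ ≤ u ∧ u < b₁) → ¬ (a₂ ≤ u ∧ u < b₂) → ℓ u = none := by
      intro u hu hne hn hn'
      have := hD u hu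
      simp only [List.mem_pair, or_and_right, exists_or, exists_eq_left, hne, hn, hn', or_false,
        false_or] at this
      exact this
    have h₃ : (Y :: Z :: γ).length ≤ N := by
      have := hk _ (List.mem_pair.2 (.inl rfl))
      simp only [List.length_cons]
      omega
    have h₄ : (Z :: γ).length ≤ N := h₁
    have r1 : LazyRun (P.truncated N hN) ℓ D a ⟨(q, X :: γ), h₁⟩ t ⟨(q, X :: γ), h₁⟩ :=
      .wait _ h3 fun u _ _ hu => hw u hu (by omega) (by omega) (by omega)
    have r2 : LazyRun (P.truncated N hN) ℓ D t ⟨(q, X :: γ), h₁⟩ (t + 1) ⟨(q₁, Y :: Z :: γ), h₃⟩ :=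
      .step (.refl _ _) h2 ⟨[], q, X, γ, q₁, [Y, Z], rfl, by simp, h1⟩
    have r3 : LazyRun (P.truncated N hN) ℓ D (t + 1) ⟨(q₁, Y :: Z :: γ), h₃⟩
        a₁ ⟨(q₁, Y :: Z :: γ), h₃⟩ :=
      .wait _ h4 fun u _ _ hu => hw u hu (by omega) (by omega) (by omega)
    have r4 := hcs _ (List.mem_pair.2 (.inl rfl)) (Z :: γ)
      (by simp only [List.length_cons]; omega) h₃ h₄
    have r5 : LazyRun (P.truncated N hN) ℓ D b₁ ⟨(r, Z :: γ), h₄⟩ a₂ ⟨(r, Z :: γ), h₄⟩ :=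
      .wait _ h6 fun u _ _ hu => hw u hu (by omega) (by omega) (by omega)
    have r6 := hcs _ (List.mem_pair.2 (.inr rfl)) γ (by omega) h₄ h₂
    have r7 : LazyRun (P.truncated N hN) ℓ D b₂ ⟨(q', γ), h₂⟩ b ⟨(q', γ), h₂⟩ :=
      .wait _ h8 fun u _ _ hu => hw u hu (by omega) (by omega) (by omega)
    exact (((((r1.trans r2).trans r3).trans r4).trans r5).trans r6).trans r7

theorem BoundedPop.mono {D' : Set ℕ} {k' : ℕ} (h : BoundedPop P ℓ N hN D k i) (hk : k ≤ k')
    (hD : ∀ t, i.start ≤ t → t < i.finish → t ∈ D' → t ∈ D ∨ ℓ t = none) :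
    BoundedPop P ℓ N hN D' k' i :=
  fun γ hγ h₁ h₂ => (h γ (by omega) h₁ h₂).mono hD

theorem PopTree.type_mem (h : PopTree P ℓ V i) : i.type ∈ V := by
  cases h with
  | mk h => exact h

theorem PopTreeAt.type_mem (h : PopTreeAt P ℓ d V i) : i.type ∈ V := by
  cases h with
  | here h => exact h
  | child h => exact h

/-- Every piece can be performed with one stack symbol per type: on each branch of the derivation
tree the repetitions of a type are cut out. -/
theorem PopTree.boundedPop [DecidableEq (Q × Γ × Q)] (W : Finset (Q × Γ × Q))
    (h : PopTree P ℓ W i) : BoundedPop P ℓ N hN ∅ W.card i := by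
  induction hk : W.card generalizing W i with
  | zero =>
    obtain rfl := Finset.card_eq_zero.1 hk
    exact absurd h.type_mem (by simp)
  | succ k ih =>
    obtain ⟨t, cs, h1, h2⟩ := h.root
    have hcard : (W.erase i.type).card = k := by
      rw [Finset.card_erase_of_mem h.type_mem, hk]
      rfl
    refine .of_rule h1 (fun c hc => ?_) (fun c hc => ih (W.erase i.type) (by simpa using h2 c hc)
      hcard) (by simp)
    rw [← hcard]
    exact Finset.card_pos.2 ⟨c.type, by simpa [and_comm] using (h2 c hc).type_mem⟩

/-- To retain the step at time `d` costs as much height again: on the branch that leads to this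
step repetitions of a type are cut out, and so they are in the trees beside this branch. -/
theorem PopTreeAt.boundedPop [Fintype Q] [Fintype Γ] [DecidableEq (Q × Γ × Q)]
    (W : Finset (Q × Γ × Q)) (h : PopTreeAt P ℓ d W i) :
    BoundedPop P ℓ N hN {d} (W.card + Fintype.card (Q × Γ × Q)) i := by
  have side : ∀ c, PopTree P ℓ Set.univ c →
      BoundedPop P ℓ N hN ∅ (Fintype.card (Q × Γ × Q)) c := fun c hc =>
    PopTree.boundedPop Finset.univ (by simpa using hc)
  induction hk : W.card generalizing W i with
  | zero =>
    obtain rfl := Finset.card_eq_zero.1 hk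
    exact absurd h.type_mem (by simp)
  | succ k ih =>
    obtain ⟨t, cs, h1, h2, h3⟩ := h.root
    have hcard : (W.erase i.type).card = k := by
      rw [Finset.card_erase_of_mem h.type_mem, hk]
      rfl
    have hpos : 0 < Fintype.card (Q × Γ × Q) := Fintype.card_pos_iff.2 ⟨i.type⟩
    rw [add_right_comm]
    rcases h3 with rfl | ⟨c₀, hc₀, h3⟩
    · refine .of_rule h1 (fun _ _ => by omega)
        (fun c hc => (side c (h2 c hc)).mono (by omega) ?_) (by simp)
      rintro u hu - rfl
      have := h1.child_subset hc
      omega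
    · have hmem₀ := h3.time_mem
      refine .of_rule h1 (fun _ _ => by omega) (fun c hc => ?_)
        (by rintro _ rfl; exact .inr (.inr ⟨c₀, hc₀, hmem₀⟩))
      by_cases hcc : c = c₀
      · subst hcc
        exact ih (W.erase i.type) (by simpa using h3) hcard
      · refine (side c (h2 c hc)).mono (by omega) ?_
        rintro u hu hu' rfl
        exact absurd ⟨hu, hu'⟩ (h1.children_disjoint hc₀ hc (Ne.symm hcc) hmem₀)

/-- The piece `i` has a derivation tree, and each action in its time interval occurs in one. -/
def PopTreeFull (P : Pushdown A Q Γ) (ℓ : ℕ → Option (Option A)) (i : PopItem Q Γ) : Prop :=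
  PopTree P ℓ Set.univ i ∧
    ∀ d, i.start ≤ d → d < i.finish → ℓ d ≠ none → PopTreeAt P ℓ d Set.univ i

theorem PopTreeFull.of_rule (hr : PopRule P ℓ i t cs) (hcs : ∀ c ∈ cs, PopTreeFull P ℓ c)
    (hd : ∀ d, i.start ≤ d → d < i.finish → ℓ d ≠ none →
      d = t ∨ ∃ c ∈ cs, c.start ≤ d ∧ d < c.finish) :
    PopTreeFull P ℓ i := by
  refine ⟨.mk trivial hr fun c hc => (hcs c hc).1, fun d h1 h2 h3 => ?_⟩
  rcases hd d h1 h2 h3 with rfl | ⟨c, hc, h4, h5⟩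
  · exact .here trivial hr fun c hc => (hcs c hc).1
  · exact .child trivial hr hc ((hcs c hc).2 d h4 h5 h3) fun c hc => (hcs c hc).1

theorem PopTreeFull.boundedPop [Fintype Q] [Fintype Γ] (h : PopTreeFull P ℓ i) (d : ℕ) :
    BoundedPop P ℓ N hN {d} (2 * Fintype.card (Q × Γ × Q)) i := by
  classical
  by_cases hd : i.start ≤ d ∧ d < i.finish ∧ ℓ d ≠ none
  · rw [two_mul]
    exact PopTreeAt.boundedPop Finset.univ (by simpa using h.2 d hd.1 hd.2.1 hd.2.2)
  · refine BoundedPop.mono (PopTree.boundedPop Finset.univ (by simpa using h.1))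
      (by simp only [Finset.card_univ]; omega) ?_
    rintro t h1 h2 rfl
    right
    by_contra h3
    exact hd ⟨h1, h2, h3⟩

end Trees

/-! ### Shortening runs to bounded stack height -/

section Pumping

variable {A Q Γ : Type*}

/-- The sequence `f` of states of `T` performs exactly the actions `ℓ`. -/
def Performs {S : Type*} (T : TransSys A S) (ℓ : ℕ → Option (Option A)) (f : ℕ → S) : Prop :=
  ∀ t, (ℓ t = none ∧ f (t + 1) = f t) ∨ ∃ l, ℓ t = some l ∧ T.tr (f t) l (f (t + 1))

variable {P : Pushdown A Q Γ} {ℓ : ℕ → Option (Option A)} {f : ℕ → Q × List Γ}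

theorem Performs.of_stack_empty (hf : Performs P.toTransSys ℓ f) {a b : ℕ} (hab : a ≤ b)
    (ha : (f a).2 = []) : f b = f a ∧ ℓ b = none := by
  have stuck : ∀ t, (f t).2 = [] → ℓ t = none ∧ f (t + 1) = f t := by
    intro t ht
    refine (hf t).resolve_right ?_
    rintro ⟨l, -, q, X, α, q', β, h1, -⟩
    rw [h1] at ht
    exact absurd ht (by simp)
  have hb : f b = f a := by
    induction b, hab using Nat.le_induction with
    | base => rfl
    | succ b _ ih => rw [(stuck b (by rw [ih]; exact ha)).2, ih]
  exact ⟨hb, (stuck b (by rw [hb]; exact ha)).1⟩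

variable [Fintype Q] [Fintype Γ]

/-- Either the topmost symbol is popped before time `b`, or the symbols pushed below the symbol
that is topmost in the end are useless, so that the truncated system need not store them. -/
theorem pop_or_lazyRun (hP : P.PushPop) (hf : Performs P.toTransSys ℓ f) {a b : ℕ} (hab : a ≤ b)
    {q : Q} {X : Γ} {γ : List Γ} (ha : f a = (q, X :: γ)) :
    (∃ r c, a < c ∧ c ≤ b ∧ f c = (r, γ) ∧ PopTreeFull P ℓ ⟨a, (q, X, r), c⟩) ∨
    ∃ q' Y β, f b = (q', Y :: β) ∧ ∀ d h₁ h₂,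
      LazyRun P.finiteContrib ℓ {d} a ⟨(q, [X]), h₁⟩ b ⟨(q', [Y]), h₂⟩ := by
  induction hn : b - a using Nat.strong_induction_on generalizing a q X γ with
  | _ n ih =>
    rcases hab.eq_or_lt with rfl | hlt
    · exact .inr ⟨q, X, γ, ha, fun _ _ _ => .refl _ _⟩
    have ih1 := fun {q X γ} => ih (b - (a + 1)) (by omega) (a := a + 1) (q := q) (X := X) (γ := γ)
      hlt
    rcases hf a with ⟨hl, hs⟩ | ⟨l, hl, hs⟩
    · rcases ih1 (hs.trans ha) rfl with ⟨r, c, h1, h2, h3, h4⟩ | ⟨q', Y, β, h1, h2⟩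
      · refine .inl ⟨r, c, by omega, h2, h3, h4.1.widen (Nat.le_succ a) le_rfl,
          fun d h5 h6 h7 => ?_⟩
        have : a ≠ d := by rintro rfl; exact h7 hl
        exact (h4.2 d (show a + 1 ≤ d by dsimp only at h5; omega) h6 h7).widen (Nat.le_succ a)
          le_rfl
      · exact .inr ⟨q', Y, β, h1, fun d h₁ h₂ =>
          (LazyRun.idle (.refl _ _) fun _ => hl).trans (h2 d h₁ h₂)⟩
    · obtain ⟨q₀, X₀, γ₀, q₁, β, h1, h2, htr⟩ := hs
      rw [ha] at h1
      obtain ⟨rfl, rfl, rfl⟩ : q₀ = q ∧ X₀ = X ∧ γ₀ = γ := by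
        simpa [eq_comm] using h1
      have hlen := hP _ htr
      have one : ∀ (Y : Γ) (α : List Γ), β = Y :: α → ∀ (d : ℕ) h₁ h₂,
          LazyRun P.finiteContrib ℓ {d} a ⟨(q₀, [X₀]), h₁⟩ (a + 1) ⟨(q₁, [Y]), h₂⟩ := by
        rintro Y α rfl d h₁ h₂
        exact .step (.refl _ _) hl ⟨α, q₀, X₀, [], q₁, Y :: α, rfl, by simp, htr⟩
      match β, hlen, htr, h2, one with
      | [], _, htr, h2, _ =>
        refine .inl ⟨q₁, a + 1, by omega, hlt, h2,
          .of_rule (.pop htr hl le_rfl (Nat.lt_succ_self a))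
          (by simp) fun d h3 h4 _ => .inl ?_⟩
        dsimp only at h3 h4
        omega
      | [Y], _, htr, h2, one =>
        rcases ih1 h2 rfl with ⟨r, c, h3, h4, h5, h6⟩ | ⟨q', Z, δ, h3, h4⟩
        · refine .inl ⟨r, c, by omega, h4, h5, .of_rule (.unary htr hl le_rfl (Nat.lt_succ_self a)
            (by omega) le_rfl) (by simpa using h6) fun d h7 h8 _ => ?_⟩
          dsimp only at h7 h8
          simp only [List.mem_singleton, exists_eq_left]
          omega
        · exact .inr ⟨q', Z, δ, h3, fun d h₁ h₂ => (one _ _ rfl d h₁ h₁).trans (h4 d h₁ h₂)⟩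
      | [Y, Z], _, htr, h2, one =>
        rcases ih1 h2 rfl with ⟨r, c, h3, h4, h5, h6⟩ | ⟨q', Z', δ, h3, h4⟩
        · rcases ih (b - c) (by omega) h4 h5 rfl with
            ⟨r', c', h7, h8, h9, h10⟩ | ⟨q', Z', δ, h7, h8⟩
          · refine .inl ⟨r', c', by omega, h8, h9, .of_rule (.binary (r := r) htr hl le_rfl
              (Nat.lt_succ_self a) h3.le le_rfl h7.le le_rfl) ?_ fun d h11 h12 _ => ?_⟩
            · intro i hi
              rcases List.mem_pair.1 hi with rfl | rfl
              exacts [h6, h10]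
            · dsimp only at h11 h12
              simp only [List.mem_pair, or_and_right, exists_or, exists_eq_left]
              omega
          · refine .inr ⟨q', Z', δ, h7, fun d h₁ h₂ => LazyRun.trans ?_ (h8 d h₁ h₂)⟩
            have h₃ : [Y, Z].length ≤ stackBound Q Γ := by
              simp [stackBound]
            have r1 : LazyRun P.finiteContrib ℓ {d} a ⟨(q₀, [X₀]), h₁⟩ (a + 1)
                ⟨(q₁, [Y, Z]), h₃⟩ :=
              .step (.refl _ _) hl ⟨[], q₀, X₀, [], q₁, [Y, Z], rfl, by simp, htr⟩
            refine r1.trans (h6.boundedPop d [Z] ?_ h₃ h₁)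
            simp only [Fintype.card_prod, List.length_singleton, stackBound]
            ring_nf
            omega
        · exact .inr ⟨q', Z', δ, h3, fun d h₁ h₂ => (one _ _ rfl d h₁ h₁).trans (h4 d h₁ h₂)⟩
      | _ :: _ :: _ :: _, hlen, _, _, _ =>
        simp at hlen

/-- A run of the pushdown system that never goes below its initial height can be shortened to a
run of the truncated system, starting and ending with a single stack symbol, in which any chosen
step is retained. -/
theorem lazyRun_of_performs (hP : P.PushPop) (hf : Performs P.toTransSys ℓ f) {a b : ℕ}
    (hab : a ≤ b) {q : Q} {X : Γ} {γ : List Γ} (ha : f a = (q, X :: γ))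
    (hmin : ∀ t, a ≤ t → t ≤ b → (f a).2.length ≤ (f t).2.length) :
    ∃ q' Y β, f b = (q', Y :: β) ∧ ∀ d h₁ h₂,
      LazyRun P.finiteContrib ℓ {d} a ⟨(q, [X]), h₁⟩ b ⟨(q', [Y]), h₂⟩ := by
  refine (pop_or_lazyRun hP hf hab ha).resolve_left ?_
  rintro ⟨r, c, h1, h2, h3, -⟩
  have := hmin c h1.le h2
  rw [ha, h3] at this
  simp at this

end Pumping

/-! ### Truncated runs between times of minimal stack height -/

section TopConf

variable {A Q Γ : Type*} [Fintype Q] [Fintype Γ]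

/-- The configuration of the truncated system that keeps only the topmost stack symbol. -/
def topConf (s : Q × List Γ) : {s : Q × List Γ // s.2.length ≤ stackBound Q Γ} :=
  ⟨(s.1, s.2.take 1), (List.length_take_le 1 s.2).trans (stackBound_pos Q Γ)⟩

instance finite_truncated_states (N : ℕ) : Finite {s : Q × List Γ // s.2.length ≤ N} := by
  have : Finite {l : List Γ // l.length ≤ N} := (List.finite_length_le Γ N).to_subtype
  refine Finite.of_injective
    (fun s => (s.1.1, (⟨s.1.2, s.2⟩ : {l : List Γ // l.length ≤ N}))) ?_
  rintro ⟨⟨q, l⟩, h⟩ ⟨⟨q', l'⟩, h'⟩ heq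
  simpa using heq

variable {P : Pushdown A Q Γ} {ℓ : ℕ → Option (Option A)} {f : ℕ → Q × List Γ}

/-- Between two times, if the height never is below the initial height, the truncated system can
get by with the topmost symbols at these times, and perform any chosen action. -/
theorem Performs.lazyRun_topConf (hP : P.PushPop) (hf : Performs P.toTransSys ℓ f) {a b : ℕ}
    (hab : a ≤ b) (hmin : ∀ t, a ≤ t → t ≤ b → (f a).2.length ≤ (f t).2.length) (d : ℕ) :
    LazyRun P.finiteContrib ℓ {d} a (topConf (f a)) b (topConf (f b)) := by
  rcases hfa : f a with ⟨q, _ | ⟨X, γ⟩⟩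
  · have := (hf.of_stack_empty hab (by rw [hfa])).1
    rw [this, hfa]
    exact .wait _ hab fun t h1 _ _ => (hf.of_stack_empty h1 (by rw [hfa])).2
  · obtain ⟨q', Y, β, h1, h2⟩ := lazyRun_of_performs hP hf hab hfa hmin
    rw [h1]
    exact h2 d _ _

theorem Performs.lazyRun_init (hP : P.PushPop) (hf : Performs P.toTransSys ℓ f) {b : ℕ}
    (h0 : f 0 = (P.init, [P.initSym])) (hb : (f b).2 ≠ []) (d : ℕ) :
    LazyRun P.finiteContrib ℓ {d} 0 P.finiteContrib.init b (topConf (f b)) := by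
  have := hf.lazyRun_topConf hP (Nat.zero_le b) (fun t _ ht => ?_) d
  · rw [h0] at this
    exact this
  · rw [h0]
    refine List.length_pos_iff.2 fun h => hb ?_
    rw [(hf.of_stack_empty ht h).1, h]

theorem LazyRun.split {S : Type*} {T : TransSys A S} {D : Set ℕ} {a b c : ℕ} {s s' : S}
    (h : LazyRun T ℓ D a s b s') (hac : a ≤ c) (hcb : c ≤ b) :
    ∃ m, LazyRun T ℓ D a s c m ∧ LazyRun T ℓ D c m b s' := by
  induction h with
  | refl =>
    obtain rfl : c = a := by omega
    exact ⟨_, .refl _ _, .refl _ _⟩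
  | idle h hd ih =>
    rcases hcb.eq_or_lt with rfl | hlt
    · exact ⟨_, .idle h hd, .refl _ _⟩
    · obtain ⟨m, h1, h2⟩ := ih (by omega)
      exact ⟨m, h1, .idle h2 hd⟩
  | step h hl ht ih =>
    rcases hcb.eq_or_lt with rfl | hlt
    · exact ⟨_, .step h hl ht, .refl _ _⟩
    · obtain ⟨m, h1, h2⟩ := ih (by omega)
      exact ⟨m, h1, .step h2 hl ht⟩

/-- Every sequence of stack heights has, arbitrarily late, a time after which it never is lower. -/
theorem Nat.exists_ge_forall_le (h : ℕ → ℕ) (a : ℕ) : ∃ b ≥ a, ∀ t ≥ b, h b ≤ h t := by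
  have hne : (h '' Set.Ici a).Nonempty := ⟨_, a, Set.self_mem_Ici, rfl⟩
  obtain ⟨b, hb, he⟩ := Nat.sInf_mem hne
  exact ⟨b, hb, fun t ht => by
    rw [he]
    exact Nat.sInf_le ⟨t, le_trans hb ht, rfl⟩⟩

end TopConf

/-! ### Runs of named contributors -/

section NamedRun

variable {G S T : Type*}

/-- A Büchi run with `n` contributors that have names: `x k i` is the state of contributor `i` at
time `k`, `t k` the state of the leader, `ρ k` the register, and `ev k` is the action at time `k`
with its actor. -/
structure NamedRun (C : TransSys (ContribAct G) S) (D : TransSys (LeaderAct G) T) (ginit : G)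
    (top : LeaderAct G) (n : ℕ) where
  x : ℕ → Fin n → S
  t : ℕ → T
  ρ : ℕ → G
  ev : ℕ → Option (LeaderAct G) ⊕ (Fin n × Option (ContribAct G))
  x_zero : ∀ i, x 0 i = C.init
  t_zero : t 0 = D.init
  ρ_zero : ρ 0 = ginit
  leader : ∀ k l, ev k = .inl l →
    D.tr (t k) l (t (k + 1)) ∧ LeaderReg l (ρ k) (ρ (k + 1)) ∧ x (k + 1) = x k
  contrib : ∀ k i l, ev k = .inr (i, l) →
    C.tr (x k i) l (x (k + 1) i) ∧ ContribReg l (ρ k) (ρ (k + 1)) ∧ t (k + 1) = t k ∧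
      ∀ j, j ≠ i → x (k + 1) j = x k j
  top_infinite : ∀ k, ∃ k' ≥ k, ev k' = .inl (some top)

variable {C : TransSys (ContribAct G) S} {D : TransSys (LeaderAct G) T} {ginit : G}
  {top : LeaderAct G}

theorem MultiStep.exists_named {n : ℕ} {x : Fin n → S} {M M' : Multiset S}
    {l : Option (ContribAct G)} (h : MultiStep C M l M') (hM : Finset.univ.val.map x = M) :
    ∃ i x', C.tr (x i) l (x' i) ∧ (∀ j, j ≠ i → x' j = x j) ∧ Finset.univ.val.map x' = M' := by
  subst hM
  obtain ⟨s, s', R, hs, hx, rfl⟩ := h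
  have hmem : s ∈ Finset.univ.val.map x := by rw [hx]; exact Multiset.mem_cons_self _ _
  obtain ⟨i, -, rfl⟩ := Multiset.mem_map.1 hmem
  refine ⟨i, Function.update x i s', by simpa using hs,
    fun j hj => Function.update_of_ne hj _ _, ?_⟩
  have huniv : (Finset.univ : Finset (Fin n)).val = i ::ₘ (Finset.univ.erase i).val := by
    rw [Finset.erase_val, Multiset.cons_erase (Finset.mem_univ_val i)]
  rw [huniv, Multiset.map_cons] at hx ⊢
  rw [Function.update_self, ← (Multiset.cons_inj_right _).1 hx]
  congr 1
  refine Multiset.map_congr rfl fun j hj => ?_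
  exact Function.update_of_ne (Finset.ne_of_mem_erase (s := Finset.univ) hj) _ _

theorem HasBuchiRun.exists_namedRun (h : HasBuchiRun C D ginit top) :
    ∃ n, Nonempty (NamedRun C D ginit top n) := by
  obtain ⟨n, c, a, h0, hs, ht⟩ := h
  refine ⟨n, ?_⟩
  let Rel : (Fin n → S) → Multiset S × T × G →
      Option (LeaderAct G) ⊕ (Fin n × Option (ContribAct G)) → (Fin n → S) →
      Multiset S × T × G → Prop := fun x c e x' c' =>
    (∀ l, e = .inl l → D.tr c.2.1 l c'.2.1 ∧ LeaderReg l c.2.2 c'.2.2 ∧ x' = x) ∧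
    (∀ i l, e = .inr (i, l) → C.tr (x i) l (x' i) ∧ ContribReg l c.2.2 c'.2.2 ∧
      c'.2.1 = c.2.1 ∧ ∀ j, j ≠ i → x' j = x j)
  have hleader : ∀ (x : Fin n → S) (c c' : Multiset S × T × G) l, D.tr c.2.1 l c'.2.1 →
      LeaderReg l c.2.2 c'.2.2 → Rel x c (.inl l) x c' := by
    intro x c c' l h1 h2
    refine ⟨?_, by simp⟩
    rintro _ ⟨⟩
    exact ⟨h1, h2, rfl⟩
  have hcontrib : ∀ (x x' : Fin n → S) (c c' : Multiset S × T × G) i l, C.tr (x i) l (x' i) →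
      ContribReg l c.2.2 c'.2.2 → c'.2.1 = c.2.1 → (∀ j, j ≠ i → x' j = x j) →
      Rel x c (.inr (i, l)) x' c' := by
    intro x x' c c' i l h1 h2 h3 h4
    refine ⟨by simp, ?_⟩
    rintro _ _ ⟨⟩
    exact ⟨h1, h2, h3, h4⟩
  have next : ∀ k (x : {x : Fin n → S // Finset.univ.val.map x = (c k).1}),
      ∃ (e : _) (x' : {x : Fin n → S // Finset.univ.val.map x = (c (k + 1)).1}),
        Rel x.1 (c k) e x'.1 (c (k + 1)) ∧ (a k = some (.leader top) → e = .inl (some top)) := by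
    rintro k ⟨x, hx⟩
    have hk := hs k
    generalize c k = c₁ at *
    generalize c (k + 1) = c₂ at *
    generalize a k = b at *
    cases hk with
    | leaderWrite h =>
      exact ⟨_, ⟨x, hx⟩, hleader _ _ _ _ h (.write _ _), by rintro ⟨⟩; rfl⟩
    | leaderRead h =>
      exact ⟨_, ⟨x, hx⟩, hleader _ _ _ _ h (.read _), by rintro ⟨⟩; rfl⟩
    | leaderSilent h =>
      exact ⟨_, ⟨x, hx⟩, hleader _ _ _ _ h (.silent _), by rintro ⟨⟩⟩
    | contribWrite h =>
      obtain ⟨i, x', h1, h2, h3⟩ := h.exists_named hx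
      exact ⟨_, ⟨x', h3⟩, hcontrib _ _ _ _ _ _ h1 (.write _ _) rfl h2, by rintro ⟨⟩⟩
    | contribRead h =>
      obtain ⟨i, x', h1, h2, h3⟩ := h.exists_named hx
      exact ⟨_, ⟨x', h3⟩, hcontrib _ _ _ _ _ _ h1 (.read _) rfl h2, by rintro ⟨⟩⟩
    | contribSilent h =>
      obtain ⟨i, x', h1, h2, h3⟩ := h.exists_named hx
      exact ⟨_, ⟨x', h3⟩, hcontrib _ _ _ _ _ _ h1 (.silent _) rfl h2, by rintro ⟨⟩⟩
  choose ev nxt hnxt using next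
  have hinit : Finset.univ.val.map (fun _ : Fin n => C.init) = (c 0).1 := by
    rw [h0]
    simp [initConfig]
  let x : ∀ k, {x : Fin n → S // Finset.univ.val.map x = (c k).1} :=
    fun k => Nat.rec ⟨_, hinit⟩ nxt k
  exact ⟨{
    x := fun k => (x k).1
    t := fun k => (c k).2.1
    ρ := fun k => (c k).2.2
    ev := fun k => ev k (x k)
    x_zero := fun i => rfl
    t_zero := by rw [h0]; rfl
    ρ_zero := by rw [h0]; rfl
    leader := fun k l hl => (hnxt k (x k)).1.1 l hl
    contrib := fun k i l hl => (hnxt k (x k)).1.2 i l hl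
    top_infinite := fun k => by
      obtain ⟨k', h1, h2⟩ := ht.exists_gt k
      exact ⟨k', h2.le, (hnxt k' (x k')).2 h1⟩ }⟩

namespace NamedRun

variable {n : ℕ} (r : NamedRun C D ginit top n)

/-- The action of contributor `i` at time `k`, if any. -/
def contribLabel (i : Fin n) (k : ℕ) : Option (Option (ContribAct G)) :=
  match r.ev k with
  | .inl _ => none
  | .inr (j, l) => if j = i then some l else none

/-- The action of the leader at time `k`, if any. -/
def leaderLabel (k : ℕ) : Option (Option (LeaderAct G)) :=
  match r.ev k with
  | .inl l => some l
  | .inr _ => none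

theorem contribLabel_eq_some {i : Fin n} {k : ℕ} {l : Option (ContribAct G)} :
    r.contribLabel i k = some l ↔ r.ev k = .inr (i, l) := by
  unfold contribLabel
  split
  · next h => simp [h]
  · next h =>
    rw [h]
    split
    · next h => simp [h]
    · next h => simp [h]

theorem leaderLabel_eq_some {k : ℕ} {l : Option (LeaderAct G)} :
    r.leaderLabel k = some l ↔ r.ev k = .inl l := by
  unfold leaderLabel
  split <;> next h => simp [h]

theorem performs_contrib (i : Fin n) : Performs C (r.contribLabel i) fun k => r.x k i := by
  intro k
  cases h : r.contribLabel i k with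
  | some l => exact .inr ⟨l, rfl, (r.contrib k i l (r.contribLabel_eq_some.1 h)).1⟩
  | none =>
    refine .inl ⟨rfl, ?_⟩
    rcases hev : r.ev k with l | ⟨j, l⟩
    · exact congrFun (r.leader k l hev).2.2 i
    · refine (r.contrib k j l hev).2.2.2 i ?_
      rintro rfl
      rw [r.contribLabel_eq_some.2 hev] at h
      cases h

theorem performs_leader : Performs D r.leaderLabel r.t := by
  intro k
  cases h : r.leaderLabel k with
  | some l => exact .inr ⟨l, rfl, (r.leader k l (r.leaderLabel_eq_some.1 h)).1⟩
  | none =>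
    refine .inl ⟨rfl, ?_⟩
    rcases hev : r.ev k with l | ⟨j, l⟩
    · rw [r.leaderLabel_eq_some.2 hev] at h
      cases h
    · exact (r.contrib k j l hev).2.2.1

/-- At time `k` some contributor writes `h`. -/
def Writes (k : ℕ) (h : G) : Prop := ∃ i, r.ev k = .inr (i, some (.w h))

/-- The values that contributors write infinitely often. -/
def recurrentValues : Set G := {h | ∀ a, ∃ k ≥ a, r.Writes k h}

theorem exists_forall_writes_recurrent [Finite G] :
    ∃ a, ∀ k ≥ a, ∀ h, r.Writes k h → h ∈ r.recurrentValues := by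
  classical
  have : ∀ h, ∃ a, h ∉ r.recurrentValues → ∀ k ≥ a, ¬ r.Writes k h := by
    intro h
    by_cases hh : h ∈ r.recurrentValues
    · exact ⟨0, fun h' => absurd hh h'⟩
    · simp only [recurrentValues, Set.mem_ofPred_eq, not_forall, not_exists, not_and] at hh
      obtain ⟨a, ha⟩ := hh
      exact ⟨a, fun _ => ha⟩
  choose a ha using this
  have := Fintype.ofFinite G
  refine ⟨Finset.univ.sup a, fun k hk h hw => ?_⟩
  by_contra hh
  exact ha h hh k ((Finset.le_sup (Finset.mem_univ h)).trans hk) hw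

end NamedRun

end NamedRun

/-! ### Checkpoints -/

section Checkpoint

variable {G QC ΓC QD ΓD : Type*} [Fintype QC] [Fintype ΓC]
  {AC : Pushdown (ContribAct G) QC ΓC} {AD : Pushdown (LeaderAct G) QD ΓD} {ginit : G}
  {top : LeaderAct G} {n : ℕ}

/-- What has to agree at the two ends of a cycle: the register value, the control state and the
topmost stack symbol of the leader, and for each recurrent value the contributor that is the next
to write it, with its state in a truncated run. -/
abbrev CheckpointType (r : NamedRun AC.toTransSys AD.toTransSys ginit top n) :=
  G × (QD × ΓD) × (r.recurrentValues →
    Fin n × {s : QC × List ΓC // s.2.length ≤ stackBound QC ΓC})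

/-- A time `last + 1` at which a cycle of the given type may begin or end, just after an action of
the leader on the register. Only silent leader steps separate it from a time `μ` at which the
leader's stack is no higher than at any later time. The next write of a recurrent value `h` is made
by its contributor at time `write h`, which is enclosed by two times `before` and `after h` at which
the contributor's stack is no higher than at any later time; a truncated run leads from the one to
the other. Everything happens between the times `base` and `bound`. -/
structure Checkpoint (r : NamedRun AC.toTransSys AD.toTransSys ginit top n) (base : ℕ)
    (ty : CheckpointType r) (bound : ℕ) where
  last : ℕ
  μ : ℕ
  before : Fin n → ℕ
  write : r.recurrentValues → ℕ
  after : r.recurrentValues → ℕ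
  act : LeaderAct G
  rest : List ΓD
  base_le_before : ∀ i, base ≤ before i
  before_le_last : ∀ i, before i ≤ last
  before_min : ∀ i t, before i ≤ t → (r.x (before i) i).2.length ≤ (r.x t i).2.length
  exists_top : ∃ k, base ≤ k ∧ k ≤ last ∧ r.ev k = .inl (some top)
  ev_last : r.ev last = .inl (some act)
  value_act : (Letter.leader act).value = ty.1
  last_lt : last < μ
  silent : ∀ k, last < k → k < μ → ∀ l, r.ev k = .inl l → l = none
  leader_min : ∀ t, μ ≤ t → (r.t μ).2.length ≤ (r.t t).2.length
  leader_top : r.t μ = (ty.2.1.1, ty.2.1.2 :: rest)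
  last_lt_write : ∀ h, last < write h
  ev_write : ∀ h, r.ev (write h) = .inr ((ty.2.2 h).1, some (.w h))
  first : ∀ h k, last < k → k < write h → ¬ r.Writes k h
  write_lt_after : ∀ h, write h < after h
  after_min : ∀ h t, after h ≤ t →
    (r.x (after h) (ty.2.2 h).1).2.length ≤ (r.x t (ty.2.2 h).1).2.length
  lazy_before : ∀ h, LazyRun AC.finiteContrib (r.contribLabel (ty.2.2 h).1) {write h}
    (before (ty.2.2 h).1) (topConf (r.x (before (ty.2.2 h).1) (ty.2.2 h).1)) (last + 1)
    (ty.2.2 h).2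
  lazy_after : ∀ h, LazyRun AC.finiteContrib (r.contribLabel (ty.2.2 h).1) {write h}
    (last + 1) (ty.2.2 h).2 (after h) (topConf (r.x (after h) (ty.2.2 h).1))
  μ_le : μ ≤ bound
  after_le : ∀ h, after h ≤ bound

variable {r : NamedRun AC.toTransSys AD.toTransSys ginit top n}

theorem exists_checkpoint [Finite G] (hAC : AC.PushPop)
    (r : NamedRun AC.toTransSys AD.toTransSys ginit top n) (base : ℕ) :
    ∃ ty bound, Nonempty (Checkpoint r base ty bound) := by
  classical
  have hmin := fun i => Nat.exists_ge_forall_le (fun k => (r.x k i).2.length) base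
  choose before hb1 hb2 using hmin
  obtain ⟨a₀, ha1, ha2⟩ := r.top_infinite (max base (Finset.univ.sup before))
  obtain ⟨μ, hμ1, hμ2⟩ := Nat.exists_ge_forall_le (fun k => (r.t k).2.length) (a₀ + 1)
  -- the last action of the leader on the register before `μ`
  let acts : ℕ → Prop := fun k => k < μ ∧ ∃ a, r.ev k = .inl (some a)
  have hacts : acts a₀ := ⟨hμ1, _, ha2⟩
  let last := Nat.findGreatest acts μ
  have hlast0 : a₀ ≤ last := Nat.le_findGreatest hacts.1.le hacts
  obtain ⟨hlastμ, act, hact⟩ : acts last := Nat.findGreatest_spec (P := acts) hacts.1.le hacts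
  have hbefore : ∀ i, before i ≤ last := fun i =>
    (((Finset.le_sup (Finset.mem_univ i)).trans (le_max_right _ _)).trans ha1).trans hlast0
  have hsilent : ∀ k, last < k → k < μ → ∀ l, r.ev k = .inl l → l = none := by
    intro k h1 h2 l hl
    cases l with
    | none => rfl
    | some a => exact absurd ⟨h2, a, hl⟩ (Nat.findGreatest_is_greatest h1 h2.le)
  obtain ⟨X, rest, htop⟩ : ∃ X rest, r.t μ = ((r.t μ).1, X :: rest) := by
    rcases hst : r.t μ with ⟨q, _ | ⟨X, γ⟩⟩
    · obtain ⟨k, hk1, hk2⟩ := r.top_infinite μ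
      have := (r.performs_leader.of_stack_empty hk1 (by rw [hst])).2
      rw [r.leaderLabel_eq_some.2 hk2] at this
      cases this
    · exact ⟨X, γ, rfl⟩
  have hwrite : ∀ h : r.recurrentValues, ∃ d, last < d ∧ r.Writes d h ∧
      ∀ k, last < k → k < d → ¬ r.Writes k h := by
    intro h
    have hex : ∃ d, last < d ∧ r.Writes d h := by
      obtain ⟨d, h1, h2⟩ := h.2 (last + 1)
      exact ⟨d, h1, h2⟩
    exact ⟨Nat.find hex, (Nat.find_spec hex).1, (Nat.find_spec hex).2,
      fun k h1 h2 h3 => Nat.find_min hex h2 ⟨h1, h3⟩⟩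
  choose write hw1 hw2 hw3 using hwrite
  choose c hc using hw2
  have hafter := fun h => Nat.exists_ge_forall_le (fun k => (r.x k (c h)).2.length) (write h + 1)
  choose after haf1 haf2 using hafter
  have hlazy : ∀ h, ∃ s, LazyRun AC.finiteContrib (r.contribLabel (c h)) {write h}
      (before (c h)) (topConf (r.x (before (c h)) (c h))) (last + 1) s ∧
      LazyRun AC.finiteContrib (r.contribLabel (c h)) {write h} (last + 1) s (after h)
        (topConf (r.x (after h) (c h))) := by
    intro h
    have h1 := hbefore (c h)
    have h2 := hw1 h
    have h3 := haf1 h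
    exact ((r.performs_contrib (c h)).lazyRun_topConf hAC (show before (c h) ≤ after h by omega)
      (fun t ht _ => hb2 _ t ht) (write h)).split (by omega) (by omega)
  choose s hs1 hs2 using hlazy
  have := Fintype.ofFinite r.recurrentValues
  exact ⟨((Letter.leader act).value, ((r.t μ).1, X), fun h => (c h, s h)),
    max μ (Finset.univ.sup after), ⟨{
      last := last
      μ := μ
      before := before
      write := write
      after := after
      act := act
      rest := rest
      base_le_before := hb1
      before_le_last := hbefore
      before_min := hb2
      exists_top := ⟨a₀, (le_max_left _ _).trans ha1, hlast0, ha2⟩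
      ev_last := hact
      value_act := rfl
      last_lt := hlastμ
      silent := hsilent
      leader_min := hμ2
      leader_top := htop
      last_lt_write := hw1
      ev_write := hc
      first := hw3
      write_lt_after := haf1
      after_min := haf2
      lazy_before := hs1
      lazy_after := hs2
      μ_le := le_max_left _ _
      after_le := fun h => (Finset.le_sup (Finset.mem_univ h)).trans (le_max_right _ _) }⟩⟩

/-- Checkpoints of one and the same type occur arbitrarily late, since there are finitely many
types. -/
theorem exists_recurrent_checkpoint [Finite G] [Finite QD] [Finite ΓD] (hAC : AC.PushPop)
    (r : NamedRun AC.toTransSys AD.toTransSys ginit top n) :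
    ∃ ty, ∀ base, ∃ base' bound, base ≤ base' ∧ Nonempty (Checkpoint r base' ty bound) := by
  classical
  -- if type `ty` did not occur after time `f ty`, a checkpoint after the largest `f ty` would have
  -- no type
  by_contra! hcon
  choose f hf using hcon
  have := Fintype.ofFinite (CheckpointType r)
  obtain ⟨ty, bound, ⟨c⟩⟩ := exists_checkpoint hAC r (Finset.univ.sup f)
  exact (hf ty _ bound (Finset.le_sup (Finset.mem_univ ty))).false c

end Checkpoint

/-! ### The shape of supporting words -/

section Shape

variable {G S T A : Type*}

/-- The list `f 0 ++ g 0 ++ f 1 ++ g 1 ++ ⋯ ++ g (m - 1) ++ f m`. -/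
def interleave {m : ℕ} (f : Fin (m + 1) → List A) (g : Fin m → List A) : List A :=
  (List.ofFn fun j : Fin m => f j.castSucc ++ g j).flatten ++ f (Fin.last m)

theorem interleave_zero (f : Fin 1 → List A) (g : Fin 0 → List A) : interleave f g = f 0 := by
  simp [interleave]

theorem interleave_succ {m : ℕ} (f : Fin (m + 2) → List A) (g : Fin (m + 1) → List A) :
    interleave f g = f 0 ++ (g 0 ++ interleave (fun j => f j.succ) (fun j => g j.succ)) := by
  simp [interleave, List.ofFn_succ]

/-- A word over `Σ_{D,ν}` is composed of words of leader actions, separated by first writes. -/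
theorem exists_interleave (v : List (Letter G)) (hv : ∀ a ∈ v, a.inDNu = true) :
    ∃ (m : ℕ) (h : Fin m → G) (w : Fin (m + 1) → List (LeaderAct G)),
      v = interleave (fun j => (w j).map Letter.leader) (fun j => [Letter.nu (h j)]) := by
  induction v with
  | nil => exact ⟨0, Fin.elim0, fun _ => [], by simp [interleave_zero]⟩
  | cons a v ih =>
    obtain ⟨m, h, w, rfl⟩ := ih fun a ha => hv a (List.mem_cons_of_mem _ ha)
    have ha := hv a (List.mem_cons_self ..)
    cases a with
    | leader a =>
      refine ⟨m, h, Fin.cons (a :: w 0) (fun j => w j.succ), ?_⟩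
      cases m with
      | zero => simp [interleave_zero]
      | succ m => simp [interleave_succ]
    | contrib a => simp [Letter.inDNu] at ha
    | nu x => exact ⟨m + 1, Fin.cons x h, Fin.cons [] w, by simp [interleave_succ]⟩

/-- The letters outside `Σ_{D,ν}` may be assigned to the words between the first writes. -/
theorem exists_interleave_of_filter {m : ℕ} (h : Fin m → G) (w : Fin (m + 1) → List (LeaderAct G))
    (u : List (Letter G)) (hu : u.filter Letter.inDNu =
      interleave (fun j => (w j).map Letter.leader) (fun j => [Letter.nu (h j)])) :
    ∃ x, u = interleave x (fun j => [Letter.nu (h j)]) := by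
  induction m generalizing u with
  | zero => exact ⟨fun _ => u, by simp [interleave_zero]⟩
  | succ m ih =>
    rw [interleave_succ, List.filter_eq_append_iff] at hu
    obtain ⟨u₁, u₂, rfl, -, hu⟩ := hu
    rw [List.singleton_append, List.filter_eq_cons_iff] at hu
    obtain ⟨u₃, u₄, rfl, -, -, hu⟩ := hu
    obtain ⟨x, rfl⟩ := ih (fun j => h j.succ) (fun j => w j.succ) u₄ hu
    exact ⟨Fin.cons (u₁ ++ u₃) x, by simp [interleave_succ]⟩

/-- The letter `b` that follows `ν(h i)` can be assigned to this first write, which is recognizable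
as the only one of the value `h i`. -/
theorem exists_interleave_of_filter_insert {m : ℕ} (h : Fin m → G) (hh : Function.Injective h)
    (w : Fin (m + 1) → List (LeaderAct G)) (i : Fin m) (b : Letter G) (u₁ u₂ : List (Letter G))
    (hu : (u₁ ++ .nu (h i) :: u₂).filter Letter.inDNu =
      interleave (fun j => (w j).map Letter.leader) (fun j => [Letter.nu (h j)])) :
    ∃ x, u₁ ++ .nu (h i) :: b :: u₂ =
      interleave x (fun j => [Letter.nu (h j)] ++ if j = i then [b] else []) := by
  induction m generalizing u₁ with
  | zero => exact i.elim0
  | succ m ih =>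
    rw [interleave_succ, List.filter_append, List.filter_cons_of_pos rfl,
      List.singleton_append] at hu
    rcases Fin.eq_zero_or_eq_succ i with rfl | ⟨i, rfl⟩
    · rw [List.append_eq_append_iff] at hu
      have hw : Letter.nu (h 0) ∉ (w 0).map Letter.leader := by simp
      have hrest : Letter.nu (h 0) ∉ interleave
          (fun j : Fin (m + 1) => (w j.succ).map Letter.leader)
          (fun j : Fin m => [Letter.nu (h j.succ)]) := by
        simp [interleave, hh.eq_iff, (Fin.succ_ne_zero _).symm]
      have hu2 : u₂.filter Letter.inDNu = interleave
          (fun j : Fin (m + 1) => (w j.succ).map Letter.leader)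
          (fun j : Fin m => [Letter.nu (h j.succ)]) := by
        rcases hu with ⟨l, h1, h2⟩ | ⟨l, h1, h2⟩
        · cases l with
          | nil => simpa using h2
          | cons a l =>
            obtain ⟨rfl, -⟩ := List.cons_eq_cons.1 h2
            exact absurd (by rw [h1]; simp) hw
        · cases l with
          | nil => simpa using h2.symm
          | cons a l =>
            obtain ⟨rfl, h3⟩ := List.cons_eq_cons.1 h2
            exact absurd (by rw [h3]; simp) hrest
      obtain ⟨x, hx⟩ := exists_interleave_of_filter _ _ _ hu2
      refine ⟨Fin.cons u₁ x, ?_⟩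
      rw [interleave_succ, hx]
      simp [Fin.succ_ne_zero]
    · have hne : h i.succ ≠ h 0 := fun hc => Fin.succ_ne_zero i (hh hc)
      obtain ⟨u₃, u₄, rfl, hu'⟩ : ∃ u₃ u₄, u₁ = u₃ ++ .nu (h 0) :: u₄ ∧
          (u₄ ++ .nu (h i.succ) :: u₂).filter Letter.inDNu = interleave
            (fun j : Fin (m + 1) => (w j.succ).map Letter.leader)
            (fun j : Fin m => [Letter.nu (h j.succ)]) := by
        rw [List.append_eq_append_iff] at hu
        rcases hu with ⟨l, h1, h2⟩ | ⟨l, h1, h2⟩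
        · exfalso
          cases l with
          | nil => exact hne (by simpa using (List.cons_eq_cons.1 h2).1)
          | cons a l =>
            obtain ⟨rfl, -⟩ := List.cons_eq_cons.1 h2
            have : Letter.nu (h i.succ) ∈ (w 0).map Letter.leader := by rw [h1]; simp
            simp at this
        · cases l with
          | nil => exact absurd (by simpa using ((List.cons_eq_cons.1 h2).1).symm) hne
          | cons a l =>
            obtain ⟨rfl, h3⟩ := List.cons_eq_cons.1 h2
            rw [List.filter_eq_append_iff] at h1
            obtain ⟨a₁, a₂, rfl, -, h1⟩ := h1
            rw [List.filter_eq_cons_iff] at h1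
            obtain ⟨a₃, a₄, rfl, -, -, h1⟩ := h1
            refine ⟨a₁ ++ a₃, a₄, by simp, ?_⟩
            rw [List.filter_append, List.filter_cons_of_pos rfl, h1, h3]
            rfl
      obtain ⟨x, hx⟩ := ih (fun j => h j.succ) (fun a b hab => Fin.succ_injective _ (hh hab))
        (fun j => w j.succ) i u₄ hu'
      refine ⟨Fin.cons u₃ x, ?_⟩
      rw [interleave_succ]
      simp only [List.append_assoc, List.cons_append, hx]
      simp [(Fin.succ_ne_zero _).symm]

/-- `ω`-support can be checked for each first write separately. -/
theorem exists_omegaSupported {C : TransSys (ContribAct G) S} {D : TransSys (LeaderAct G) T}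
    {ginit g : G} {v : List (Letter G)} {c : Set G × T × G} {t : T}
    (hv : ∀ a ∈ v, a.inDNu = true) (hlast : lastValue v = some g)
    (hpath : (capLeader D ginit).Path (∅, t, g) v c) (p : G → S)
    (hp : ∀ h, Letter.nu h ∈ v → ∃ u₁ u₂ K,
      (u₁ ++ .nu h :: .contrib (.w h) :: u₂).filter Letter.inDNu = v ∧
      (capContrib C ginit).Path (∅, p h, g) (u₁ ++ .nu h :: .contrib (.w h) :: u₂) (K, p h, g)) :
    ∃ (m : ℕ) (h : Fin m → G), (∀ i, Letter.nu (h i) ∈ v) ∧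
      OmegaSupported C ginit v fun i => p (h i) := by
  obtain ⟨m, h, w, hvw⟩ := exists_interleave v hv
  have hmem : ∀ i, Letter.nu (h i) ∈ v := by
    intro i
    rw [hvw]
    refine List.mem_append_left _ (List.mem_flatten.2 ⟨_, List.mem_ofFn.2 ⟨i, rfl⟩, by simp⟩)
  have hinj : Function.Injective h := by
    suffices H : ∀ i j, i < j → h i ≠ h j by
      intro i j hij
      by_contra hne
      rcases lt_or_gt_of_ne hne with hlt | hlt
      · exact H _ _ hlt hij
      · exact H _ _ hlt hij.symm
    clear hp hlast hv hmem
    generalize ((∅ : Set G), t, g) = c₀ at hpath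
    subst hvw
    induction m generalizing c₀ with
    | zero => exact fun i => i.elim0
    | succ m ih =>
      intro i j hij heq
      rw [interleave_succ, List.singleton_append] at hpath
      have hn := (capLeader_nu_unique hpath).2
      obtain ⟨j, rfl⟩ := (Fin.eq_zero_or_eq_succ j).resolve_left (Fin.ne_zero_of_lt hij)
      rcases Fin.eq_zero_or_eq_succ i with rfl | ⟨i, rfl⟩
      · refine hn ?_
        rw [heq]
        exact List.mem_append_left _ (List.mem_flatten.2 ⟨_, List.mem_ofFn.2 ⟨j, rfl⟩, by simp⟩)
      · obtain ⟨d, -, hd⟩ := hpath.split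
        obtain ⟨e, -, he⟩ := TransSys.Path.split (u := [Letter.nu (h 0)]) hd
        exact ih (fun j => h j.succ) (fun j => w j.succ) _ he i j (Fin.succ_lt_succ_iff.1 hij) heq
  refine ⟨m, h, hmem, h, w, g, hinj, hvw, hlast, fun i => ?_⟩
  obtain ⟨u₁, u₂, K, h1, h2⟩ := hp (h i) (hmem i)
  have h3 : (u₁ ++ .nu (h i) :: u₂).filter Letter.inDNu = v := by
    rw [← h1, List.filter_append, List.filter_append, List.filter_cons_of_pos rfl,
      List.filter_cons_of_pos rfl, List.filter_cons_of_neg Bool.false_ne_true]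
  obtain ⟨x, hx⟩ := exists_interleave_of_filter_insert h hinj w i (.contrib (.w (h i))) u₁ u₂
    (h3.trans hvw)
  refine ⟨_, x, K, ?_, h1, h2⟩
  rw [hx, interleave]
  simp only [List.append_assoc]

end Shape

/-! ### Reading a run as a run of the capacity systems -/

section Track

variable {G S S' T T' : Type*} {C : TransSys (ContribAct G) S} {D : TransSys (LeaderAct G) T}
  {ginit : G} {top : LeaderAct G} {n : ℕ}

namespace NamedRun

variable (r : NamedRun C D ginit top n)

/-- The values that contributors have written between the times `a` and `k`. -/
def capacityAt (a k : ℕ) : Set G := {h | ∃ j, a ≤ j ∧ j < k ∧ r.Writes j h}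

open Classical in
/-- The letters of the step at time `k` in the word of a cycle that begins at time `a`: the action
of the leader, or `ν(h)` if the step is the first write of `h`. -/
noncomputable def lettersAt (a k : ℕ) : List (Letter G) :=
  match r.ev k with
  | .inl none => []
  | .inl (some b) => [.leader b]
  | .inr (_, some (.w h)) => if h ∈ r.capacityAt a k then [] else [.nu h]
  | .inr (_, some (.r _)) => []
  | .inr (_, none) => []

/-- The word over `Σ_{D,ν}` of the steps between the times `b` and `c`. -/
noncomputable def wordBetween (a b c : ℕ) : List (Letter G) :=
  (List.range' b (c - b)).flatMap (r.lettersAt a)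

/-- What is known about the register value `γ` of a capacity system at time `k`. It need not be the
real one, because writes of values of the capacity are not seen. After a leader action it is. -/
def RegisterView (a k : ℕ) (γ : G) : Prop :=
  (γ = r.ρ k ∨ r.ρ k ∈ r.capacityAt a k) ∧
    ∀ j b, k = j + 1 → r.ev j = .inl (some b) → γ = (Letter.leader b).value

theorem capacityAt_self (a : ℕ) : r.capacityAt a a = ∅ := by
  ext h
  simp only [capacityAt, Set.mem_ofPred_eq, Set.mem_empty_iff_false, iff_false]
  rintro ⟨j, h1, h2, -⟩
  omega

theorem capacityAt_succ {a k : ℕ} (hk : a ≤ k) :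
    r.capacityAt a (k + 1) = r.capacityAt a k ∪ {h | r.Writes k h} := by
  ext h
  constructor
  · rintro ⟨j, h1, h2, h3⟩
    rcases Nat.lt_succ_iff_lt_or_eq.1 h2 with h2 | rfl
    · exact .inl ⟨j, h1, h2, h3⟩
    · exact .inr h3
  · rintro (⟨j, h1, h2, h3⟩ | h3)
    · exact ⟨j, h1, by omega, h3⟩
    · exact ⟨k, hk, Nat.lt_succ_self k, h3⟩

theorem capacityAt_succ_of_not_write {a k : ℕ} (hk : a ≤ k)
    (h : ∀ i h, r.ev k ≠ .inr (i, some (.w h))) : r.capacityAt a (k + 1) = r.capacityAt a k := by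
  rw [r.capacityAt_succ hk]
  ext x
  simp only [Set.mem_union, Set.mem_ofPred_eq, or_iff_left_iff_imp]
  rintro ⟨i, hi⟩
  exact absurd hi (h i x)

theorem capacityAt_succ_of_write {a k : ℕ} (hk : a ≤ k) {i : Fin n} {h : G}
    (hev : r.ev k = .inr (i, some (.w h))) :
    r.capacityAt a (k + 1) = r.capacityAt a k ∪ {h} := by
  rw [r.capacityAt_succ hk]
  congr 1
  ext x
  simp only [Writes, hev, Set.mem_ofPred_eq, Set.mem_singleton_iff]
  constructor
  · rintro ⟨j, hj⟩
    cases hj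
    rfl
  · rintro rfl
    exact ⟨i, rfl⟩

theorem wordBetween_self (a b : ℕ) : r.wordBetween a b b = [] := by simp [wordBetween]

theorem wordBetween_succ {a b c : ℕ} (h : b ≤ c) :
    r.wordBetween a b (c + 1) = r.wordBetween a b c ++ r.lettersAt a c := by
  rw [wordBetween, Nat.succ_sub h, Nat.succ_eq_add_one, List.range'_concat]
  simp [wordBetween, Nat.add_sub_cancel' h]

theorem wordBetween_append {a b c d : ℕ} (h : b ≤ c) (h' : c ≤ d) :
    r.wordBetween a b c ++ r.wordBetween a c d = r.wordBetween a b d := by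
  induction d, h' using Nat.le_induction with
  | base => simp [wordBetween_self]
  | succ d hd ih => rw [wordBetween_succ _ hd, wordBetween_succ _ (h.trans hd), ← ih,
      List.append_assoc]

theorem mem_wordBetween {a b c : ℕ} {x : Letter G} :
    x ∈ r.wordBetween a b c ↔ ∃ k, b ≤ k ∧ k < c ∧ x ∈ r.lettersAt a k := by
  simp only [wordBetween, List.mem_flatMap, List.mem_range'_1]
  constructor
  · rintro ⟨k, ⟨h1, h2⟩, h3⟩
    exact ⟨k, h1, by omega, h3⟩
  · rintro ⟨k, h1, h2, h3⟩
    exact ⟨k, ⟨h1, by omega⟩, h3⟩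

theorem inDNu_of_mem_lettersAt {a k : ℕ} {x : Letter G} (hx : x ∈ r.lettersAt a k) :
    x.inDNu = true := by
  unfold lettersAt at hx
  split at hx
  · simp at hx
  · rw [List.mem_singleton.1 hx]
    rfl
  · split at hx
    · simp at hx
    · rw [List.mem_singleton.1 hx]
      rfl
  · simp at hx
  · simp at hx

theorem writes_of_nu_mem_lettersAt {a k : ℕ} {h : G} (hx : Letter.nu h ∈ r.lettersAt a k) :
    r.Writes k h ∧ h ∉ r.capacityAt a k := by
  unfold lettersAt at hx
  split at hx
  · simp at hx
  · simp at hx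
  · next i h' hev =>
    split at hx
    · simp at hx
    · next hc =>
      have : h = h' := by simpa using hx
      subst this
      exact ⟨⟨i, hev⟩, hc⟩
  · simp at hx
  · simp at hx

variable {r}

/-- The capacity leader performs the letters of one step. -/
theorem RegisterView.capLeader_step {D' : TransSys (LeaderAct G) T'} {a k : ℕ} (hk : a ≤ k)
    {γ : G} (hγ : r.RegisterView a k γ) {s s' : T'}
    (hs : ∀ l, r.ev k = .inl l → D'.tr s l s' ∨ l = none ∧ s' = s)
    (hs' : ∀ x, r.ev k = .inr x → s' = s) :
    ∃ γ', (capLeader D' ginit).Path (r.capacityAt a k, s, γ) (r.lettersAt a k)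
      (r.capacityAt a (k + 1), s', γ') ∧ r.RegisterView a (k + 1) γ' := by
  rcases hev : r.ev k with l | ⟨i, l⟩
  · have hcap := r.capacityAt_succ_of_not_write hk (by simp [hev])
    obtain ⟨-, hreg, -⟩ := r.leader k l hev
    have hs := hs l hev
    rw [hcap, lettersAt, hev]
    cases hreg' : l with
    | none =>
      subst hreg'
      generalize hρ : r.ρ k = ρ at hreg
      generalize hρ' : r.ρ (k + 1) = ρ' at hreg
      cases hreg
      refine ⟨γ, ?_, ?_, ?_⟩
      · rcases hs with hs | ⟨-, rfl⟩
        · exact .silent (.silent hs) (.nil _)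
        · exact .nil _
      · rw [hcap, hρ', ← hρ]
        exact hγ.1
      · rintro j b hj hb
        obtain rfl : k = j := by omega
        rw [hev] at hb
        cases hb
    | some b =>
      subst hreg'
      have hs : D'.tr s (some b) s' := by simpa using hs
      have hval : r.ρ (k + 1) = (Letter.leader b).value := by
        generalize r.ρ k = ρ at hreg
        generalize r.ρ (k + 1) = ρ' at hreg
        cases hreg <;> rfl
      refine ⟨(Letter.leader b).value, ?_, .inl hval.symm, ?_⟩
      · cases b with
        | w h => exact .cons (.write hs) (.nil _)
        | r h =>
          refine .cons (.read hs ?_) (.nil _)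
          have : r.ρ k = h := by
            generalize r.ρ k = ρ at hreg
            generalize r.ρ (k + 1) = ρ' at hreg
            cases hreg
            rfl
          rcases hγ.1 with h1 | h1
          · exact .inr (this.symm.trans h1.symm)
          · exact .inl (this ▸ h1)
      · rintro j b' hj hb
        obtain rfl : k = j := by omega
        rw [hev] at hb
        cases hb
        rfl
  · obtain rfl := hs' _ hev
    obtain ⟨-, hreg, -⟩ := r.contrib k i l hev
    have hno : ∀ {γ : G} (j : ℕ) (b : LeaderAct G), k + 1 = j + 1 → r.ev j = .inl (some b) →
        γ = (Letter.leader b).value := by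
      intro γ j b hj hb
      obtain rfl : k = j := by omega
      rw [hev] at hb
      cases hb
    rw [lettersAt, hev]
    have same : (∀ h, l ≠ some (.w h)) → r.ρ (k + 1) = r.ρ k := by
      intro hl
      generalize r.ρ k = ρ at hreg
      generalize r.ρ (k + 1) = ρ' at hreg
      cases hreg with
      | silent => rfl
      | read => rfl
      | write => exact absurd rfl (hl ρ')
    match l, hev, hreg, same with
    | none, hev, _, same =>
      have hcap := r.capacityAt_succ_of_not_write hk (by simp [hev])
      rw [hcap]
      refine ⟨γ, .nil _, ?_, hno⟩
      rw [hcap, same (by simp)]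
      exact hγ.1
    | some (.r h), hev, _, same =>
      have hcap := r.capacityAt_succ_of_not_write hk (by simp [hev])
      rw [hcap]
      refine ⟨γ, .nil _, ?_, hno⟩
      rw [hcap, same (by simp)]
      exact hγ.1
    | some (.w h), hev, hreg, _ =>
      have hcap := r.capacityAt_succ_of_write hk hev
      have hval : r.ρ (k + 1) = h := by
        generalize r.ρ k = ρ at hreg
        generalize r.ρ (k + 1) = ρ' at hreg
        cases hreg
        rfl
      dsimp only
      by_cases hh : h ∈ r.capacityAt a k
      · rw [if_pos hh]
        refine ⟨γ, ?_, ?_, hno⟩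
        · rw [hcap, Set.union_eq_self_of_subset_right (by simpa using hh)]
          exact .nil _
        · rw [hcap, hval]
          exact .inr (.inr rfl)
      · rw [if_neg hh]
        refine ⟨h, ?_, ?_, hno⟩
        · rw [hcap]
          exact .cons (.nu hh) (.nil _)
        · exact .inl hval.symm

/-- The capacity contributor performs the letters of one step, whether or not the contributor itself
takes part in this step. -/
theorem RegisterView.capContrib_step {C' : TransSys (ContribAct G) S'} {a k : ℕ} (hk : a ≤ k)
    {γ : G} (hγ : r.RegisterView a k γ) {s s' : S'}
    (hs : s' = s ∨ ∃ i l, r.ev k = .inr (i, l) ∧ C'.tr s l s') :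
    ∃ u γ', u.filter Letter.inDNu = r.lettersAt a k ∧
      (capContrib C' ginit).Path (r.capacityAt a k, s, γ) u (r.capacityAt a (k + 1), s', γ') ∧
      r.RegisterView a (k + 1) γ' := by
  have hidle : s' = s → ∃ u γ', u.filter Letter.inDNu = r.lettersAt a k ∧
      (capContrib C' ginit).Path (r.capacityAt a k, s, γ) u (r.capacityAt a (k + 1), s', γ') ∧
      r.RegisterView a (k + 1) γ' := by
    rintro rfl
    -- the leader's transitions do not matter here, so the trivial leader is taken
    let D' : TransSys (LeaderAct G) Unit := ⟨fun _ _ _ => True, ()⟩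
    obtain ⟨γ', h1, h2⟩ := hγ.capLeader_step (ginit := ginit) (D' := D') hk (s := ()) (s' := ())
      (fun _ _ => .inl trivial) (fun _ _ => rfl)
    refine ⟨r.lettersAt a k, γ', List.filter_eq_self.2 fun x => r.inDNu_of_mem_lettersAt, ?_, h2⟩
    suffices H : ∀ c v c', (capLeader D' ginit).Path c v c' →
        (capContrib C' ginit).Path (c.1, s', c.2.2) v (c'.1, s', c'.2.2) from H _ _ _ h1
    intro c v c' hp
    induction hp with
    | nil => exact .nil _
    | silent hs _ ih =>
      cases hs with
      | silent => exact ih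
    | cons hs _ ih =>
      cases hs with
      | write => exact .cons .leaderWrite ih
      | read _ h => exact .cons (.leaderRead h) ih
      | nu => exact .cons .nu ih
  rcases hs with hs | ⟨i, l, hev, hs⟩
  · exact hidle hs
  · obtain ⟨-, hreg, -⟩ := r.contrib k i l hev
    have hno : ∀ {γ : G} (j : ℕ) (b : LeaderAct G), k + 1 = j + 1 → r.ev j = .inl (some b) →
        γ = (Letter.leader b).value := by
      intro γ j b hj hb
      obtain rfl : k = j := by omega
      rw [hev] at hb
      cases hb
    generalize hρ : r.ρ k = ρ at hreg
    generalize hρ' : r.ρ (k + 1) = ρ' at hreg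
    rw [lettersAt, hev]
    cases hreg with
    | silent =>
      have hcap := r.capacityAt_succ_of_not_write hk (by simp [hev])
      rw [hcap]
      refine ⟨[], γ, rfl, .silent (.contribSilent hs) (.nil _), ?_, hno⟩
      rw [hcap, hρ', ← hρ]
      exact hγ.1
    | read =>
      have hcap := r.capacityAt_succ_of_not_write hk (by simp [hev])
      rw [hcap]
      refine ⟨[.contrib (.r ρ)], ρ, rfl, .cons (.contribRead hs ?_) (.nil _), .inl hρ'.symm, hno⟩
      rcases hγ.1 with h1 | h1
      · exact .inr (hρ.symm.trans h1.symm)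
      · exact .inl (hρ ▸ h1)
    | write =>
      have hcap := r.capacityAt_succ_of_write hk hev
      rw [hcap]
      dsimp only
      by_cases hh : ρ' ∈ r.capacityAt a k
      · rw [if_pos hh, Set.union_eq_self_of_subset_right (by simpa using hh)]
        exact ⟨[.contrib (.w ρ')], ρ', rfl, .cons (.contribWrite hs hh) (.nil _), .inl hρ'.symm,
          hno⟩
      · rw [if_neg hh]
        exact ⟨[.nu ρ', .contrib (.w ρ')], ρ', rfl,
          .cons .nu (.cons (.contribWrite hs (.inr rfl)) (.nil _)), .inl hρ'.symm, hno⟩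

/-- The step of a capacity contributor that performs the first write of `h`. -/
theorem capContrib_first_write {C' : TransSys (ContribAct G) S'} {a k : ℕ}
    (hk : a ≤ k) {γ : G} {s s' : S'} {i : Fin n} {h : G}
    (hev : r.ev k = .inr (i, some (.w h))) (hh : h ∉ r.capacityAt a k)
    (hs : C'.tr s (some (.w h)) s') :
    r.lettersAt a k = [.nu h] ∧
      (capContrib C' ginit).Path (r.capacityAt a k, s, γ) [.nu h, .contrib (.w h)]
        (r.capacityAt a (k + 1), s', h) ∧
      r.RegisterView a (k + 1) h := by
  obtain ⟨-, hreg, -⟩ := r.contrib k i _ hev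
  refine ⟨?_, ?_, .inl ?_, ?_⟩
  · rw [lettersAt, hev]
    exact if_neg hh
  · rw [r.capacityAt_succ_of_write hk hev]
    exact .cons .nu (.cons (.contribWrite hs (.inr rfl)) (.nil _))
  · generalize r.ρ k = ρ at hreg
    generalize r.ρ (k + 1) = ρ' at hreg
    cases hreg
    rfl
  · intro j b hj hb
    obtain rfl : k = j := by omega
    rw [hev] at hb
    cases hb

theorem RegisterView.capLeader_path {D' : TransSys (LeaderAct G) T'} {a b c : ℕ} (hab : a ≤ b)
    (hbc : b ≤ c) {γ : G} (hγ : r.RegisterView a b γ) {s : ℕ → T'}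
    (hs : ∀ k, b ≤ k → k < c → ∀ l, r.ev k = .inl l →
      D'.tr (s k) l (s (k + 1)) ∨ l = none ∧ s (k + 1) = s k)
    (hs' : ∀ k, b ≤ k → k < c → ∀ x, r.ev k = .inr x → s (k + 1) = s k) :
    ∃ γ', (capLeader D' ginit).Path (r.capacityAt a b, s b, γ) (r.wordBetween a b c)
      (r.capacityAt a c, s c, γ') ∧ r.RegisterView a c γ' := by
  induction c, hbc using Nat.le_induction with
  | base =>
    rw [wordBetween_self]
    exact ⟨γ, .nil _, hγ⟩
  | succ c hc ih =>
    obtain ⟨γ', h1, h2⟩ := ih (fun k hk hk' => hs k hk (by omega))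
      (fun k hk hk' => hs' k hk (by omega))
    obtain ⟨γ'', h3, h4⟩ := h2.capLeader_step (ginit := ginit) (hab.trans hc)
      (hs c hc (Nat.lt_succ_self c)) (hs' c hc (Nat.lt_succ_self c))
    rw [wordBetween_succ _ hc]
    exact ⟨γ'', h1.append h3, h4⟩

theorem RegisterView.capContrib_path {C' : TransSys (ContribAct G) S'} {a b c : ℕ} (hab : a ≤ b)
    (hbc : b ≤ c) {γ : G} (hγ : r.RegisterView a b γ) {s : ℕ → S'}
    (hs : ∀ k, b ≤ k → k < c →
      s (k + 1) = s k ∨ ∃ i l, r.ev k = .inr (i, l) ∧ C'.tr (s k) l (s (k + 1))) :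
    ∃ u γ', u.filter Letter.inDNu = r.wordBetween a b c ∧
      (capContrib C' ginit).Path (r.capacityAt a b, s b, γ) u (r.capacityAt a c, s c, γ') ∧
      r.RegisterView a c γ' := by
  induction c, hbc using Nat.le_induction with
  | base =>
    rw [wordBetween_self]
    exact ⟨[], γ, rfl, .nil _, hγ⟩
  | succ c hc ih =>
    obtain ⟨u, γ', h0, h1, h2⟩ := ih (fun k hk hk' => hs k hk (by omega))
    obtain ⟨w, γ'', h3, h4, h5⟩ := h2.capContrib_step (ginit := ginit) (hab.trans hc)
      (hs c hc (Nat.lt_succ_self c))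
    refine ⟨u ++ w, γ'', ?_, h1.append h4, h5⟩
    rw [wordBetween_succ _ hc, List.filter_append, h0, h3]

end NamedRun

end Track

/-! ### Replacing the contributors of a run by copies -/

section Copies

variable {G S S' T J : Type*} [Fintype J] [DecidableEq J] {C₀ : TransSys (ContribAct G) S}
  {C : TransSys (ContribAct G) S'} {D : TransSys (LeaderAct G) T} {ginit : G} {top : LeaderAct G}
  {n : ℕ}

theorem multiStep_crowd {s : J → S'} {j : J} {x : S'} {l : Option (ContribAct G)}
    (h : C.tr (s j) l x) :
    MultiStep C (crowd (fun _ => 1) s) l (crowd (fun _ => 1) (Function.update s j x)) := by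
  obtain ⟨N, hN⟩ := crowd_split (fun _ => 1) s j
  have h0 := hN (s j)
  rw [Function.update_eq_self] at h0
  exact ⟨s j, x, N, h, by rw [h0, one_nsmul, Multiset.singleton_add],
    by rw [hN, one_nsmul, Multiset.singleton_add]⟩

/-- Each contributor may make a step, one after the other, if no step disturbs the register. -/
theorem reach_of_quiet {s s' : J → S'} {t : T} {g : G}
    (h : ∀ j, s' j = s j ∨ QuietStep C g (s j) (s' j)) :
    ReflTransGen (fun c₁ c₂ => ∃ a, CDStep C D c₁ a c₂) (crowd (fun _ => 1) s, t, g)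
      (crowd (fun _ => 1) s', t, g) := by
  refine pull_back_components (r := QuietStep C g) (s₁ := s')
    (Φ := fun s => ReflTransGen (fun c₁ c₂ => ∃ a, CDStep C D c₁ a c₂)
      (crowd (fun _ => 1) s, t, g) (crowd (fun _ => 1) s', t, g)) ?_ ?_ .refl
  · rintro s j x ⟨l, hl, hr⟩ hx
    exact .head ⟨_, CDStep.of_contrib (multiStep_crowd hl) hr⟩ hx
  · intro j
    rcases h j with h | h
    · rw [h]
    · exact .single h

/-- A family of contributors, each of which skips some of the actions that contributors perform in a
run, can take the place of the contributors of this run, provided that each write of the run is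
performed by one of them. -/
theorem NamedRun.reach_of_copies (r : NamedRun C₀ D ginit top n) (f : ℕ → J → S') (b : ℕ)
    (hf : ∀ k < b, ∀ j, f (k + 1) j = f k j ∨
      ∃ i l, r.ev k = .inr (i, l) ∧ C.tr (f k j) l (f (k + 1) j))
    (hw : ∀ k < b, ∀ i h, r.ev k = .inr (i, some (.w h)) →
      ∃ j, C.tr (f k j) (some (.w h)) (f (k + 1) j)) :
    ReflTransGen (fun c₁ c₂ => ∃ a, CDStep C D c₁ a c₂) (crowd (fun _ => 1) (f 0), r.t 0, r.ρ 0)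
      (crowd (fun _ => 1) (f b), r.t b, r.ρ b) := by
  induction b with
  | zero => exact .refl
  | succ b ih =>
    refine (ih (fun k hk => hf k (by omega)) (fun k hk => hw k (by omega))).trans ?_
    have hf := hf b (Nat.lt_succ_self b)
    have hw := hw b (Nat.lt_succ_self b)
    rcases hev : r.ev b with l | ⟨i, l⟩
    · obtain ⟨h1, h2, -⟩ := r.leader b l hev
      have : f (b + 1) = f b := by
        funext j
        refine (hf j).resolve_right ?_
        rintro ⟨i, l', h, -⟩
        rw [hev] at h
        cases h
      rw [this]
      exact .single ⟨_, CDStep.of_leader h1 h2⟩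
    · obtain ⟨-, hreg, ht, -⟩ := r.contrib b i l hev
      have hf' : ∀ j, f (b + 1) j = f b j ∨ C.tr (f b j) l (f (b + 1) j) := by
        intro j
        refine (hf j).imp_right ?_
        rintro ⟨i', l', h, h'⟩
        rw [hev] at h
        cases h
        exact h'
      rw [ht]
      generalize r.ρ b = ρ at hreg
      generalize r.ρ (b + 1) = ρ' at hreg
      cases hreg with
      | silent => exact reach_of_quiet fun j => (hf' j).imp_right fun h => ⟨_, h, .silent _⟩
      | read => exact reach_of_quiet fun j => (hf' j).imp_right fun h => ⟨_, h, .read _⟩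
      | write =>
        -- after one of the copies has written, the other copies do not change the register
        obtain ⟨j₀, hj₀⟩ := hw i ρ' hev
        refine .head ⟨_, CDStep.of_contrib (multiStep_crowd hj₀) (.write ρ ρ')⟩ ?_
        refine reach_of_quiet fun j => ?_
        rcases eq_or_ne j j₀ with rfl | hne
        · exact .inl (by simp)
        · rw [Function.update_of_ne hne]
          exact (hf' j).imp_right fun hj => ⟨_, hj, .write _ _⟩

end Copies

/-! ### Cutting a cycle out of a run -/

section Strip

variable {A Q Γ : Type*} {P : Pushdown A Q Γ} {ℓ : ℕ → Option (Option A)} {f : ℕ → Q × List Γ}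

/-- From a time on after which the stack never is lower, the symbols below the topmost one can be
removed. -/
theorem Performs.exists_strip (hf : Performs P.toTransSys ℓ f) {a : ℕ} {q : Q} {X : Γ}
    {α : List Γ} (ha : f a = (q, X :: α)) (hmin : ∀ t, a ≤ t → (f a).2.length ≤ (f t).2.length) :
    ∃ s : ℕ → Q × List Γ, s a = (q, [X]) ∧
      (∀ k, a ≤ k → (s k).2 ≠ [] ∧ f k = ((s k).1, (s k).2 ++ α)) ∧
      ∀ k, a ≤ k → (ℓ k = none ∧ s (k + 1) = s k) ∨
        ∃ l, ℓ k = some l ∧ P.toTransSys.tr (s k) l (s (k + 1)) := by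
  have hmin' : ∀ t, a ≤ t → α.length < (f t).2.length := by
    intro t ht
    have := hmin t ht
    rw [ha] at this
    exact this
  have hex : ∀ k, ∃ s : Q × List Γ, a ≤ k → s.2 ≠ [] ∧ f k = (s.1, s.2 ++ α) := by
    intro k
    by_cases hk : a ≤ k
    swap
    · exact ⟨(q, []), fun h => absurd h hk⟩
    induction k, hk using Nat.le_induction with
    | base => exact ⟨(q, [X]), fun _ => ⟨by simp, ha⟩⟩
    | succ k hk ih =>
      obtain ⟨s, hs⟩ := ih
      obtain ⟨hne, hfk⟩ := hs hk
      rcases hf k with ⟨-, h⟩ | ⟨l, -, q₀, Y, γ, q', β, h1, h2, -⟩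
      · exact ⟨s, fun _ => ⟨hne, by rw [h, hfk]⟩⟩
      · obtain ⟨Z, δ, hZ⟩ := List.exists_cons_of_ne_nil hne
        have hγ : γ = δ ++ α := by
          rw [hfk, hZ] at h1
          simp only [List.cons_append, Prod.mk.injEq, List.cons.injEq] at h1
          exact h1.2.2.symm
        refine ⟨(q', β ++ δ), fun h => ⟨?_, by rw [h2, hγ, List.append_assoc]⟩⟩
        intro h0
        have := hmin' (k + 1) h
        rw [h2, hγ, ← List.append_assoc, show β ++ δ = [] from h0] at this
        simp at this
  choose s hs using hex
  refine ⟨s, ?_, hs, fun k hk => ?_⟩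
  · have h := (hs a le_rfl).2
    rw [ha] at h
    simp only [Prod.mk.injEq] at h
    have h2 : s a = ((s a).1, (s a).2) := rfl
    rw [h2, ← h.1, ← List.append_cancel_right (as := [X]) (bs := α) h.2]
  · obtain ⟨hne, hfk⟩ := hs k hk
    obtain ⟨-, hfk'⟩ := hs (k + 1) (by omega)
    rcases hf k with ⟨h0, h⟩ | ⟨l, hl, q₀, Y, γ, q', β, h1, h2, h3⟩
    · refine .inl ⟨h0, ?_⟩
      rw [hfk, hfk'] at h
      simp only [Prod.mk.injEq, List.append_cancel_right_eq] at h
      exact Prod.ext h.1 h.2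
    · refine .inr ⟨l, hl, q₀, Y, ?_⟩
      obtain ⟨Z, δ, hZ⟩ := List.exists_cons_of_ne_nil hne
      rw [hfk, hZ] at h1
      simp only [List.cons_append, Prod.mk.injEq, List.cons.injEq] at h1
      obtain ⟨e1, e2, e3⟩ := h1
      rw [hfk', ← e3, ← List.append_assoc] at h2
      simp only [Prod.mk.injEq, List.append_cancel_right_eq] at h2
      exact ⟨δ, q', β, Prod.ext e1 (by rw [hZ, e2]), Prod.ext h2.1 h2.2, h3⟩

end Strip

section Cycle

variable {G QC ΓC QD ΓD : Type*} [Fintype QC] [Fintype ΓC]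
  {AC : Pushdown (ContribAct G) QC ΓC} {AD : Pushdown (LeaderAct G) QD ΓD} {ginit : G}
  {top : LeaderAct G} {n : ℕ} {r : NamedRun AC.toTransSys AD.toTransSys ginit top n}
  {base base₁ base₂ bound bound₁ bound₂ : ℕ} {ty : CheckpointType r}

namespace Checkpoint

theorem base_le_last (c : Checkpoint r base ty bound) : base ≤ c.last := by
  obtain ⟨k, h1, h2, -⟩ := c.exists_top
  exact h1.trans h2

theorem value (c : Checkpoint r base ty bound) : r.ρ (c.last + 1) = ty.1 := by
  obtain ⟨-, h, -⟩ := r.leader _ _ c.ev_last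
  rw [← c.value_act]
  generalize r.ρ c.last = ρ at h
  generalize r.ρ (c.last + 1) = ρ' at h
  generalize c.act = b at h
  cases h <;> rfl

theorem registerView (c : Checkpoint r base ty bound) (a : ℕ) :
    r.RegisterView a (c.last + 1) ty.1 := by
  refine ⟨.inl c.value.symm, fun j b hj hb => ?_⟩
  obtain rfl : c.last = j := by omega
  rw [c.ev_last] at hb
  cases hb
  exact c.value_act.symm

/-- The register of a capacity system agrees with the real one at a checkpoint, since the leader has
just acted. -/
theorem eq_value (c : Checkpoint r base ty bound) {a : ℕ} {γ : G}
    (h : r.RegisterView a (c.last + 1) γ) : γ = ty.1 := by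
  rw [← c.value_act]
  exact h.2 _ _ rfl c.ev_last

/-- The leader's part of the run between two checkpoints of the same type is a cycle of the capacity
leader, except for the part of the stack below the topmost symbol. -/
theorem exists_leader_cycle (c₁ : Checkpoint r base₁ ty bound₁) (c₂ : Checkpoint r base₂ ty bound₂)
    (hb : bound₁ ≤ base₂) :
    ∃ K α', (capLeader AD.toTransSys ginit).Path (∅, (ty.2.1.1, [ty.2.1.2]), ty.1)
      (r.wordBetween (c₁.last + 1) (c₁.last + 1) (c₂.last + 1))
      (K, (ty.2.1.1, ty.2.1.2 :: α'), ty.1) := by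
  obtain ⟨s, hs1, hs2, hs3⟩ := r.performs_leader.exists_strip c₁.leader_top c₁.leader_min
  have hle := c₁.last_lt
  have hle1 := c₁.μ_le
  have hle2 := c₂.base_le_last
  have hle3 := c₂.last_lt
  -- silent steps of the leader before time `μ` belong to the run that leads to the cycle; on the
  -- cycle the leader is already in its state at time `μ`
  obtain ⟨γ, hpath, hγ⟩ := (c₁.registerView (c₁.last + 1)).capLeader_path (D' := AD.toTransSys)
    (ginit := ginit) (b := c₁.last + 1) (c := c₂.last + 1) le_rfl (by omega)
    (s := fun k => s (max k c₁.μ))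
    (fun k h1 h2 l hl => by
      rcases lt_or_ge k c₁.μ with hk | hk
      · refine .inr ⟨c₁.silent k h1 hk l hl, ?_⟩
        simp only [max_eq_right hk.le, max_eq_right (Nat.succ_le_of_lt hk)]
      · simp only [max_eq_left hk, max_eq_left (hk.trans (Nat.le_succ k))]
        have hl := r.leaderLabel_eq_some.2 hl
        rcases hs3 k hk with ⟨h, -⟩ | ⟨l', h, h'⟩
        · rw [hl] at h
          cases h
        · rw [hl] at h
          cases h
          exact .inl h')
    (fun k h1 h2 x hx => by
      rcases lt_or_ge k c₁.μ with hk | hk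
      · simp only [max_eq_right hk.le, max_eq_right (Nat.succ_le_of_lt hk)]
      · simp only [max_eq_left hk, max_eq_left (hk.trans (Nat.le_succ k))]
        rcases hs3 k hk with ⟨-, h⟩ | ⟨l', h, -⟩
        · exact h
        · rw [r.leaderLabel_eq_some, hx] at h
          cases h)
  obtain rfl := c₂.eq_value hγ
  simp only [max_eq_right (Nat.succ_le_of_lt hle),
    max_eq_left (show c₁.μ ≤ c₂.last + 1 by omega), hs1, r.capacityAt_self] at hpath
  -- correspondingly, the silent steps up to the second time `μ` are added at the end
  have htail : ∀ k, c₂.last + 1 ≤ k → k ≤ c₂.μ → ∀ K,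
      (capLeader AD.toTransSys ginit).Path (K, s (c₂.last + 1), ty.1) [] (K, s k, ty.1) := by
    intro k hk hk' K
    induction k, hk using Nat.le_induction with
    | base => exact .nil _
    | succ k hk ih =>
      have ih := ih (by omega)
      rcases hs3 k (by omega) with ⟨-, h⟩ | ⟨l, h, h'⟩
      · rw [h]
        exact ih
      · obtain rfl := c₂.silent k hk (by omega) l (r.leaderLabel_eq_some.1 h)
        have := ih.append (v := []) (.silent (.silent h') (.nil _))
        exact this
  have hend := hpath.append (htail c₂.μ (by omega) le_rfl _)
  rw [List.append_nil] at hend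
  obtain ⟨hne, hsμ⟩ := hs2 c₂.μ (by omega)
  obtain ⟨Z, δ, hZ⟩ := List.exists_cons_of_ne_nil hne
  rw [c₂.leader_top, hZ] at hsμ
  simp only [List.cons_append, Prod.mk.injEq, List.cons.injEq] at hsμ
  have heq : s c₂.μ = (ty.2.1.1, ty.2.1.2 :: δ) :=
    Prod.ext hsμ.1.symm (by rw [hZ, hsμ.2.1])
  rw [heq] at hend
  exact ⟨_, _, hend⟩

/-- Between two checkpoints of the same type, the contributor in charge of the value `h` can be
shortened to a cycle of the capacity contributor in which it performs the first write of `h`. -/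
theorem exists_contrib_cycle (hAC : AC.PushPop) (c₁ : Checkpoint r base₁ ty bound₁)
    (c₂ : Checkpoint r base₂ ty bound₂) (hb : bound₁ ≤ base₂) (h : r.recurrentValues) :
    ∃ u₁ u₂ K, (u₁ ++ .nu h.1 :: .contrib (.w h.1) :: u₂).filter Letter.inDNu =
        r.wordBetween (c₁.last + 1) (c₁.last + 1) (c₂.last + 1) ∧
      (capContrib AC.finiteContrib ginit).Path (∅, (ty.2.2 h).2, ty.1)
        (u₁ ++ .nu h.1 :: .contrib (.w h.1) :: u₂) (K, (ty.2.2 h).2, ty.1) := by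
  have h1 := c₁.last_lt_write h
  have h2 := c₁.write_lt_after h
  have h3 := c₁.after_le h
  have h4 := c₂.base_le_before (ty.2.2 h).1
  have h5 := c₂.before_le_last (ty.2.2 h).1
  -- the designated write is the one at time `c₁.write h`; the one after the cycle, which `c₂`
  -- refers to, is not needed
  have hrun := ((c₁.lazy_after h).trans ((r.performs_contrib _).lazyRun_topConf hAC
    (show c₁.after h ≤ c₂.before (ty.2.2 h).1 by omega) (fun t ht _ => c₁.after_min h t ht)
    (c₁.write h))).trans ((c₂.lazy_before h).mono (D' := {c₁.write h}) (fun t ht _ ht' => by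
      rw [Set.mem_singleton_iff] at ht'
      omega))
  obtain ⟨s, hs1, hs2, hs3⟩ := hrun.exists_states
  have hstep : ∀ k, c₁.last + 1 ≤ k → k < c₂.last + 1 → s (k + 1) = s k ∨
      ∃ i l, r.ev k = .inr (i, l) ∧ AC.finiteContrib.tr (s k) l (s (k + 1)) := by
    intro k hk hk'
    rcases hs3 k hk hk' with ⟨-, h⟩ | ⟨l, hl, h⟩
    · exact .inl h
    · exact .inr ⟨_, l, r.contribLabel_eq_some.1 hl, h⟩
  have hd : AC.finiteContrib.tr (s (c₁.write h)) (some (.w h.1)) (s (c₁.write h + 1)) := by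
    have hl := r.contribLabel_eq_some.2 (c₁.ev_write h)
    rcases hs3 (c₁.write h) h1 (by omega) with ⟨h', -⟩ | ⟨l, hl', h'⟩
    · rw [h' rfl] at hl
      cases hl
    · rw [hl] at hl'
      cases hl'
      exact h'
  have hnew : h.1 ∉ r.capacityAt (c₁.last + 1) (c₁.write h) := by
    rintro ⟨j, hj1, hj2, hj3⟩
    exact c₁.first h j hj1 hj2 hj3
  obtain ⟨u₁, γ₁, e1, p1, v1⟩ := (c₁.registerView (c₁.last + 1)).capContrib_path
    (ginit := ginit) (c := c₁.write h) le_rfl h1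
    (fun k hk hk' => hstep k hk (by omega))
  obtain ⟨e2, p2, v2⟩ := NamedRun.capContrib_first_write (ginit := ginit) (γ := γ₁)
    (show c₁.last + 1 ≤ c₁.write h from h1) (c₁.ev_write h) hnew hd
  obtain ⟨u₂, γ₂, e3, p3, v3⟩ := v2.capContrib_path (ginit := ginit) (by omega)
    (show c₁.write h + 1 ≤ c₂.last + 1 by omega) (fun k hk hk' => hstep k (by omega) hk')
  obtain rfl := c₂.eq_value v3
  rw [hs1, r.capacityAt_self] at p1
  rw [hs2] at p3
  refine ⟨u₁, u₂, _, ?_, p1.append (p2.append p3)⟩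
  rw [← r.wordBetween_append (show c₁.last + 1 ≤ c₁.write h + 1 by omega) (by omega),
    r.wordBetween_succ (by omega), e2, List.filter_append, e1, List.filter_cons_of_pos rfl,
    List.filter_cons_of_neg Bool.false_ne_true, e3, List.append_assoc]
  rfl

end Checkpoint

/-- Some truncated contributor performs a given write of the run. -/
theorem NamedRun.exists_copy_of_write (hAC : AC.PushPop)
    (r : NamedRun AC.toTransSys AD.toTransSys ginit top n) (d : ℕ) {i : Fin n}
    {l : Option (ContribAct G)} (hd : r.ev d = .inr (i, l)) :
    ∃ s : ℕ → {s : QC × List ΓC // s.2.length ≤ stackBound QC ΓC}, s 0 = AC.finiteContrib.init ∧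
      (∀ k, s (k + 1) = s k ∨
        ∃ i l, r.ev k = .inr (i, l) ∧ AC.finiteContrib.tr (s k) l (s (k + 1))) ∧
      AC.finiteContrib.tr (s d) l (s (d + 1)) := by
  obtain ⟨htr, -⟩ := r.contrib d i l hd
  obtain ⟨q, X, α, q', β, h1, h2, h3⟩ := htr
  have hβ : β.length ≤ stackBound QC ΓC := (hAC _ h3).trans (Nat.le_add_left _ _)
  have hlazy := (r.performs_contrib i).lazyRun_init hAC (b := d) (r.x_zero i)
    (by rw [h1]; simp) d
  obtain ⟨s, hs1, hs2, hs3⟩ := hlazy.exists_states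
  have hstep : AC.finiteContrib.tr (s d) l ⟨(q', β), hβ⟩ := by
    rw [hs2]
    refine ⟨[], q, X, [], q', β, ?_, by simp, h3⟩
    simp [topConf, h1]
  refine ⟨fun k => if k ≤ d then s k else ⟨(q', β), hβ⟩, by simp [hs1], fun k => ?_, ?_⟩
  · rcases lt_trichotomy k d with hk | rfl | hk
    · simp only [hk.le, Nat.succ_le_of_lt hk, if_true]
      rcases hs3 k (Nat.zero_le k) hk with ⟨-, h⟩ | ⟨l', hl, h⟩
      · exact .inl h
      · exact .inr ⟨i, l', r.contribLabel_eq_some.1 hl, h⟩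
    · refine .inr ⟨i, l, hd, ?_⟩
      simpa using hstep
    · simp [hk.not_ge, (hk.trans (Nat.lt_succ_self k)).not_ge]
  · simpa using hstep

/-- A contributor that reaches the state which the type of a checkpoint gives for the value `h`. -/
theorem Checkpoint.exists_copy (hAC : AC.PushPop) (c : Checkpoint r base ty bound)
    (h : r.recurrentValues) :
    ∃ s : ℕ → {s : QC × List ΓC // s.2.length ≤ stackBound QC ΓC}, s 0 = AC.finiteContrib.init ∧
      s (c.last + 1) = (ty.2.2 h).2 ∧
      ∀ k ≤ c.last, s (k + 1) = s k ∨
        ∃ i l, r.ev k = .inr (i, l) ∧ AC.finiteContrib.tr (s k) l (s (k + 1)) := by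
  have h1 := c.last_lt_write h
  have h2 := c.before_le_last (ty.2.2 h).1
  have hne : (r.x (c.before (ty.2.2 h).1) (ty.2.2 h).1).2 ≠ [] := by
    intro he
    have hw := ((r.performs_contrib _).of_stack_empty
      (show c.before (ty.2.2 h).1 ≤ c.write h by omega) he).2
    rw [r.contribLabel_eq_some.2 (c.ev_write h)] at hw
    cases hw
  obtain ⟨s, hs1, hs2, hs3⟩ := (((r.performs_contrib _).lazyRun_init hAC
    (r.x_zero _) hne _).trans (c.lazy_before h)).exists_states
  refine ⟨s, hs1, hs2, fun k hk => ?_⟩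
  rcases hs3 k (Nat.zero_le k) (by omega) with ⟨-, h⟩ | ⟨l', hl, h⟩
  · exact .inl h
  · exact .inr ⟨_, l', r.contribLabel_eq_some.1 hl, h⟩

/-- The truncated system can reach a checkpoint, with a contributor for each of given recurrent
values in the state that the type of the checkpoint prescribes. -/
theorem Checkpoint.exists_reachable (hAC : AC.PushPop) (c : Checkpoint r base ty bound) {m : ℕ}
    (h : Fin m → r.recurrentValues) :
    ∃ M, CDReachable AC.finiteContrib AD.toTransSys ginit
        (M, (ty.2.1.1, ty.2.1.2 :: c.rest), ty.1) ∧
      (List.ofFn fun i => (ty.2.2 (h i)).2 : Multiset _) ≤ M := by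
  classical
  have hw : ∀ d, ∃ s : ℕ → {s : QC × List ΓC // s.2.length ≤ stackBound QC ΓC},
      s 0 = AC.finiteContrib.init ∧ (∀ k, s (k + 1) = s k ∨
        ∃ i l, r.ev k = .inr (i, l) ∧ AC.finiteContrib.tr (s k) l (s (k + 1))) ∧
      ∀ i l, r.ev d = .inr (i, l) → AC.finiteContrib.tr (s d) l (s (d + 1)) := by
    intro d
    rcases hev : r.ev d with l | ⟨i, l⟩
    · exact ⟨fun _ => AC.finiteContrib.init, rfl, fun _ => .inl rfl, by simp⟩
    · obtain ⟨s, h1, h2, h3⟩ := r.exists_copy_of_write hAC d hev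
      refine ⟨s, h1, h2, ?_⟩
      rintro _ _ ⟨⟩
      exact h3
  choose w hw1 hw2 hw3 using hw
  choose z hz1 hz2 hz3 using fun i => c.exists_copy hAC (h i)
  -- one copy for each time at which a write might happen, and the contributors that are asked for
  let f : ℕ → Fin (c.last + 1) ⊕ Fin m → {s : QC × List ΓC // s.2.length ≤ stackBound QC ΓC} :=
    fun k => Sum.elim (fun d => w d k) fun i => z i k
  have hreach := r.reach_of_copies (C := AC.finiteContrib) f (c.last + 1)
    (by
      rintro k hk (d | i)
      · exact hw2 d k
      · exact hz3 i k (by omega))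
    (fun k hk i x hx => ⟨.inl ⟨k, hk⟩, hw3 k i _ hx⟩)
  have hinit : crowd (fun _ => 1) (f 0) =
      Multiset.replicate (Fintype.card (Fin (c.last + 1) ⊕ Fin m)) AC.finiteContrib.init := by
    have : f 0 = fun _ => AC.finiteContrib.init := by
      funext j
      rcases j with d | i
      · exact hw1 d
      · exact hz1 i
    rw [this, crowd]
    simp [Multiset.nsmul_singleton]
  rw [hinit, r.t_zero, r.ρ_zero, c.value] at hreach
  have htail : ∀ k, c.last + 1 ≤ k → k ≤ c.μ → ReflTransGen
      (fun c₁ c₂ => ∃ a, CDStep AC.finiteContrib AD.toTransSys c₁ a c₂)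
      (crowd (fun _ => 1) (f (c.last + 1)), r.t (c.last + 1), ty.1)
      (crowd (fun _ => 1) (f (c.last + 1)), r.t k, ty.1) := by
    intro k hk hk'
    induction k, hk using Nat.le_induction with
    | base => exact .refl
    | succ k hk ih =>
      have ih := ih (by omega)
      rcases r.performs_leader k with ⟨-, h⟩ | ⟨l, h, h'⟩
      · rw [h]
        exact ih
      · obtain rfl := c.silent k hk (by omega) l (r.leaderLabel_eq_some.1 h)
        exact ih.tail ⟨_, .leaderSilent h'⟩
  have hend := hreach.trans (htail c.μ c.last_lt le_rfl)
  rw [c.leader_top] at hend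
  refine ⟨_, ⟨_, hend⟩, ?_⟩
  calc (List.ofFn fun i => (ty.2.2 (h i)).2 : Multiset _)
      = ∑ i : Fin m, {z i (c.last + 1)} := by
        simp only [Multiset.coe_ofFn_eq_sum, hz2]
    _ ≤ crowd (fun _ => 1) (f (c.last + 1)) := by
        rw [crowd, Fintype.sum_sum_type]
        simp only [one_nsmul]
        exact Multiset.le_add_left _ _

end Cycle

/-! ### Büchi runs yield supported cycles -/

section Result

variable {G QC ΓC QD ΓD : Type*} [Finite G] [Fintype QC] [Fintype ΓC] [Finite QD] [Finite ΓD]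

/-- A Büchi run passes through two checkpoints of the same type, and the part between them can be
shortened to a supported cycle. -/
theorem exists_supported_cycle {AC : Pushdown (ContribAct G) QC ΓC}
    {AD : Pushdown (LeaderAct G) QD ΓD} {ginit : G} {top : LeaderAct G} (hAC : AC.PushPop)
    (hrun : HasBuchiRun AC.toTransSys AD.toTransSys ginit top) :
    ∃ (M : Multiset {s : QC × List ΓC // s.2.length ≤ stackBound QC ΓC})
      (q : QD) (A : ΓD) (α : List ΓD) (g : G) (v : List (Letter G)),
      CDReachable AC.finiteContrib AD.toTransSys ginit (M, (q, A :: α), g) ∧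
      (∀ a ∈ v, a.inDNu = true) ∧
      (∃ (K : Set G) (α' : List ΓD),
        (capLeader AD.toTransSys ginit).Path (∅, (q, [A]), g) v (K, (q, A :: α'), g)) ∧
      Letter.leader top ∈ v ∧
      ∃ (m : ℕ) (p : Fin m → {s : QC × List ΓC // s.2.length ≤ stackBound QC ΓC}),
        OmegaSupported AC.finiteContrib ginit v p ∧ (List.ofFn p : Multiset _) ≤ M := by
  classical
  obtain ⟨n, ⟨r⟩⟩ := hrun.exists_namedRun
  obtain ⟨a, ha⟩ := r.exists_forall_writes_recurrent
  obtain ⟨ty, hty⟩ := exists_recurrent_checkpoint hAC r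
  obtain ⟨base₁, bound₁, hb₁, ⟨c₁⟩⟩ := hty a
  obtain ⟨base₂, bound₂, hb₂, ⟨c₂⟩⟩ := hty bound₁
  have hle1 := c₁.base_le_last
  have hle2 := c₁.last_lt
  have hle3 := c₁.μ_le
  obtain ⟨K, α', hpath⟩ := c₁.exists_leader_cycle c₂ hb₂
  have hnu : ∀ x, Letter.nu x ∈ r.wordBetween (c₁.last + 1) (c₁.last + 1) (c₂.last + 1) →
      x ∈ r.recurrentValues := by
    intro x hx
    obtain ⟨k, hk, -, hx⟩ := r.mem_wordBetween.1 hx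
    exact ha k (by omega) x (r.writes_of_nu_mem_lettersAt hx).1
  have htop : Letter.leader top ∈ r.wordBetween (c₁.last + 1) (c₁.last + 1) (c₂.last + 1) := by
    obtain ⟨k, h1, h2, h3⟩ := c₂.exists_top
    refine r.mem_wordBetween.2 ⟨k, by omega, by omega, ?_⟩
    rw [NamedRun.lettersAt, h3]
    exact List.mem_singleton_self _
  have hDNu : ∀ x ∈ r.wordBetween (c₁.last + 1) (c₁.last + 1) (c₂.last + 1),
      x.inDNu = true := by
    intro x hx
    obtain ⟨k, -, -, hx⟩ := r.mem_wordBetween.1 hx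
    exact r.inDNu_of_mem_lettersAt hx
  generalize hv : r.wordBetween (c₁.last + 1) (c₁.last + 1) (c₂.last + 1) = v at *
  have hlast : lastValue v = some ty.1 := by
    have h := capLeader_register hpath
    cases v with
    | nil => simp at htop
    | cons b v =>
      rw [lastValue_cons] at h ⊢
      exact congrArg some h.symm
  -- the value of `p` outside the recurrent values is arbitrary
  let p : G → {s : QC × List ΓC // s.2.length ≤ stackBound QC ΓC} := fun x =>
    if hx : x ∈ r.recurrentValues then (ty.2.2 ⟨x, hx⟩).2 else AC.finiteContrib.init
  have hp : ∀ x (hx : x ∈ r.recurrentValues), p x = (ty.2.2 ⟨x, hx⟩).2 := fun x hx => dif_pos hx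
  obtain ⟨m, h, hmem, hω⟩ := exists_omegaSupported (C := AC.finiteContrib) hDNu hlast hpath p
    fun x hx => by
      rw [hp x (hnu x hx), ← hv]
      exact c₁.exists_contrib_cycle hAC c₂ hb₂ ⟨x, hnu x hx⟩
  obtain ⟨M, hM, hle⟩ := c₁.exists_reachable hAC fun i => ⟨h i, hnu _ (hmem i)⟩
  refine ⟨M, _, _, _, _, v, hM, hDNu, ⟨K, α', hpath⟩, htop, m, _, hω, ?_⟩
  simpa only [hp _ (hnu _ (hmem _))] using hle

end Result

theorem mainTheorem6 {G QC ΓC QD ΓD : Type*}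
    [Fintype G] [Fintype QC] [Fintype ΓC] [Fintype QD] [Fintype ΓD]
    (AC : Pushdown (ContribAct G) QC ΓC) (AD : Pushdown (LeaderAct G) QD ΓD)
    (ginit : G) (top : LeaderAct G) (hAC : AC.PushPop) :
    HasBuchiRun AC.toTransSys AD.toTransSys ginit top ↔
      ∃ (M : Multiset {s : QC × List ΓC // s.2.length ≤ stackBound QC ΓC})
        (q : QD) (A : ΓD) (α : List ΓD) (g : G) (v : List (Letter G)),
        CDReachable AC.finiteContrib AD.toTransSys ginit (M, (q, A :: α), g) ∧
        (∀ a ∈ v, a.inDNu = true) ∧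
        (∃ (K : Set G) (α' : List ΓD),
          (capLeader AD.toTransSys ginit).Path (∅, (q, [A]), g) v (K, (q, A :: α'), g)) ∧
        Letter.leader top ∈ v ∧
        ∃ (m : ℕ) (p : Fin m → {s : QC × List ΓC // s.2.length ≤ stackBound QC ΓC}),
          OmegaSupported AC.finiteContrib ginit v p ∧
          (List.ofFn p : Multiset _) ≤ M := by
  constructor
  · exact exists_supported_cycle hAC
  · rintro ⟨M, q, A, α, g, v, hM, -, ⟨K, α', hpath⟩, htop, m, p, hω, hle⟩
    exact .of_truncated (hasBuchiRun_of_supported_cycle hM hpath htop hω hle)
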